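/- Let $k$ be an algebraically closed field of characteristic zero. For a finite-dimensional vector space $W$, a subalgebra $P\subset\operatorname{End}(W)$ is called parabolic if in some basis of $W$ it is a standard parabolic subalgebra, i.e. the span of all upper triangular matrices and of the matrix units $e_{ji}$ with $(i,j)\in\Pi$, where $\Pi\subset\{(i,j)\mid i<j\}$ is such that for all $i<j<l$ one has $(i,l)\in\Pi$ if and only if $(i,j)\in\Pi$ and $(j,l)\in\Pi$. Let $J(P)$ be the Jacobson radical of $P$, let $L(P)=P/J(P)$, and let $\pi_L:P\to L(P)$ be the projection. For parabolic subalgebras $P_1\subset\operatorname{End}(W_1)$, $P_2\subset\operatorname{End}(W_2)$, with $\dim W_1=\dim W_2=n$, and an isomorphism of $k$-algebras $\phi:L(P_1)\to L(P_2)$, put $$I(P_1,P_2,\phi)=\{(a,b)\in P_1\oplus P_2\mid \pi_L(b)=\phi(\pi_L(a))\}.$$ Let $C$ be the irreducible nodal curve of arithmetic genus $1$ over $k$, obtained from $\mathbb P^1$ by gluing the points $0$ and $\infty$ into a node $q$, let $\pi:\mathbb P^1\to C$ be the normalization, and let $\omega_C$ be the dualizing sheaf of $C$: its sections over $U$ are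 the rational differentials on $\mathbb P^1$ that are regular on $\pi^{-1}(U)\setminus\{0,\infty\}$ and, if $q\in U$, have at most simple poles at $0$ and $\infty$, with opposite residues. An order over $C$ is a torsion free coherent sheaf $\mathcal A$ of $\mathcal O_C$-algebras whose stalk at the generic point is a matrix algebra (of positive size) over the field of rational functions on $C$. It is called a symmetric spherical order if $H^0(C,\mathcal O_C)=k$, there is a nonzero morphism $\tau:\mathcal A\to\omega_C$ of $\mathcal O_C$-modules, unique up to rescaling, the induced morphism $\mathcal A\to\underline{\operatorname{Hom}}(\mathcal A,\omega_C)$, $y\mapsto(x\mapsto\tau(xy))$, is an isomorphism, and $\tau(xy)=\tau(yx)$. For a vector bundle $\mathcal V$ of rank $n\ge 1$ over $\mathbb P^1$ and a subalgebra $I\subset\operatorname{End}(\mathcal V|_0)\oplus\operatorname{End}(\mathcal V|_\infty)$, let $\mathcal A(\mathcal V,I)\subset\pi_*\underline{\operatorname{End}}(\mathcal V)$ be the subsheaf of those sections $a$ for which $(a(0),a(\infty))\in I$ (a condition only over open sets containing $q$). Then: 1. For all $n$-dimensional $W_1,W_2$ and all $P_1,P_2,\phi$ as above, $I(P_1,P_2,\phi)$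 is a maximal isotropic subalgebra of $\operatorname{End}(W_1)\oplus\operatorname{End}(W_2)$ (i.e. a subalgebra that is maximal among the isotropic subspaces) with respect to the pairing $\langle(a,b),(a',b')\rangle=\operatorname{tr}(aa')-\operatorname{tr}(bb')$. 2. For every unital subalgebra $I\subset\operatorname{End}(\mathcal V|_0)\oplus\operatorname{End}(\mathcal V|_\infty)$ that is maximal isotropic with respect to this pairing, $\mathcal A(\mathcal V,I)$ is an order over $C$; if $h^0(\mathcal A(\mathcal V,I))=1$, then it is a symmetric spherical order over $C$ and its center is $\mathcal O_C$. 3. In particular, for parabolic subalgebras $P_1\subset\operatorname{End}(\mathcal V|_0)$, $P_2\subset\operatorname{End}(\mathcal V|_\infty)$ and an isomorphism of $k$-algebras $\phi:L(P_1)\to L(P_2)$, the sheaf $\mathcal A=\mathcal A(\mathcal V,I(P_1,P_2,\phi))$ is an order over $C$, and if $h^0(\mathcal A)=1$, then $\mathcal A$ is a symmetric spherical order over $C$ with center $\mathcal O_C$. -/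

import Mathlib

open CategoryTheory AlgebraicGeometry TopologicalSpace Opposite

universe u v w

noncomputable section

namespace NodalOrder

attribute [local instance] MvPolynomial.gradedAlgebra

/-! ### Parabolic subalgebras and maximal isotropic subalgebras -/

section Isotropic

variable {k : Type u} [Field k] {W₁ : Type v} {W₂ : Type w}
  [AddCommGroup W₁] [Module k W₁] [AddCommGroup W₂] [Module k W₂]

/-- Sets `S` of positive weights `(i, j)`, `i < j`, that are closed under sums and contain
`α` and `β` as soon as they contain `α + β` (the sum of `(i, j)` and `(j, l)` is `(i, l)`). -/
def IsClosedWeights {n : ℕ} (S : Set (Fin n × Fin n)) : Prop :=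
  (∀ α ∈ S, α.1 < α.2) ∧
    ∀ i j l : Fin n, i < j → j < l → ((i, l) ∈ S ↔ (i, j) ∈ S ∧ (j, l) ∈ S)

/-- A subalgebra of `End W` is parabolic if in some basis of `W` it is the standard parabolic
subalgebra of all matrices `a` with `a i j = 0` whenever `i > j` and `(j, i) ∉ S`, that is,
the upper triangular matrices plus the span of the `e_{-α}`, `α ∈ S`. -/
def IsParabolic (P : Subalgebra k (Module.End k W₁)) : Prop :=
  ∃ (n : ℕ) (b : Module.Basis (Fin n) k W₁) (S : Set (Fin n × Fin n)), IsClosedWeights S ∧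
    ∀ a : Module.End k W₁, a ∈ P ↔
      ∀ i j : Fin n, j < i → (j, i) ∉ S → LinearMap.toMatrix b b a i j = 0

/-- The quotient of an algebra of endomorphisms by its Jacobson radical. -/
abbrev Levi (P : Subalgebra k (Module.End k W₁)) : Type _ := P ⧸ Ring.jacobson P

/-- `I(P₁, P₂, φ) = {(a, b) ∈ P₁ × P₂ | φ (a mod J(P₁)) = b mod J(P₂)}`. -/
def gluedSubalgebra (P₁ : Subalgebra k (Module.End k W₁)) (P₂ : Subalgebra k (Module.End k W₂))
    (φ : Levi P₁ ≃ₐ[k] Levi P₂) : Subalgebra k (Module.End k W₁ × Module.End k W₂) :=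
  (AlgHom.equalizer
    ((φ.toAlgHom.comp (Ideal.Quotient.mkₐ k (Ring.jacobson P₁))).comp (AlgHom.fst k P₁ P₂))
    ((Ideal.Quotient.mkₐ k (Ring.jacobson P₂)).comp (AlgHom.snd k P₁ P₂))).map
      (AlgHom.prodMap P₁.val P₂.val)

/-- The pairing `⟨(a, b), (a', b')⟩ = tr (a a') - tr (b b')`. -/
def trPairing (x y : Module.End k W₁ × Module.End k W₂) : k :=
  LinearMap.trace k W₁ (x.1 * y.1) - LinearMap.trace k W₂ (x.2 * y.2)

def IsIsotropic (J : Submodule k (Module.End k W₁ × Module.End k W₂)) : Prop :=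
  ∀ x ∈ J, ∀ y ∈ J, trPairing x y = 0

/-- The subalgebra `I` is maximal among the isotropic subspaces. -/
def IsMaximalIsotropic (I : Subalgebra k (Module.End k W₁ × Module.End k W₂)) : Prop :=
  Maximal IsIsotropic (Subalgebra.toSubmodule I)

end Isotropic

/-! ### Schemes over a field, values of functions, the projective line -/

section Values

variable {k : Type u} [Field k] {X : Scheme.{u}} (s : X ⟶ Spec (.of k))

/-- Constants as functions on `U`. -/
def constSec (U : X.Opens) : k →+* Γ(X, U) :=
  ((Scheme.ΓSpecIso (.of k)).inv ≫ s.appTop ≫ X.presheaf.map (homOfLE le_top).op).hom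

/-- Constants as elements of a local ring. -/
def constStalk (x : X) : k →+* X.presheaf.stalk x :=
  (X.presheaf.germ ⊤ x trivial).hom.comp (constSec s ⊤)

/-- The germ `f` takes the value `c ∈ k` at `x`. -/
def HasValue (x : X) (f : X.presheaf.stalk x) (c : k) : Prop :=
  f - constStalk s x c ∈ IsLocalRing.maximalIdeal (X.presheaf.stalk x)

theorem HasValue.mul {x : X} {f g : X.presheaf.stalk x} {c d : k} (hf : HasValue s x f c)
    (hg : HasValue s x g d) : HasValue s x (f * g) (c * d) := by
  have e : f * g - constStalk s x (c * d) =
      f * (g - constStalk s x d) + constStalk s x d * (f - constStalk s x c) := by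
    rw [map_mul]; ring
  rw [HasValue, e]
  exact Ideal.add_mem _ (Ideal.mul_mem_left _ _ hg) (Ideal.mul_mem_left _ _ hf)

theorem HasValue.add {x : X} {f g : X.presheaf.stalk x} {c d : k} (hf : HasValue s x f c)
    (hg : HasValue s x g d) : HasValue s x (f + g) (c + d) := by
  have e : f + g - constStalk s x (c + d) =
      (f - constStalk s x c) + (g - constStalk s x d) := by
    rw [map_add]; ring
  rw [HasValue, e]
  exact Ideal.add_mem _ hf hg

theorem hasValue_zero (x : X) : HasValue s x 0 0 := by
  simp [HasValue]

end Values

section ProjectiveLine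

variable (k : Type u) [Field k]

/-- The projective line `Proj k[x₀, x₁]`. -/
abbrev P1 : Scheme.{u} := Proj (MvPolynomial.homogeneousSubmodule (Fin 2) k)

/-- The structure morphism of the projective line. -/
def P1.str : P1 k ⟶ Spec (.of k) :=
  Proj.toSpecZero (MvPolynomial.homogeneousSubmodule (Fin 2) k) ≫
    Spec.map (CommRingCat.ofHom
      (algebraMap k (MvPolynomial.homogeneousSubmodule (Fin 2) k 0)))

theorem span_X_isHomogeneous (i : Fin 2) :
    (Ideal.span {(MvPolynomial.X i : MvPolynomial (Fin 2) k)}).IsHomogeneous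
      (MvPolynomial.homogeneousSubmodule (Fin 2) k) := by
  apply Ideal.homogeneous_span
  rintro x rfl
  exact ⟨1, MvPolynomial.isHomogeneous_X k i⟩

theorem not_irrelevant_le_of_X_notMem
    (I : HomogeneousIdeal (MvPolynomial.homogeneousSubmodule (Fin 2) k)) (j : Fin 2)
    (h : MvPolynomial.X j ∉ I.toIdeal) :
    ¬ HomogeneousIdeal.irrelevant (MvPolynomial.homogeneousSubmodule (Fin 2) k) ≤ I :=
  fun H => h (H (HomogeneousIdeal.mem_irrelevant_of_mem _ Nat.one_pos
    (MvPolynomial.isHomogeneous_X k j)))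

/-- The point `xᵢ = 0` of the projective line. -/
def P1.coordPoint (i : Fin 2) : P1 k :=
  (⟨⟨Ideal.span {(MvPolynomial.X i : MvPolynomial (Fin 2) k)}, span_X_isHomogeneous k i⟩,
    (Ideal.span_singleton_prime (MvPolynomial.X_ne_zero i)).2 MvPolynomial.X_prime,
    not_irrelevant_le_of_X_notMem k _ (i + 1) (by
      change MvPolynomial.X (i + 1) ∉ Ideal.span {(MvPolynomial.X i : MvPolynomial (Fin 2) k)}
      rw [Ideal.mem_span_singleton, MvPolynomial.X_dvd_X]
      fin_cases i <;> simp)⟩ :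
    ProjectiveSpectrum (MvPolynomial.homogeneousSubmodule (Fin 2) k))

/-- The point `0`, where `x₁ = 0`. -/
abbrev P1.zero : P1 k := P1.coordPoint k 1

/-- The point `∞`, where `x₀ = 0`. -/
abbrev P1.infty : P1 k := P1.coordPoint k 0

/-- The generic point of the projective line. -/
def P1.etaPoint : ProjectiveSpectrum (MvPolynomial.homogeneousSubmodule (Fin 2) k) :=
  ⟨⊥, by simpa using (Ideal.isPrime_bot : (⊥ : Ideal (MvPolynomial (Fin 2) k)).IsPrime),
    not_irrelevant_le_of_X_notMem k _ 0 (by simp [MvPolynomial.X_ne_zero])⟩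

instance P1.irreducibleSpace : IrreducibleSpace (P1 k) := by
  have h : closure {P1.etaPoint k} = Set.univ :=
    Set.eq_univ_of_forall fun x =>
      (ProjectiveSpectrum.le_iff_mem_closure _ (P1.etaPoint k) x).1
        ((ProjectiveSpectrum.as_ideal_le_as_ideal _ _ _).1 bot_le)
  have h2 := (isIrreducible_singleton (x := P1.etaPoint k)).closure
  rw [h] at h2
  exact (irreducibleSpace_def
    (X := ProjectiveSpectrum (MvPolynomial.homogeneousSubmodule (Fin 2) k))).2 h2

end ProjectiveLine

/-! ### The irreducible nodal curve of arithmetic genus one -/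

/-- The irreducible nodal curve of arithmetic genus one with its normalization `π : ℙ¹ ⟶ C`:
the integral curve `C` is obtained from `ℙ¹` by gluing the points `0` and `∞` to a node, i.e.
`π` is finite and surjective, identifies `0` with `∞` and no other points, and the functions on
`C` are exactly the functions on `ℙ¹` taking the same value at `0` and `∞`.
This determines `C` and `π` up to a unique isomorphism. -/
structure NodalCurve (k : Type u) [Field k] where
  C : Scheme.{u}
  str : C ⟶ Spec (.of k)
  π : P1 k ⟶ C
  integral : IsIntegral C
  π_str : π ≫ str = P1.str k
  π_finite : IsFinite π
  π_surjective : Function.Surjective π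
  π_eq_iff : ∀ x y : P1 k, π x = π y ↔
    x = y ∨ (x ∈ ({P1.zero k, P1.infty k} : Set (P1 k)) ∧
      y ∈ ({P1.zero k, P1.infty k} : Set (P1 k)))
  app_injective : ∀ U : C.Opens, Function.Injective (π.app U)
  mem_range_app_iff : ∀ (U : C.Opens) (f : Γ(P1 k, π ⁻¹ᵁ U)), f ∈ Set.range (π.app U) ↔
    ∀ (h₀ : P1.zero k ∈ π ⁻¹ᵁ U) (h₁ : P1.infty k ∈ π ⁻¹ᵁ U), ∃ c : k,
      HasValue (P1.str k) (P1.zero k) ((P1 k).presheaf.germ _ _ h₀ f) c ∧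
      HasValue (P1.str k) (P1.infty k) ((P1 k).presheaf.germ _ _ h₁ f) c

attribute [instance] NodalCurve.integral

section Node

variable {k : Type u} [Field k] (X : NodalCurve k)

/-- The node `q = π(0) = π(∞)`. -/
def NodalCurve.node : X.C := X.π (P1.zero k)

theorem NodalCurve.zero_mem {U : X.C.Opens} (h : X.node ∈ U) : P1.zero k ∈ X.π ⁻¹ᵁ U := h

theorem NodalCurve.infty_mem {U : X.C.Opens} (h : X.node ∈ U) : P1.infty k ∈ X.π ⁻¹ᵁ U := by
  have e : X.π (P1.zero k) = X.π (P1.infty k) :=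
    (X.π_eq_iff _ _).2 (Or.inr ⟨by simp, by simp⟩)
  change X.π (P1.infty k) ∈ U
  rw [← e]
  exact h

theorem NodalCurve.exists_value {U : X.C.Opens} (h : X.node ∈ U) (f : Γ(X.C, U)) : ∃ c : k,
    HasValue (P1.str k) (P1.zero k)
      ((P1 k).presheaf.germ _ _ (X.zero_mem h) (X.π.app U f)) c ∧
    HasValue (P1.str k) (P1.infty k)
      ((P1 k).presheaf.germ _ _ (X.infty_mem h) (X.π.app U f)) c :=
  (X.mem_range_app_iff U (X.π.app U f)).1 ⟨f, rfl⟩ (X.zero_mem h) (X.infty_mem h)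

end Node

/-! ### The dualizing sheaf -/

section Dualizing

variable (k : Type u) [Field k]

instance P1.algebraFunctionField : Algebra k (P1 k).functionField :=
  (constStalk (P1.str k) (genericPoint (P1 k))).toAlgebra

/-- Rational differentials on the projective line. -/
abbrev RatDiff : Type u := Ω[(P1 k).functionField⁄k]

variable {k}

/-- The rational function defined by a germ. -/
abbrev toK (p : P1 k) : (P1 k).presheaf.stalk p →+* (P1 k).functionField :=
  algebraMap ((P1 k).presheaf.stalk p) (P1 k).functionField

/-- The rational differential `η` is regular at `p`: it is a finite sum of `f dg` with `f`, `g` in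
the local ring of `p`. -/
def IsRegularAt (p : P1 k) (η : RatDiff k) : Prop :=
  η ∈ AddSubgroup.closure {ξ : RatDiff k | ∃ f g : (P1 k).presheaf.stalk p,
    ξ = toK p f • KaehlerDifferential.D k (P1 k).functionField (toK p g)}

/-- The rational differential `η` has at most a simple pole at the closed point `p`, and its residue
is `c`: for every uniformizer `t` at `p`, `η = f dt / t` with `f` in the local ring and
`f(p) = c`. -/
def HasLogResidue (p : P1 k) (η : RatDiff k) (c : k) : Prop :=
  ∀ t : (P1 k).presheaf.stalk p,
    IsLocalRing.maximalIdeal ((P1 k).presheaf.stalk p) = Ideal.span {t} →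
      ∃ f : (P1 k).presheaf.stalk p, HasValue (P1.str k) p f c ∧
        toK p t • η = toK p f • KaehlerDifferential.D k (P1 k).functionField (toK p t)

theorem IsRegularAt.smul {p : P1 k} {η : RatDiff k} (h : IsRegularAt p η)
    (f : (P1 k).presheaf.stalk p) : IsRegularAt p (toK p f • η) := by
  unfold IsRegularAt at h ⊢
  induction h using AddSubgroup.closure_induction with
  | mem x hx =>
    obtain ⟨a, b, rfl⟩ := hx
    exact AddSubgroup.subset_closure ⟨f * a, b, by rw [map_mul, mul_smul]⟩
  | zero => rw [smul_zero]; exact AddSubgroup.zero_mem _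
  | add x y _ _ hx hy => rw [smul_add]; exact AddSubgroup.add_mem _ hx hy
  | neg x _ hx => rw [smul_neg]; exact AddSubgroup.neg_mem _ hx

theorem HasLogResidue.smul {p : P1 k} {η : RatDiff k} {c d : k} (h : HasLogResidue p η c)
    {f : (P1 k).presheaf.stalk p} (hf : HasValue (P1.str k) p f d) :
    HasLogResidue p (toK p f • η) (d * c) := by
  intro t ht
  obtain ⟨g, hg, e⟩ := h t ht
  exact ⟨f * g, hf.mul _ hg, by rw [smul_comm, e, map_mul, mul_smul]⟩

theorem HasLogResidue.add {p : P1 k} {η ξ : RatDiff k} {c d : k} (h : HasLogResidue p η c)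
    (h' : HasLogResidue p ξ d) : HasLogResidue p (η + ξ) (c + d) := by
  intro t ht
  obtain ⟨g, hg, e⟩ := h t ht
  obtain ⟨g', hg', e'⟩ := h' t ht
  exact ⟨g + g', hg.add _ hg', by rw [smul_add, e, e', map_add, add_smul]⟩

theorem hasLogResidue_zero (p : P1 k) : HasLogResidue p (0 : RatDiff k) 0 :=
  fun _ _ => ⟨0, hasValue_zero _ _, by simp⟩

variable (X : NodalCurve k)

/-- A function on `U ⊆ C` acts on families of rational differentials indexed by `π⁻¹(U)`. -/
instance familyModule (U : X.C.Opens) :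
    Module Γ(X.C, U) ((p : (X.π ⁻¹ᵁ U : (P1 k).Opens)) → RatDiff k) :=
  @Pi.module _ _ _ _ _ fun p => Module.compHom (RatDiff k)
    (((toK p.1).comp ((P1 k).presheaf.germ _ p.1 p.2).hom).comp (X.π.app U).hom)

theorem family_smul_apply (U : X.C.Opens) (f : Γ(X.C, U))
    (η : (p : (X.π ⁻¹ᵁ U : (P1 k).Opens)) → RatDiff k) (p : (X.π ⁻¹ᵁ U : (P1 k).Opens)) :
    (f • η) p = toK p.1 ((P1 k).presheaf.germ _ p.1 p.2 (X.π.app U f)) • η p := rfl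

/-- The dualizing sheaf `ω_C` of the nodal curve: its sections over `U` are the rational
differentials on `ℙ¹` that are regular on `π⁻¹(U)` outside `0` and `∞` and, if `U` contains the
node, have at most simple poles at `0` and `∞`, with opposite residues. Sections are written as
constant families indexed by the points of `π⁻¹(U)`, so that there is only the zero section over
the empty set. -/
def omega (U : X.C.Opens) :
    Submodule Γ(X.C, U) ((p : (X.π ⁻¹ᵁ U : (P1 k).Opens)) → RatDiff k) where
  carrier := {η | (∀ p p', η p = η p') ∧
    (∀ p, p.1 ≠ P1.zero k → p.1 ≠ P1.infty k → IsRegularAt p.1 (η p)) ∧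
    ∀ h : X.node ∈ U, ∃ c : k,
      HasLogResidue (P1.zero k) (η ⟨P1.zero k, X.zero_mem h⟩) c ∧
      HasLogResidue (P1.infty k) (η ⟨P1.infty k, X.infty_mem h⟩) (-c)}
  zero_mem' := ⟨fun _ _ => rfl, fun _ _ _ => AddSubgroup.zero_mem _,
    fun _ => ⟨0, hasLogResidue_zero _, by rw [neg_zero]; exact hasLogResidue_zero _⟩⟩
  add_mem' := by
    rintro η ξ ⟨h1, h2, h3⟩ ⟨h1', h2', h3'⟩
    refine ⟨fun p p' => ?_, fun p hp hp' => AddSubgroup.add_mem _ (h2 p hp hp') (h2' p hp hp'),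
      fun h => ?_⟩
    · rw [Pi.add_apply, Pi.add_apply, h1 p p', h1' p p']
    · obtain ⟨c, hc, hc'⟩ := h3 h
      obtain ⟨d, hd, hd'⟩ := h3' h
      exact ⟨c + d, hc.add hd, by rw [neg_add]; exact hc'.add hd'⟩
  smul_mem' := by
    rintro f η ⟨h1, h2, h3⟩
    refine ⟨fun p p' => ?_, fun p hp hp' => (h2 p hp hp').smul _, fun h => ?_⟩
    · have : Nonempty (X.π ⁻¹ᵁ U : (P1 k).Opens) := ⟨p⟩
      rw [family_smul_apply, family_smul_apply, h1 p p',
        Scheme.algebraMap_germ_eq_germToFunctionField,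
        Scheme.algebraMap_germ_eq_germToFunctionField]
    · obtain ⟨c, hc, hc'⟩ := h3 h
      obtain ⟨d, hd, hd'⟩ := X.exists_value h f
      exact ⟨d * c, hc.smul hd, by rw [← mul_neg]; exact hc'.smul hd'⟩

/-- Restriction of sections of the dualizing sheaf. -/
def omegaRes {U U' : X.C.Opens} (h : U' ≤ U) (η : omega X U) : omega X U' :=
  ⟨fun p => η.1 ⟨p.1, h p.2⟩, fun _ _ => η.2.1 _ _, fun p hp hp' => η.2.2.1 ⟨p.1, h p.2⟩ hp hp',
    fun hq => η.2.2.2 (h hq)⟩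

end Dualizing

/-! ### Sheaves of algebras and orders -/

/-- A presheaf of `𝒪_X`-algebras: a presheaf of rings `A` with a morphism `𝒪_X → A` with central
image. -/
structure AlgebraPresheaf (X : Scheme.{u}) where
  presheaf : TopCat.Presheaf RingCat.{u} X
  unit : ∀ U : X.Opens, Γ(X, U) →+* presheaf.obj (op U)
  unit_res : ∀ {U U' : X.Opens} (h : U' ≤ U) (f : Γ(X, U)),
    presheaf.map (homOfLE h).op (unit U f) = unit U' (X.presheaf.map (homOfLE h).op f)
  central : ∀ (U : X.Opens) (f : Γ(X, U)) (a : presheaf.obj (op U)), unit U f * a = a * unit U f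

namespace AlgebraPresheaf

variable {X : Scheme.{u}} (A : AlgebraPresheaf X)

abbrev sec (U : X.Opens) : Type u := A.presheaf.obj (op U)

abbrev res {U U' : X.Opens} (h : U' ≤ U) : A.sec U →+* A.sec U' :=
  (A.presheaf.map (homOfLE h).op).hom

instance (U : X.Opens) : Algebra Γ(X, U) (A.sec U) :=
  (A.unit U).toAlgebra' (A.central U)

/-- The dimension of the space of global sections. -/
def h0 {k : Type u} [Field k] (s : X ⟶ Spec (.of k)) : ℕ :=
  letI : Module k (A.sec ⊤) := Module.compHom _ (constSec s ⊤)
  Module.finrank k (A.sec ⊤)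

/-- An order over an integral (locally Noetherian) scheme: a torsion free coherent sheaf of
algebras whose stalk at the generic point is a matrix algebra over the function field.
Coherence says that on affine opens the sections form a finitely generated module, and that the
sections over `D(f)` are the localization at `f` of the sections over the affine open. -/
structure IsOrder [IsIntegral X] : Prop where
  isSheaf : A.presheaf.IsSheaf
  torsionFree : ∀ (U : X.Opens) (f : Γ(X, U)) (a : A.sec U), f ≠ 0 → f • a = 0 → a = 0
  finite : ∀ U : X.Opens, IsAffineOpen U → Module.Finite Γ(X, U) (A.sec U)
  exists_pow_smul_eq_zero : ∀ U : X.Opens, IsAffineOpen U → ∀ (f : Γ(X, U)) (a : A.sec U),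
    A.res (X.basicOpen_le f) a = 0 → ∃ N : ℕ, f ^ N • a = 0
  exists_pow_smul_eq_res : ∀ U : X.Opens, IsAffineOpen U →
    ∀ (f : Γ(X, U)) (b : A.sec (X.basicOpen f)), ∃ (N : ℕ) (a : A.sec U),
      A.res (X.basicOpen_le f) a =
        X.presheaf.map (homOfLE (X.basicOpen_le f)).op (f ^ N) • b
  generic : ∃ (m : ℕ) (_ : 0 < m)
    (e : A.presheaf.stalk (genericPoint X) ≃+* Matrix (Fin m) (Fin m) X.functionField),
    ∀ (U : X.Opens) (h : genericPoint X ∈ U) (f : Γ(X, U)),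
      e (A.presheaf.germ U _ h (A.unit U f)) = Matrix.scalar (Fin m) (X.presheaf.germ U _ h f)

/-- The center of `A` is `𝒪_X`. -/
def HasCenterStructureSheaf : Prop :=
  ∀ U : X.Opens, Function.Injective (A.unit U) ∧
    ∀ a : A.sec U, a ∈ Set.range (A.unit U) ↔
      ∀ (U' : X.Opens) (h : U' ≤ U) (b : A.sec U'), A.res h a * b = b * A.res h a

end AlgebraPresheaf

section Spherical

variable {k : Type u} [Field k] (X : NodalCurve k) (A : AlgebraPresheaf X.C)

/-- The sections over `U` of the sheaf `Hom(A, ω_C)` of homomorphisms of `𝒪_C`-modules. -/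
@[ext] structure OmegaHom (U : X.C.Opens) where
  app : ∀ W : {W : X.C.Opens // W ≤ U}, A.sec W.1 →ₗ[Γ(X.C, W.1)] omega X W.1
  naturality : ∀ (W W' : {W : X.C.Opens // W ≤ U}) (h : W'.1 ≤ W.1) (a : A.sec W.1),
    omegaRes X h (app W a) = app W' (A.res h a)

variable {X A}

/-- `τ(a)` for a global homomorphism `τ : A → ω_C` and a local section `a`. -/
abbrev OmegaHom.eval (τ : OmegaHom X A ⊤) {W : X.C.Opens} :
    A.sec W →ₗ[Γ(X.C, W)] omega X W := τ.app ⟨W, le_top⟩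

def OmegaHom.IsNonzero (τ : OmegaHom X A ⊤) : Prop :=
  ∃ (W : X.C.Opens) (a : A.sec W), τ.eval a ≠ 0

/-- The morphism `ν : A → Hom(A, ω_C)`, `y ↦ (x ↦ τ(x y))`. -/
def OmegaHom.nu (τ : OmegaHom X A ⊤) (U : X.C.Opens) (y : A.sec U) : OmegaHom X A U where
  app W := τ.eval.comp (LinearMap.mulRight Γ(X.C, W.1) (A.res W.2 y))
  naturality W W' h a := by
    have e : A.res h (A.res W.2 y) = A.res W'.2 y := by
      change (A.presheaf.map _ ≫ A.presheaf.map _).hom y = _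
      rw [← Functor.map_comp]
      rfl
    change omegaRes X h (τ.app ⟨W.1, le_top⟩ (a * A.res W.2 y)) =
      τ.app ⟨W'.1, le_top⟩ (A.res h a * A.res W'.2 y)
    rw [τ.naturality ⟨W.1, le_top⟩ ⟨W'.1, le_top⟩ h, map_mul, e]

variable (X A)

/-- Symmetric spherical orders over the nodal curve: `H⁰(C, 𝒪_C) = k`, there is a nonzero morphism
`τ : A → ω_C`, unique up to rescaling, the morphism `ν` is an isomorphism, and
`τ(x y) = τ(y x)`. -/
structure IsSymmetricSphericalOrder : Prop where
  isOrder : A.IsOrder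
  constants : Function.Bijective (constSec X.str ⊤)
  exists_nonzero : ∃ τ : OmegaHom X A ⊤, τ.IsNonzero
  unique : ∀ τ τ' : OmegaHom X A ⊤, τ.IsNonzero → ∃ c : k, ∀ (W : X.C.Opens) (a : A.sec W),
    τ'.eval a = constSec X.str W c • τ.eval a
  nu_bijective : ∀ τ : OmegaHom X A ⊤, τ.IsNonzero → ∀ U : X.C.Opens,
    Function.Bijective (τ.nu U)
  symm : ∀ τ : OmegaHom X A ⊤, τ.IsNonzero → ∀ (W : X.C.Opens) (x y : A.sec W),
    τ.eval (x * y) = τ.eval (y * x)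

end Spherical

/-! ### Vector bundles, their fibers and their endomorphisms -/

section Bundles

variable {X : Scheme.{u}}

/-- A sheaf of modules is a vector bundle of rank `n`: every point has a neighborhood `U` with
sections `e₁, …, eₙ` over `U` giving an isomorphism of the restriction to `U` with `𝒪_U ^ n`. -/
def IsVectorBundle (V : X.Modules) (n : ℕ) : Prop :=
  ∀ x : X, ∃ (U : X.Opens) (_ : x ∈ U) (e : Fin n → Γ(V, U)),
    ∀ (W : X.Opens) (h : W ≤ U), ∃ b : Module.Basis (Fin n) Γ(X, W) Γ(V, W),
      ∀ i, b i = V.presheaf.map (homOfLE h).op (e i)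

/-- The module structure on the stalks of a sheaf of modules. -/
instance stalkModule (V : X.Modules) (x : X) :
    Module (X.presheaf.stalk x) (V.presheaf.stalk x) :=
  PresheafOfModules.instModuleCarrierStalkCommRingCatCarrierAbPresheafOpensCarrier
    (R := X.presheaf) V.val x

theorem germ_smul (V : X.Modules) (x : X) (U : X.Opens) (hx : x ∈ U) (f : Γ(X, U))
    (v : Γ(V, U)) :
    V.presheaf.germ U x hx (f • v) = X.presheaf.germ U x hx f • V.presheaf.germ U x hx v :=
  PresheafOfModules.germ_smul (R := X.presheaf) V.val x U hx f v

/-- The sections over `U` of the sheaf of endomorphisms of `V`: compatible families of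
endomorphisms of the sections over the open subsets of `U`. -/
def endSections (V : X.Modules) (U : X.Opens) :
    Subring ((W : {W : X.Opens // W ≤ U}) → Module.End Γ(X, W.1) Γ(V, W.1)) where
  carrier := {a | ∀ (W W' : {W : X.Opens // W ≤ U}) (h : W'.1 ≤ W.1) (v : Γ(V, W.1)),
    V.presheaf.map (homOfLE h).op (a W v) = a W' (V.presheaf.map (homOfLE h).op v)}
  zero_mem' := fun _ _ _ _ => by simp
  one_mem' := fun _ _ _ _ => rfl
  add_mem' := by
    intro a b ha hb W W' h v
    simp only [Pi.add_apply, LinearMap.add_apply, map_add, ha W W' h, hb W W' h]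
  neg_mem' := by
    intro a ha W W' h v
    simp only [Pi.neg_apply, LinearMap.neg_apply, map_neg, ha W W' h]
  mul_mem' := by
    intro a b ha hb W W' h v
    simp only [Pi.mul_apply, Module.End.mul_apply, ha W W' h, hb W W' h]

/-- Restriction of endomorphisms. -/
def endRes (V : X.Modules) {U U' : X.Opens} (h : U' ≤ U) :
    endSections V U →+* endSections V U' where
  toFun a := ⟨fun W => a.1 ⟨W.1, W.2.trans h⟩, fun W W' h' v =>
    a.2 ⟨W.1, W.2.trans h⟩ ⟨W'.1, W'.2.trans h⟩ h' v⟩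
  map_zero' := rfl
  map_one' := rfl
  map_add' _ _ := rfl
  map_mul' _ _ := rfl

/-- Multiplication by functions. -/
def endScalar (V : X.Modules) (U : X.Opens) : Γ(X, U) →+* endSections V U where
  toFun f := ⟨fun W => LinearMap.lsmul Γ(X, W.1) Γ(V, W.1) (X.presheaf.map (homOfLE W.2).op f), by
    intro W W' h v
    simp only [LinearMap.lsmul_apply, Scheme.Modules.map_smul]
    congr 1
    change (X.presheaf.map _ ≫ X.presheaf.map _).hom f = _
    rw [← Functor.map_comp]
    rfl⟩
  map_zero' := by ext; simp
  map_one' := by ext; simp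
  map_add' f g := by ext; simp
  map_mul' f g := by ext W v; simpa [mul_smul] using smul_comm _ _ _

variable {k : Type u} [Field k]

/-- The fiber `V|_p = V_p / m_p V_p` of a sheaf of modules on the projective line. -/
def Fiber (V : (P1 k).Modules) (p : P1 k) : Type u :=
  V.presheaf.stalk p ⧸
    (IsLocalRing.maximalIdeal ((P1 k).presheaf.stalk p) •
      (⊤ : Submodule ((P1 k).presheaf.stalk p) (V.presheaf.stalk p)))

instance (V : (P1 k).Modules) (p : P1 k) : AddCommGroup (Fiber V p) :=
  inferInstanceAs (AddCommGroup (V.presheaf.stalk p ⧸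
    (IsLocalRing.maximalIdeal ((P1 k).presheaf.stalk p) •
      (⊤ : Submodule ((P1 k).presheaf.stalk p) (V.presheaf.stalk p)))))

instance fiberStalkModule (V : (P1 k).Modules) (p : P1 k) :
    Module ((P1 k).presheaf.stalk p) (Fiber V p) :=
  inferInstanceAs (Module ((P1 k).presheaf.stalk p) (V.presheaf.stalk p ⧸
    (IsLocalRing.maximalIdeal ((P1 k).presheaf.stalk p) •
      (⊤ : Submodule ((P1 k).presheaf.stalk p) (V.presheaf.stalk p)))))

instance fiberModule (V : (P1 k).Modules) (p : P1 k) : Module k (Fiber V p) :=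
  Module.compHom _ (constStalk (P1.str k) p)

/-- The value in the fiber of a section of `V`. -/
def fiberValue (V : (P1 k).Modules) (p : P1 k) {U : (P1 k).Opens} (hp : p ∈ U) (v : Γ(V, U)) :
    Fiber V p :=
  Submodule.Quotient.mk (V.presheaf.germ U p hp v)

theorem fiberValue_add (V : (P1 k).Modules) (p : P1 k) {U : (P1 k).Opens} (hp : p ∈ U)
    (v v' : Γ(V, U)) : fiberValue V p hp (v + v') = fiberValue V p hp v + fiberValue V p hp v' := by
  simp only [fiberValue, map_add]
  rfl

theorem fiberValue_neg (V : (P1 k).Modules) (p : P1 k) {U : (P1 k).Opens} (hp : p ∈ U)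
    (v : Γ(V, U)) : fiberValue V p hp (-v) = -fiberValue V p hp v := by
  simp only [fiberValue, map_neg]
  rfl

theorem fiberValue_zero (V : (P1 k).Modules) (p : P1 k) {U : (P1 k).Opens} (hp : p ∈ U) :
    fiberValue V p hp (0 : Γ(V, U)) = 0 := by
  simp only [fiberValue, map_zero]
  rfl

theorem fiberValue_smul (V : (P1 k).Modules) (p : P1 k) {U : (P1 k).Opens} (hp : p ∈ U)
    (f : Γ(P1 k, U)) (v : Γ(V, U)) {c : k}
    (h : HasValue (P1.str k) p ((P1 k).presheaf.germ U p hp f) c) :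
    fiberValue V p hp (f • v) = c • fiberValue V p hp v := by
  have e : c • fiberValue V p hp v = (Submodule.Quotient.mk
      (constStalk (P1.str k) p c • V.presheaf.germ U p hp v) : Fiber V p) := rfl
  rw [e, fiberValue, germ_smul]
  refine (Submodule.Quotient.eq _).2 ?_
  rw [← sub_smul]
  exact Submodule.smul_mem_smul h trivial

/-- The endomorphism of the fiber `V|_p` induced by the section `a` of the sheaf of endomorphisms
is `α`. -/
def HasFiberValue (V : (P1 k).Modules) (p : P1 k) {U : (P1 k).Opens} (a : endSections V U)
    (α : Module.End k (Fiber V p)) : Prop :=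
  ∀ (W : {W : (P1 k).Opens // W ≤ U}) (hp : p ∈ W.1) (v : Γ(V, W.1)),
    fiberValue V p hp (a.1 W v) = α (fiberValue V p hp v)

end Bundles

/-! ### The sheaf of algebras `A(V, I)` -/

section Order

variable {k : Type u} [Field k] (X : NodalCurve k) (V : (P1 k).Modules)
  (I : Subalgebra k (Module.End k (Fiber V (P1.zero k)) × Module.End k (Fiber V (P1.infty k))))

/-- The sections over `U` of `A(V, I) ⊆ π_* End(V)`: the endomorphisms `a` of `V` over `π⁻¹(U)`
with `(a(0), a(∞)) ∈ I` if `U` contains the node. -/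
def orderSections (U : X.C.Opens) : Subring (endSections V (X.π ⁻¹ᵁ U)) where
  carrier := {a | X.node ∈ U → ∃ x ∈ I,
    HasFiberValue V (P1.zero k) a x.1 ∧ HasFiberValue V (P1.infty k) a x.2}
  zero_mem' := fun _ => ⟨0, I.zero_mem, fun _ hp _ => fiberValue_zero V _ hp,
    fun _ hp _ => fiberValue_zero V _ hp⟩
  one_mem' := fun _ => ⟨1, I.one_mem, fun _ _ _ => rfl, fun _ _ _ => rfl⟩
  add_mem' := by
    intro a b ha hb h
    obtain ⟨x, hx, h0, h1⟩ := ha h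
    obtain ⟨y, hy, h0', h1'⟩ := hb h
    exact ⟨x + y, I.add_mem hx hy,
      fun W hp v => (fiberValue_add V _ hp _ _).trans (by rw [h0 W hp v, h0' W hp v]; rfl),
      fun W hp v => (fiberValue_add V _ hp _ _).trans (by rw [h1 W hp v, h1' W hp v]; rfl)⟩
  neg_mem' := by
    intro a ha h
    obtain ⟨x, hx, h0, h1⟩ := ha h
    exact ⟨-x, I.neg_mem hx,
      fun W hp v => (fiberValue_neg V _ hp _).trans (by rw [h0 W hp v]; rfl),
      fun W hp v => (fiberValue_neg V _ hp _).trans (by rw [h1 W hp v]; rfl)⟩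
  mul_mem' := by
    intro a b ha hb h
    obtain ⟨x, hx, h0, h1⟩ := ha h
    obtain ⟨y, hy, h0', h1'⟩ := hb h
    exact ⟨x * y, I.mul_mem hx hy,
      fun W hp v => (h0 W hp (b.1 W v)).trans (by rw [h0' W hp v]; rfl),
      fun W hp v => (h1 W hp (b.1 W v)).trans (by rw [h1' W hp v]; rfl)⟩

/-- Restriction of sections of `A(V, I)`. -/
def orderRes {U U' : X.C.Opens} (h : U' ≤ U) :
    orderSections X V I U →+* orderSections X V I U' where
  toFun a := ⟨endRes V (fun _ hp => h hp) a.1, fun hq => by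
    obtain ⟨x, hx, h0, h1⟩ := a.2 (h hq)
    exact ⟨x, hx, fun W hp v => h0 ⟨W.1, W.2.trans (fun _ hp => h hp)⟩ hp v,
      fun W hp v => h1 ⟨W.1, W.2.trans (fun _ hp => h hp)⟩ hp v⟩⟩
  map_zero' := rfl
  map_one' := rfl
  map_add' _ _ := rfl
  map_mul' _ _ := rfl

theorem endScalar_mem (U : X.C.Opens) (f : Γ(X.C, U)) :
    endScalar V (X.π ⁻¹ᵁ U) (X.π.app U f) ∈ orderSections X V I U := by
  intro h
  obtain ⟨c, h0, h1⟩ := X.exists_value h f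
  refine ⟨algebraMap k _ c, I.algebraMap_mem c, fun W hp v => ?_, fun W hp v => ?_⟩
  · refine fiberValue_smul V _ hp _ v (c := c) ?_
    rw [TopCat.Presheaf.germ_res_apply]
    exact h0
  · refine fiberValue_smul V _ hp _ v (c := c) ?_
    rw [TopCat.Presheaf.germ_res_apply]
    exact h1

/-- The presheaf of `𝒪_C`-algebras `A(V, I)`. -/
def orderSheaf : AlgebraPresheaf X.C where
  presheaf :=
    { obj := fun U => RingCat.of (orderSections X V I U.unop)
      map := fun i => RingCat.ofHom (orderRes X V I i.unop.le)
      map_id := fun _ => rfl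
      map_comp := fun _ _ => rfl }
  unit U := ((endScalar V (X.π ⁻¹ᵁ U)).comp (X.π.app U).hom).codRestrict
    (orderSections X V I U) (endScalar_mem X V I U)
  unit_res {U U'} h f := by
    apply Subtype.ext
    apply Subtype.ext
    funext W
    ext v
    refine congrArg (fun g : Γ(P1 k, W.1) => g • v) ?_
    have e := ConcreteCategory.congr_hom (X.π.naturality (homOfLE h).op) f
    simp only [ConcreteCategory.comp_apply] at e
    refine Eq.trans ?_ (congrArg ((P1 k).presheaf.map (homOfLE W.2).op) e.symm)
    exact ConcreteCategory.congr_hom ((P1 k).presheaf.map_comp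
      ((Opens.map X.π.base).map (homOfLE h)).op (homOfLE W.2).op) (X.π.app U f)
  central U f a := by
    apply Subtype.ext
    apply Subtype.ext
    funext W
    ext v
    exact ((a.1.1 W).map_smul _ v).symm

end Order

end NodalOrder

end

/-! The first claim is linear algebra over any field. The radical of a parabolic algebra P consists
of its strictly block triangular matrices, so the trace of an element of P depends only on its class
in L(P); moreover P and J(P) are orthogonal complements of each other for the trace form. The trace
on L(P) is intrinsic: it is a trace function with value 1 on every primitive idempotent. Hence φ
preserves it (`trace_eq_of_quotient_equiv`), and tr a = tr b on I(P₁, P₂, φ). As this subspace is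
closed under products, it is isotropic. An element orthogonal to it is orthogonal to J(P₁) × 0 and 0
× J(P₂), so it lies in P₁ × P₂; comparison with an element of the glued algebra that has the same
first component then puts it into the glued algebra.

For the sheaf, everything is moved to the generic fiber E of V, a vector space over K = k(t). A
section of A(V, I) over U is a K-linear endomorphism of E that preserves the stalk of V at each
point of π⁻¹(U) and, if U contains the node, has its pair of values at 0 and ∞ in I (`oE_injective`,
`exists_oE_eq`). The axioms of an order are read off from this description. Finiteness holds because
the sections embed into matrices of functions on π⁻¹(U), which form a finite module over the
noetherian ring of functions on U.

The dualizing sheaf is free with generator dt/t, because f dt/t has residues f(0) and -f(∞)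
(`mem_omega_iff`). Pairing an element x of I with 1 gives tr x₁ = tr x₂, so a ↦ tr(a) dt/t is a
morphism from A to ω_C. The heart of the proof is that it induces an isomorphism of A with Hom(A,
ω_C) (`traceHom_nu_injective`, `traceHom_nu_surjective`). A local homomorphism has the form x ↦ tr(x
Y) dt/t for an endomorphism Y of E. Perfectness of the trace form over the local rings makes Y
regular away from the node. At the node, test endomorphisms that vanish at both points show that Y
is regular there (`isRegularEnd_of_trace_hasVal`), and test sections with arbitrary values in I show
that (Y(0), Y(∞)) is orthogonal to I. Over an algebraically closed field of characteristic zero, a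
maximal isotropic subspace of this nondegenerate form of even rank is its own orthogonal
(`mem_of_isMaximalIsotropic`), so Y is a section of A.

If h⁰(A) = 1, then Hom(A, ω_C) = H⁰(A) = k, which gives uniqueness of τ; the trace morphism is
nonzero since tr 1 = n ≠ 0 in k. A central section is a scalar f at the generic point, and f is 1/n
times its trace, hence a function on C. -/

noncomputable section

namespace NodalOrder

attribute [local instance] MvPolynomial.gradedAlgebra

section Parabolic

/-! ### Algebras of block triangular matrices -/

section BlockTriangular

/-- A total preorder on the indices; its classes are the blocks. -/
structure IsTotalPreorder {ι : Type*} (r : ι → ι → Prop) : Prop where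
  trans : ∀ i j l, r i j → r j l → r i l
  total : ∀ i j, r i j ∨ r j i

theorem IsTotalPreorder.refl {ι : Type*} {r : ι → ι → Prop} (hr : IsTotalPreorder r) (i : ι) :
    r i i := (hr.total i i).elim id id

/-- An identification of the algebra `P` with the algebra of block triangular matrices of shape
`r`. -/
structure IsBlockTriangular {k : Type*} [Field k] {ι : Type*} [Fintype ι] [DecidableEq ι]
    (r : ι → ι → Prop) {P : Type*} [Ring P] [Algebra k P] (m : P →ₐ[k] Matrix ι ι k) : Prop where
  preorder : IsTotalPreorder r
  injective : Function.Injective m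
  mem_range : ∀ A : Matrix ι ι k, (∃ x, m x = A) ↔ ∀ i j, ¬ r i j → A i j = 0

variable {k : Type*} [Field k] {ι : Type*} [Fintype ι] [DecidableEq ι]
  {r : ι → ι → Prop} {P : Type*} [Ring P] [Algebra k P] {m : P →ₐ[k] Matrix ι ι k}

namespace IsBlockTriangular

variable (h : IsBlockTriangular r m)

include h

theorem eq_zero (x : P) {i j : ι} (hij : ¬ r i j) : m x i j = 0 :=
  (h.mem_range (m x)).1 ⟨x, rfl⟩ i j hij

theorem exists_single {i j : ι} (hij : r i j) : ∃ x, m x = Matrix.single i j 1 := by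
  refine (h.mem_range _).2 fun a b hab => Matrix.single_apply_of_ne _ _ _ _ _ ?_
  rintro ⟨rfl, rfl⟩
  exact hab hij

open Classical in
/-- The number of indices that are not before a given index. -/
theorem pow_apply_eq_zero {x : P} (hx : ∀ i j, r j i → m x i j = 0) (N : ℕ) (i j : ι)
    (hij : (Finset.univ.filter (r i)).card < (Finset.univ.filter (r j)).card + N) :
    (m x ^ N) i j = 0 := by
  induction N generalizing i with
  | zero =>
    rw [pow_zero, Matrix.one_apply_ne]
    rintro rfl
    omega
  | succ N ih =>
    rw [pow_succ', Matrix.mul_apply]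
    refine Finset.sum_eq_zero fun l _ => ?_
    by_cases hl : m x i l = 0
    · rw [hl, zero_mul]
    · have h1 : r i l := by_contra fun hc => hl (h.eq_zero x hc)
      have h2 : ¬ r l i := fun hc => hl (hx i l hc)
      -- A nonzero strict entry at (i, l) puts l in a strictly later block than i, so l has fewer
      -- successors. Each factor of a power uses up at least one of them.
      have : (Finset.univ.filter (r l)).card < (Finset.univ.filter (r i)).card := by
        apply Finset.card_lt_card
        rw [Finset.ssubset_iff_of_subset]
        · exact ⟨i, by simpa using h.preorder.refl i, by simpa using h2⟩
        · intro a ha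
          simp only [Finset.mem_filter, Finset.mem_univ, true_and] at ha ⊢
          exact h.preorder.trans _ _ _ h1 ha
      rw [ih l (by omega), mul_zero]

theorem isNilpotent_of_strict {x : P} (hx : ∀ i j, r j i → m x i j = 0) : IsNilpotent x := by
  classical
  refine ⟨Fintype.card ι + 1, h.injective ?_⟩
  rw [map_pow, map_zero]
  ext i j
  refine h.pow_apply_eq_zero hx _ i j ?_
  have := Finset.card_le_univ (Finset.univ.filter (r i))
  omega

theorem mul_strict {x : P} (hx : ∀ i j, r j i → m x i j = 0) (y : P) :
    ∀ i j, r j i → m (y * x) i j = 0 := by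
  intro i j hij
  rw [map_mul, Matrix.mul_apply]
  refine Finset.sum_eq_zero fun l _ => ?_
  by_cases hl : r i l
  · rw [hx l j (h.preorder.trans _ _ _ hij hl), mul_zero]
  · rw [h.eq_zero y hl, zero_mul]

/-- The Jacobson radical consists of the strictly block triangular matrices. -/
theorem mem_jacobson_iff (x : P) :
    x ∈ Ring.jacobson P ↔ ∀ i j, r j i → m x i j = 0 := by
  constructor
  · intro hx i j hij
    by_contra hne
    obtain ⟨a, ha⟩ := h.exists_single hij
    obtain ⟨e, he⟩ := h.exists_single (h.preorder.refl j)
    -- Multiplying x by E_ji on the left and E_jj on the right leaves x_ij E_jj, so a nonzero entry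
    -- inside a block puts the idempotent E_jj into the radical.
    have hmem : (m x i j)⁻¹ • (a * x * e) ∈ Ring.jacobson P := by
      rw [← one_mul (a * x * e), ← smul_mul_assoc]
      exact Ideal.mul_mem_left _ _ (Ideal.mul_mem_right _ _ (Ideal.mul_mem_left _ _ hx))
    have hee : (m x i j)⁻¹ • (a * x * e) = e := by
      apply h.injective
      rw [map_smul, map_mul, map_mul, ha, he]
      ext p q
      simp only [Matrix.smul_apply, Matrix.single_mul_mul_single, one_mul, mul_one,
        Matrix.single_apply]
      split_ifs <;> simp [hne]
    rw [hee] at hmem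
    have hj : Ring.jacobson P = Ideal.jacobson ⊥ := Ring.jacobson_eq_sInf_isMaximal P ▸ by
      simp [Ideal.jacobson]
    rw [hj, Ideal.mem_jacobson_iff] at hmem
    -- An idempotent e of the radical is zero: 1 - e has a left inverse z, and z (1 - e) = 1
    -- multiplied by e gives 0 = e.
    obtain ⟨z, hz⟩ := hmem (-1)
    rw [Ideal.mem_bot] at hz
    have hidem : e * e = e := h.injective (by rw [map_mul, he]; simp)
    have : (0 : P) = e := by
      have := congrArg (· * e) hz
      simp only [sub_mul, add_mul, mul_assoc, hidem] at this
      exact (by simpa using this : e = 0).symm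
    rw [← this, map_zero] at he
    have := congrFun (congrFun he j) j
    simp at this
  · intro hx
    have hj : Ring.jacobson P = Ideal.jacobson ⊥ := Ring.jacobson_eq_sInf_isMaximal P ▸ by
      simp [Ideal.jacobson]
    rw [hj, Ideal.mem_jacobson_iff]
    intro y
    obtain ⟨u, hu⟩ := (h.isNilpotent_of_strict (h.mul_strict hx y)).isUnit_add_one
    refine ⟨↑u⁻¹, ?_⟩
    rw [Ideal.mem_bot, sub_eq_zero, mul_assoc, ← u.inv_mul, hu, mul_add, mul_one]

theorem trace_eq_zero_of_mem_jacobson {x : P} (hx : x ∈ Ring.jacobson P) : (m x).trace = 0 :=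
  Finset.sum_eq_zero fun i _ => (h.mem_jacobson_iff x).1 hx i i (h.preorder.refl i)

open Classical in
/-- The block diagonal part of a product. -/
theorem blockDiag_mul (x y : P) :
    (Matrix.of fun i j => if r j i then m (x * y) i j else 0) =
      (Matrix.of fun i j => if r j i then m x i j else 0) *
        (Matrix.of fun i j => if r j i then m y i j else 0) := by
  ext i j
  simp only [Matrix.of_apply, Matrix.mul_apply, map_mul]
  split_ifs with hij
  · refine Finset.sum_congr rfl fun l _ => ?_
    by_cases h1 : r i l
    · by_cases h2 : r l j
      · rw [if_pos (h.preorder.trans _ _ _ h2 hij), if_pos (h.preorder.trans _ _ _ hij h1)]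
      · simp [h.eq_zero y h2]
    · simp [h.eq_zero x h1]
  · symm
    refine Finset.sum_eq_zero fun l _ => ?_
    by_cases h1 : r l i
    · by_cases h2 : r j l
      · exact absurd (h.preorder.trans _ _ _ h2 h1) hij
      · simp [h2]
    · simp [h1]

/-- A primitive idempotent modulo the radical has trace one. -/
theorem trace_eq_one {e : P} (he : e ∉ Ring.jacobson P) (hidem : e * e - e ∈ Ring.jacobson P)
    (hprim : ∀ x : P, ∃ c : k, e * x * e - c • e ∈ Ring.jacobson P) : (m e).trace = 1 := by
  classical
  set D : P → Matrix ι ι k := fun x => Matrix.of fun i j => if r j i then m x i j else 0 with hD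
  have hDmul : ∀ x y, D (x * y) = D x * D y := h.blockDiag_mul
  have hDeq : ∀ x y, x - y ∈ Ring.jacobson P → D x = D y := by
    intro x y hxy
    ext i j
    simp only [hD, Matrix.of_apply]
    split_ifs with hij
    · have := (h.mem_jacobson_iff _).1 hxy i j hij
      rwa [map_sub, Matrix.sub_apply, sub_eq_zero] at this
    · rfl
  have hDtr : ∀ x, (D x).trace = (m x).trace := fun x =>
    Finset.sum_congr rfl fun i _ => by simp [hD, h.preorder.refl i]
  have hDsmul : ∀ (c : k) x, D (c • x) = c • D x := by
    intro c x
    ext i j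
    simp [hD]
  -- Outside the radical, e has a nonzero entry at some (a, b) inside a block. Modulo the radical e
  -- E_ba e = c e. The entry at (a, b) gives c = e_ab, and taking traces gives e_ab = c tr e, so tr
  -- e = 1.
  obtain ⟨a, b, hab, hba, hne⟩ : ∃ a b, r a b ∧ r b a ∧ D e a b ≠ 0 := by
    by_contra hcon
    push Not at hcon
    refine he ((h.mem_jacobson_iff e).2 fun i j hij => ?_)
    by_cases hij' : r i j
    · have := hcon i j hij' hij
      simpa [hD, hij] using this
    · exact h.eq_zero e hij'
  obtain ⟨x, hx⟩ := h.exists_single hba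
  have hDx : D x = Matrix.single b a 1 := by
    ext i j
    simp only [hD, Matrix.of_apply, hx, Matrix.single_apply]
    split_ifs with h1 h2 h2
    · rfl
    · rfl
    · exact absurd (h2.1 ▸ h2.2 ▸ hab) h1
    · rfl
  obtain ⟨c, hc⟩ := hprim x
  have e1 : D e * D x * D e = c • D e := by
    rw [← hDmul, ← hDmul, hDeq _ _ hc, hDsmul]
  have e2 : D e * D e = D e := by rw [← hDmul, hDeq _ _ hidem]
  have e3 : D e a b * D e a b = c * D e a b := by
    have := congrFun (congrFun e1 a) b
    rw [hDx] at this
    simpa [Matrix.mul_apply, Matrix.single_apply, Finset.sum_mul, ite_and] using this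
  have e4 : D e a b = c * (D e).trace := by
    have := congrArg Matrix.trace e1
    rw [mul_assoc, Matrix.trace_mul_comm, mul_assoc, e2, hDx, Matrix.trace_smul,
      smul_eq_mul] at this
    rw [← this]
    simp [Matrix.trace, Matrix.mul_apply, Matrix.single_apply, ite_and]
  have e5 : c = D e a b := (mul_right_cancel₀ hne e3).symm
  rw [e5] at e4
  rw [← hDtr]
  exact (mul_left_cancel₀ hne (by rw [mul_one]; exact e4)).symm

end IsBlockTriangular

/-- An isomorphism of the quotients by the Jacobson radicals preserves the traces. -/
theorem trace_eq_of_quotient_equiv {κ : Type*} [Fintype κ] [DecidableEq κ]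
    {s : κ → κ → Prop} {Q : Type*} [Ring Q] [Algebra k Q] {m' : Q →ₐ[k] Matrix κ κ k}
    (h : IsBlockTriangular r m) (h' : IsBlockTriangular s m')
    (φ : (P ⧸ Ring.jacobson P) ≃ₐ[k] (Q ⧸ Ring.jacobson Q)) (a : P) (b : Q)
    (hab : φ (Ideal.Quotient.mk _ a) = Ideal.Quotient.mk _ b) :
    (m a).trace = (m' b).trace := by
  have hlift : ∀ a : P, ∃ b : Q, φ (Ideal.Quotient.mk _ a) = Ideal.Quotient.mk _ b := fun a =>
    (Ideal.Quotient.mk_surjective (φ (Ideal.Quotient.mk _ a))).imp fun _ => Eq.symm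
  choose l hl using hlift
  have key : ∀ (b b' : Q), Ideal.Quotient.mk (Ring.jacobson Q) b = Ideal.Quotient.mk _ b' →
      (m' b).trace = (m' b').trace := by
    intro b b' hb
    have := h'.trace_eq_zero_of_mem_jacobson (Ideal.Quotient.eq.1 hb)
    rwa [map_sub, Matrix.trace_sub, sub_eq_zero] at this
  have hsmul : ∀ (c : k) (x : P) (y : Q), φ (Ideal.Quotient.mk _ x) = Ideal.Quotient.mk _ y →
      Ideal.Quotient.mk (Ring.jacobson Q) (c • y) = φ (Ideal.Quotient.mk _ (c • x)) :=
    fun c x y hxy => ((map_smul φ c (Ideal.Quotient.mk _ x)).trans (by rw [hxy]; rfl)).symm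
  -- The trace of Q transported along φ; it does not depend on the lifts because the trace of Q
  -- kills the radical. It vanishes on commutators, so it is determined by its values on the
  -- diagonal matrix units.
  let T : P →ₗ[k] k :=
    { toFun := fun a => (m' (l a)).trace
      map_add' := fun a a' => by
        rw [← Matrix.trace_add, ← map_add]
        apply key
        rw [← hl, map_add, map_add, map_add, hl, hl]
      map_smul' := fun c a => by
        rw [RingHom.id_apply, ← Matrix.trace_smul, ← map_smul]
        apply key
        rw [← hl, hsmul c a _ (hl a)] }
  have hT : ∀ x y, T (x * y) = T (y * x) := by
    intro x y
    change (m' (l (x * y))).trace = (m' (l (y * x))).trace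
    rw [key (l (x * y)) (l x * l y) (by rw [← hl, map_mul, map_mul, map_mul, hl, hl]),
      key (l (y * x)) (l y * l x) (by rw [← hl, map_mul, map_mul, map_mul, hl, hl]),
      map_mul, map_mul, Matrix.trace_mul_comm]
  have hE : ∀ i j, ∃ x : P, r i j → m x = Matrix.single i j 1 := fun i j => by
    by_cases hij : r i j
    · exact (h.exists_single hij).imp fun _ hx _ => hx
    · exact ⟨0, fun hc => absurd hc hij⟩
  choose E hE using hE
  have hTE : ∀ i j, r i j → T (E i j) = if i = j then 1 else 0 := by
    intro i j hij
    have hi := h.preorder.refl i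
    have hEii := hE i i hi
    split_ifs with hc
    · subst hc
      -- Modulo the radicals, φ carries E_ii to a nonzero idempotent whose corner consists of
      -- scalars. These properties alone force trace 1, so it does not matter to which block φ sends
      -- it.
      refine h'.trace_eq_one (e := l (E i i)) ?_ ?_ ?_
      · intro hmem
        rw [← Ideal.Quotient.eq_zero_iff_mem, ← hl, EmbeddingLike.map_eq_zero_iff,
          Ideal.Quotient.eq_zero_iff_mem] at hmem
        have := (h.mem_jacobson_iff _).1 hmem i i hi
        rw [hEii] at this
        simp at this
      · rw [← Ideal.Quotient.eq_zero_iff_mem, map_sub, map_mul, ← hl, ← map_mul, ← map_mul,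
          ← map_sub, ← map_sub]
        have : E i i * E i i - E i i = 0 := h.injective (by rw [map_sub, map_mul, hEii]; simp)
        rw [this, map_zero, map_zero]
      · intro y
        obtain ⟨x, hx⟩ := Ideal.Quotient.mk_surjective (φ.symm (Ideal.Quotient.mk _ y))
        have hx' : φ (Ideal.Quotient.mk _ x) = Ideal.Quotient.mk _ y := by
          rw [hx, AlgEquiv.apply_symm_apply]
        refine ⟨m x i i, ?_⟩
        rw [← Ideal.Quotient.eq_zero_iff_mem, map_sub, map_mul, map_mul, hsmul _ _ _ (hl _), ← hl, ←
          hx',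
          ← map_mul, ← map_mul, ← map_mul, ← map_mul, ← map_sub, ← map_sub]
        have : E i i * x * E i i - m x i i • E i i = 0 := h.injective (by
          rw [map_sub, map_mul, map_mul, map_smul, hEii, Matrix.single_mul_mul_single]; simp)
        rw [this, map_zero, map_zero]
    -- For i ≠ j the unit E_ij is the commutator of E_ii and E_ij.
    · have e1 : E i i * E i j = E i j := h.injective (by
        rw [map_mul, hEii, hE i j hij]; simp)
      have e2 : E i j * E i i = 0 := h.injective (by
        rw [map_mul, hEii, hE i j hij, map_zero, Matrix.single_mul_single_of_ne]
        exact fun hc' => hc hc'.symm)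
      rw [← e1, hT, e2, map_zero]
  have hsum : a = ∑ i, ∑ j, m a i j • E i j := by
    apply h.injective
    rw [map_sum]
    simp_rw [map_sum, map_smul]
    conv_lhs => rw [Matrix.matrix_eq_sum_single (m a)]
    refine Finset.sum_congr rfl fun i _ => Finset.sum_congr rfl fun j _ => ?_
    by_cases hij : r i j
    · rw [hE i j hij, Matrix.smul_single, smul_eq_mul, mul_one]
    · rw [h.eq_zero a hij, zero_smul, Matrix.single_zero]
  have hTa : T a = (m a).trace := by
    conv_lhs => rw [hsum]
    rw [map_sum]
    refine Finset.sum_congr rfl fun i _ => ?_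
    rw [map_sum, Finset.sum_eq_single i]
    · rw [map_smul, hTE i i (h.preorder.refl i), if_pos rfl, smul_eq_mul, mul_one]
      rfl
    · intro j _ hj
      by_cases hij : r i j
      · rw [map_smul, hTE i j hij, if_neg hj.symm, smul_zero]
      · rw [h.eq_zero a hij, zero_smul, map_zero]
    · simp
  rw [← hTa]
  exact key _ _ (by rw [← hl, hab])

end BlockTriangular

/-! ### Parabolic subalgebras and maximal isotropy of the glued algebra -/

section Parabolic

variable {k : Type u} [Field k] {W₁ : Type v} {W₂ : Type w}
  [AddCommGroup W₁] [Module k W₁] [AddCommGroup W₂] [Module k W₂]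

/-- Adding the relations from `S` to the order of the indices keeps it transitive: two added
relations compose because `S` is closed under sums, and an added relation composes with `≤` because
`S` contains the summands of its elements. -/
theorem IsClosedWeights.isTotalPreorder {n : ℕ} {S : Set (Fin n × Fin n)}
    (hS : IsClosedWeights S) : IsTotalPreorder fun i j : Fin n => i ≤ j ∨ (j, i) ∈ S where
  trans i j l hij hjl := by
    rcases le_or_gt i l with hil | hil
    · exact Or.inl hil
    right
    rcases hij with hij | hij
    · have hjl' : (l, j) ∈ S := hjl.resolve_left (by order)
      rcases hij.eq_or_lt with rfl | hlt
      · exact hjl'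
      · exact ((hS.2 l i j hil hlt).1 hjl').1
    · have hlt : j < i := hS.1 _ hij
      rcases hjl with hjl | hjl
      · rcases hjl.eq_or_lt with rfl | hlt'
        · exact hij
        · exact ((hS.2 j l i hlt' hil).1 hij).2
      · exact (hS.2 l j i (hS.1 _ hjl) hlt).2 ⟨hjl, hij⟩
  total i j := (le_total i j).imp Or.inl Or.inl

theorem IsParabolic.exists_isBlockTriangular {P : Subalgebra k (Module.End k W₁)}
    (hP : IsParabolic P) : ∃ (n : ℕ) (b : Module.Basis (Fin n) k W₁) (r : Fin n → Fin n → Prop),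
      IsBlockTriangular r ((LinearMap.toMatrixAlgEquiv b : _ →ₐ[k] _).comp P.val) ∧
      ∀ a : Module.End k W₁, a ∈ P ↔ ∀ i j, ¬ r i j → LinearMap.toMatrixAlgEquiv b a i j = 0 := by
  obtain ⟨n, b, S, hS, h⟩ := hP
  have h' : ∀ a : Module.End k W₁, a ∈ P ↔
      ∀ i j : Fin n, ¬ (i ≤ j ∨ (j, i) ∈ S) → LinearMap.toMatrixAlgEquiv b a i j = 0 := by
    intro a
    rw [h]
    refine forall₂_congr fun i j => ?_
    rw [not_or, not_le, and_imp]
    rfl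
  refine ⟨n, b, _, ⟨hS.isTotalPreorder, ?_, fun A => ⟨?_, fun hA => ?_⟩⟩, h'⟩
  · exact (LinearMap.toMatrixAlgEquiv b).injective.comp Subtype.val_injective
  · rintro ⟨x, rfl⟩
    exact (h' _).1 x.2
  · refine ⟨⟨(LinearMap.toMatrixAlgEquiv b).symm A, (h' _).2 ?_⟩,
      (LinearMap.toMatrixAlgEquiv b).apply_symm_apply A⟩
    rwa [AlgEquiv.apply_symm_apply]

theorem mem_gluedSubalgebra {P₁ : Subalgebra k (Module.End k W₁)}
    {P₂ : Subalgebra k (Module.End k W₂)} {φ : Levi P₁ ≃ₐ[k] Levi P₂}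
    (x : Module.End k W₁ × Module.End k W₂) :
    x ∈ gluedSubalgebra P₁ P₂ φ ↔ ∃ (a : P₁) (b : P₂), x = (a.1, b.1) ∧
      φ (Ideal.Quotient.mk _ a) = Ideal.Quotient.mk _ b := by
  constructor
  · rintro ⟨y, hy, rfl⟩
    exact ⟨y.1, y.2, rfl, hy⟩
  · rintro ⟨a, b, rfl, h⟩
    exact ⟨(a, b), h, rfl⟩

theorem trace_eq_trace_toMatrixAlgEquiv {n : ℕ} (b : Module.Basis (Fin n) k W₁)
    (a : Module.End k W₁) :
    LinearMap.trace k W₁ a = (LinearMap.toMatrixAlgEquiv b a).trace :=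
  LinearMap.trace_eq_matrix_trace k b a

/-- Isotropy: the difference of the traces vanishes on the glued algebra, which is closed under
products. Maximality: an orthogonal element is forced into P₁ × P₂ by pairing it with the two
radicals, and its second component is then determined modulo J(P₂) by pairing with all of P₂. -/
theorem isMaximalIsotropic_gluedSubalgebra {P₁ : Subalgebra k (Module.End k W₁)}
    {P₂ : Subalgebra k (Module.End k W₂)} (h₁ : IsParabolic P₁) (h₂ : IsParabolic P₂)
    (φ : Levi P₁ ≃ₐ[k] Levi P₂) : IsMaximalIsotropic (gluedSubalgebra P₁ P₂ φ) := by
  obtain ⟨n₁, b₁, r₁, H₁, hP₁⟩ := h₁.exists_isBlockTriangular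
  obtain ⟨n₂, b₂, r₂, H₂, hP₂⟩ := h₂.exists_isBlockTriangular
  have htr : ∀ x ∈ gluedSubalgebra P₁ P₂ φ,
      LinearMap.trace k W₁ x.1 - LinearMap.trace k W₂ x.2 = 0 := by
    intro x hx
    obtain ⟨a, b, rfl, hab⟩ := (mem_gluedSubalgebra x).1 hx
    rw [sub_eq_zero, trace_eq_trace_toMatrixAlgEquiv b₁, trace_eq_trace_toMatrixAlgEquiv b₂]
    exact trace_eq_of_quotient_equiv H₁ H₂ φ a b hab
  have hiso : IsIsotropic (Subalgebra.toSubmodule (gluedSubalgebra P₁ P₂ φ)) :=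
    fun x hx y hy => htr (x * y) (Subalgebra.mul_mem _ hx hy)
  refine ⟨hiso, fun J hJ hle x hx => ?_⟩
  have horth : ∀ y ∈ gluedSubalgebra P₁ P₂ φ, trPairing y x = 0 := fun y hy =>
    hJ y (hle hy) x hx
  have entry₁ : ∀ i j (a : Module.End k W₁), LinearMap.toMatrixAlgEquiv b₁ a = Matrix.single j i 1 →
      ∀ z, LinearMap.trace k W₁ (a * z) = LinearMap.toMatrixAlgEquiv b₁ z i j := by
    intro i j a ha z
    rw [trace_eq_trace_toMatrixAlgEquiv b₁, map_mul, ha, Matrix.trace_single_mul, one_smul]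
  have entry₂ : ∀ i j (a : Module.End k W₂), LinearMap.toMatrixAlgEquiv b₂ a = Matrix.single j i 1 →
      ∀ z, LinearMap.trace k W₂ (a * z) = LinearMap.toMatrixAlgEquiv b₂ z i j := by
    intro i j a ha z
    rw [trace_eq_trace_toMatrixAlgEquiv b₂, map_mul, ha, Matrix.trace_single_mul, one_smul]
  -- For a position (i, j) outside the blocks, E_ji lies in the radical, so (E_ji, 0) is in the
  -- glued algebra; pairing with it reads off the entry of x.1 that has to vanish.
  have hx₁ : x.1 ∈ P₁ := by
    refine (hP₁ _).2 fun i j hij => ?_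
    have hji : r₁ j i := (H₁.preorder.total i j).resolve_left hij
    obtain ⟨a, ha⟩ := H₁.exists_single hji
    have haJ : a ∈ Ring.jacobson P₁ := (H₁.mem_jacobson_iff a).2 fun p q hqp => by
      rw [ha, Matrix.single_apply_of_ne]
      rintro ⟨rfl, rfl⟩
      exact hij hqp
    have := horth (a.1, 0) ((mem_gluedSubalgebra _).2 ⟨a, 0, rfl, by
      rw [Ideal.Quotient.eq_zero_iff_mem.2 haJ, map_zero (Ideal.Quotient.mk _)]
      exact map_zero φ.toRingEquiv⟩)
    rw [← entry₁ i j a.1 ha]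
    simpa [trPairing] using this
  have hx₂ : x.2 ∈ P₂ := by
    refine (hP₂ _).2 fun i j hij => ?_
    have hji : r₂ j i := (H₂.preorder.total i j).resolve_left hij
    obtain ⟨a, ha⟩ := H₂.exists_single hji
    have haJ : a ∈ Ring.jacobson P₂ := (H₂.mem_jacobson_iff a).2 fun p q hqp => by
      rw [ha, Matrix.single_apply_of_ne]
      rintro ⟨rfl, rfl⟩
      exact hij hqp
    have := horth (0, a.1) ((mem_gluedSubalgebra _).2 ⟨0, a, rfl, by
      rw [Ideal.Quotient.eq_zero_iff_mem.2 haJ, map_zero (Ideal.Quotient.mk _)]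
      exact map_zero φ.toRingEquiv⟩)
    rw [← entry₂ i j a.1 ha]
    simpa [trPairing] using this
  -- z completes x.1 to an element of the glued algebra. The difference (0, x.2 - z) is orthogonal
  -- to pairs (c, a) in which a is any element of P₂, so x.2 - z lies in J(P₂).
  obtain ⟨z, hz⟩ := Ideal.Quotient.mk_surjective (φ (Ideal.Quotient.mk _ ⟨x.1, hx₁⟩))
  have hxz : (x.1, z.1) ∈ gluedSubalgebra P₁ P₂ φ :=
    (mem_gluedSubalgebra _).2 ⟨⟨x.1, hx₁⟩, z, rfl, hz.symm⟩
  refine (mem_gluedSubalgebra _).2 ⟨⟨x.1, hx₁⟩, ⟨x.2, hx₂⟩, rfl, ?_⟩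
  rw [← hz, Ideal.Quotient.eq, H₂.mem_jacobson_iff]
  intro i j hji
  obtain ⟨a, ha⟩ := H₂.exists_single hji
  obtain ⟨c, hc⟩ := Ideal.Quotient.mk_surjective (φ.symm (Ideal.Quotient.mk _ a))
  have hca : (c.1, a.1) ∈ gluedSubalgebra P₁ P₂ φ :=
    (mem_gluedSubalgebra _).2 ⟨c, a, rfl, by rw [hc, AlgEquiv.apply_symm_apply]⟩
  have e1 := horth _ hca
  have e2 := hiso _ hca _ hxz
  have e3 : LinearMap.trace k W₂ (a.1 * x.2) = LinearMap.trace k W₂ (a.1 * z.1) := by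
    simp only [trPairing] at e1 e2
    rw [sub_eq_zero] at e1 e2
    rw [← e1, ← e2]
  rw [entry₂ i j a.1 ha, entry₂ i j a.1 ha] at e3
  rw [map_sub, Matrix.sub_apply, sub_eq_zero]
  exact e3.symm

end Parabolic

end Parabolic

section Line

/-! ### Germs and points of the projective line -/

section Constants

variable {A σ : Type u} [CommRing A] [SetLike σ A] [AddSubgroupClass σ A] (𝒜 : ℕ → σ) [GradedRing 𝒜]

/-- The map to the spectrum of the degree zero part is defined through the chart D₊(1), which is all
of Proj. Unwinding this makes constants computable in the homogeneous localizations that describe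
the stalks. -/
theorem toSpecZero_appTop :
    (Scheme.ΓSpecIso _).inv ≫ (Proj.toSpecZero 𝒜).appTop =
     CommRingCat.ofHom (HomogeneousLocalization.fromZeroRingHom 𝒜 _) ≫ Proj.awayToSection 𝒜 1 ≫
       (Proj 𝒜).presheaf.map (eqToHom (Proj.basicOpen_one 𝒜).symm).op := by
  have e : (Scheme.topIso (Proj 𝒜)).inv ≫ (Scheme.isoOfEq (Proj 𝒜) (Proj.basicOpen_one 𝒜)).inv ≫
      (Proj.basicOpen 𝒜 1).ι = 𝟙 _ := by simp
  have e2 : (Proj.basicOpen 𝒜 1).ι.appTop ≫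
      (Scheme.isoOfEq (Proj 𝒜) (Proj.basicOpen_one 𝒜)).inv.appTop ≫
      (Scheme.topIso (Proj 𝒜)).inv.appTop = 𝟙 _ := by
    have := congrArg Scheme.Hom.appTop e
    rwa [Scheme.Hom.comp_appTop, Scheme.Hom.comp_appTop, Category.assoc] at this
  have e3 : (Proj.basicOpen 𝒜 1).topIso.inv =
      (Proj 𝒜).presheaf.map (eqToHom (Proj.basicOpen_one 𝒜).symm).op ≫
        (Proj.basicOpen 𝒜 1).ι.appTop := by
    rw [Scheme.Opens.ι_appTop, Scheme.Opens.topIso_inv]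
    exact (Proj 𝒜).presheaf.map_comp (eqToHom (Proj.basicOpen_one 𝒜).symm).op (homOfLE le_top).op
  have e4 : (Proj.basicOpenToSpec 𝒜 1).appTop = _ := Proj.basicOpenToSpec_app_top 𝒜 (1 : A)
  rw [Proj.toSpecZero]
  simp only [Scheme.Hom.comp_appTop, Category.assoc]
  rw [← Scheme.ΓSpecIso_inv_naturality_assoc, e4, Category.assoc, Category.assoc,
    Iso.inv_hom_id_assoc, e3, Category.assoc, e2, Category.comp_id]

end Constants

variable (k : Type u) [Field k]

/-- The grading of `k[x₀, x₁]` by degree. -/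
abbrev G := MvPolynomial.homogeneousSubmodule (Fin 2) k

instance : IsReduced (P1 k) := by
  have : ∀ x, _root_.IsReduced ((P1 k).presheaf.stalk x) := fun x =>
    haveI := x.isPrime
    isReduced_of_injective ((algebraMap (HomogeneousLocalization.AtPrime (G k)
      x.asHomogeneousIdeal.toIdeal) (Localization.AtPrime x.asHomogeneousIdeal.toIdeal)).comp
      (Proj.stalkIso' (G k) x).toRingHom) ((HomogeneousLocalization.val_injective _).comp
      (RingEquiv.injective _))
  exact isReduced_of_isReduced_stalk _

instance : IsIntegral (P1 k) := isIntegral_of_irreducibleSpace_of_isReduced _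

instance : Algebra.FiniteType (G k 0) (MvPolynomial (Fin 2) k) :=
  have : IsScalarTower k (G k 0) (MvPolynomial (Fin 2) k) :=
    ⟨fun _ _ _ => Algebra.smul_mul_assoc _ _ _⟩
  Algebra.FiniteType.of_restrictScalars_finiteType k _ _

variable {k}

theorem stalkIso'_constStalk (p : P1 k) (c : k) :
    Proj.stalkIso' (G k) p (constStalk (P1.str k) p c) =
      HomogeneousLocalization.fromZeroRingHom (G k) _ (algebraMap k (G k 0) c) := by
  have h : constStalk (P1.str k) p c = (P1 k).presheaf.germ ⊤ p trivial
      ((P1 k).presheaf.map (eqToHom (Proj.basicOpen_one (G k)).symm).op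
        (Proj.awayToSection (G k) 1 (HomogeneousLocalization.fromZeroRingHom (G k) _
          (algebraMap k (G k 0) c)))) := by
    have e := toSpecZero_appTop (G k)
    have e2 : (Scheme.ΓSpecIso (.of k)).inv ≫ (P1.str k).appTop =
        CommRingCat.ofHom (algebraMap k (G k 0)) ≫ (Scheme.ΓSpecIso (.of (G k 0))).inv ≫
          (Proj.toSpecZero (G k)).appTop := by
      rw [P1.str, Scheme.Hom.comp_appTop, ← Scheme.ΓSpecIso_inv_naturality_assoc]
    rw [e] at e2
    have e3 := ConcreteCategory.congr_hom e2 c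
    simp only [constStalk, constSec]
    refine congrArg ((P1 k).presheaf.germ ⊤ p trivial).hom (Eq.trans ?_ e3)
    change ((P1 k).presheaf.map (𝟙 _)) _ = _
    rw [CategoryTheory.Functor.map_id]
    rfl
  rw [h]
  erw [Proj.stalkIso'_germ]
  rfl

/-- The open set where the homogeneous coordinate `xⱼ` does not vanish. -/
abbrev P1.chart (k : Type u) [Field k] (j : Fin 2) : (P1 k).Opens :=
  Proj.basicOpen (G k) (MvPolynomial.X j)

/-- The function `xᵢ / xᵢ₊₁` on the open set `xᵢ₊₁ ≠ 0`. -/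
def P1.coordSec (k : Type u) [Field k] (i : Fin 2) : Γ(P1 k, P1.chart k (i + 1)) :=
  Proj.awayToSection (G k) (MvPolynomial.X (i + 1)) (HomogeneousLocalization.mk
    ⟨1, ⟨MvPolynomial.X i, MvPolynomial.isHomogeneous_X k i⟩,
      ⟨MvPolynomial.X (i + 1), MvPolynomial.isHomogeneous_X k (i+1)⟩, ⟨1, pow_one _⟩⟩)

instance P1.isPrime (p : P1 k) : p.asHomogeneousIdeal.toIdeal.IsPrime :=
  ProjectiveSpectrum.isPrime p

/-- The embedding of the local ring of `p` into the localization of the polynomial ring. -/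
def P1.stalkToLocalization (p : P1 k) :
    (P1 k).presheaf.stalk p →+* Localization.AtPrime p.asHomogeneousIdeal.toIdeal :=
  (algebraMap (HomogeneousLocalization.AtPrime (G k) p.asHomogeneousIdeal.toIdeal)
    (Localization.AtPrime p.asHomogeneousIdeal.toIdeal)).comp (Proj.stalkIso' (G k) p).toRingHom

theorem P1.stalkToLocalization_injective (p : P1 k) :
    Function.Injective (P1.stalkToLocalization p) :=
  (HomogeneousLocalization.val_injective _).comp (RingEquiv.injective _)

theorem P1.isUnit_of_isUnit_stalkToLocalization (p : P1 k) {f}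
    (hf : IsUnit (P1.stalkToLocalization p f)) : IsUnit f := by
  have := (HomogeneousLocalization.isUnit_iff_isUnit_val (G k) p.asHomogeneousIdeal.toIdeal _).1 hf
  exact (MulEquiv.isUnit_map (Proj.stalkIso' (G k) p)).1 this

theorem P1.stalkToLocalization_constStalk (p : P1 k) (c : k) :
    P1.stalkToLocalization p (constStalk (P1.str k) p c) =
      algebraMap (MvPolynomial (Fin 2) k) _ (MvPolynomial.C c) := by
  change (Proj.stalkIso' (G k) p (constStalk (P1.str k) p c)).val = _
  rw [stalkIso'_constStalk]
  exact Localization.mk_one_eq_algebraMap _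

theorem P1.stalkToLocalization_coordSec (i : Fin 2) (p : P1 k) (hp : p ∈ P1.chart k (i + 1)) :
    P1.stalkToLocalization p ((P1 k).presheaf.germ _ p hp (P1.coordSec k i)) *
        algebraMap (MvPolynomial (Fin 2) k) _ (MvPolynomial.X (i + 1)) =
      algebraMap (MvPolynomial (Fin 2) k) _ (MvPolynomial.X i) := by
  change (Proj.stalkIso' (G k) p _).val * _ = _
  erw [Proj.stalkIso'_germ]
  change Localization.mk (MvPolynomial.X i) ⟨MvPolynomial.X (i+1), hp⟩ * _ = _
  rw [Localization.mk_eq_mk']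
  exact IsLocalization.mk'_spec _ _ _

theorem P1.exists_num_den (p : P1 k) (f : (P1 k).presheaf.stalk p) :
    ∃ (d : ℕ) (a b : MvPolynomial (Fin 2) k), a.IsHomogeneous d ∧ b.IsHomogeneous d ∧ b ∉
      p.asHomogeneousIdeal.toIdeal ∧
      P1.stalkToLocalization p f * algebraMap _ _ b = algebraMap _ _ a := by
  obtain ⟨z, hz⟩ := HomogeneousLocalization.mk_surjective (Proj.stalkIso' (G k) p f)
  refine ⟨z.deg, z.num, z.den, z.num.2, z.den.2, z.den_mem, ?_⟩
  change (Proj.stalkIso' (G k) p f).val * _ = _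
  rw [← hz, HomogeneousLocalization.val_mk, Localization.mk_eq_mk']
  exact IsLocalization.mk'_spec _ _ _

theorem eval₂_smul_of_isHomogeneous {R L σ : Type*} [CommSemiring R] [CommSemiring L] (θ : R →+* L)
    (w : L) (v : σ → L) {F : MvPolynomial σ R} {d : ℕ} (hF : F.IsHomogeneous d) :
    MvPolynomial.eval₂ θ (fun l => w * v l) F = w ^ d * MvPolynomial.eval₂ θ v F := by
  rw [MvPolynomial.eval₂_eq, MvPolynomial.eval₂_eq, Finset.mul_sum]
  refine Finset.sum_congr rfl fun s hs => ?_
  rw [hF.degree_eq_sum_deg_support hs]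
  simp_rw [mul_pow]
  rw [Finset.prod_mul_distrib, Finset.prod_pow_eq_pow_sum]
  ring

/-- Setting `xᵢ₊₁ = 1` in a polynomial. -/
def dehomogenize (i : Fin 2) (F : MvPolynomial (Fin 2) k) : Polynomial k :=
  MvPolynomial.eval₂ Polynomial.C (fun l => if l = i then Polynomial.X else 1) F

theorem fin_two_add_one_ne (i : Fin 2) : i + 1 ≠ i := by fin_cases i <;> decide

theorem fin_two_eq_or (i l : Fin 2) : l = i ∨ l = i + 1 := by
  fin_cases i <;> fin_cases l <;> decide

/-- The polynomial `a` in the coordinate `xᵢ / xᵢ₊₁`, as a germ. -/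
def P1.polyGerm (i : Fin 2) (p : P1 k) (hp : p ∈ P1.chart k (i + 1)) :
    Polynomial k →+* (P1 k).presheaf.stalk p :=
  Polynomial.eval₂RingHom (constStalk (P1.str k) p) ((P1 k).presheaf.germ _ p hp (P1.coordSec k i))

/-- Homogeneity: pulling a power of xᵢ₊₁ out of a form of degree d leaves the dehomogenized
polynomial in xᵢ / xᵢ₊₁. This turns fractions of forms into fractions of polynomials in one
coordinate. -/
theorem P1.algebraMap_eq_mul_polyGerm (i : Fin 2) (p : P1 k) (hp : p ∈ P1.chart k (i + 1))
    {F : MvPolynomial (Fin 2) k} {d : ℕ} (hF : F.IsHomogeneous d) :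
    algebraMap _ (Localization.AtPrime p.asHomogeneousIdeal.toIdeal) F =
      algebraMap (MvPolynomial (Fin 2) k) _ (MvPolynomial.X (i + 1)) ^ d * P1.stalkToLocalization p
        (P1.polyGerm i p hp (dehomogenize i F)) := by
  set θ := P1.stalkToLocalization p
  set u := θ ((P1 k).presheaf.germ _ p hp (P1.coordSec k i)) with hu
  have h1 : θ (P1.polyGerm i p hp (dehomogenize i F)) = MvPolynomial.eval₂
    (θ.comp (constStalk (P1.str k) p)) (fun l => if l = i then u else 1) F := by
    change (θ.comp (P1.polyGerm i p hp)) (dehomogenize i F) = _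
    rw [dehomogenize, MvPolynomial.eval₂_comp_left]
    congr 1
    · ext c
      simp [P1.polyGerm]
    · ext l
      simp only [Function.comp_apply]
      split_ifs
      · simp [P1.polyGerm, hu]
      · simp
  rw [h1, ← eval₂_smul_of_isHomogeneous _ _ _ hF]
  have h2 : (fun l => algebraMap (MvPolynomial (Fin 2) k)
    (Localization.AtPrime p.asHomogeneousIdeal.toIdeal) (MvPolynomial.X (i + 1)) * if l = i then u
    else 1) = fun l => algebraMap (MvPolynomial (Fin 2) k) _ (MvPolynomial.X l) := by
    ext l
    rcases fin_two_eq_or i l with rfl | rfl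
    · rw [if_pos rfl, mul_comm]
      exact P1.stalkToLocalization_coordSec _ p hp
    · rw [if_neg (fin_two_add_one_ne i), mul_one]
  have h3 : θ.comp (constStalk (P1.str k) p) =
      (algebraMap (MvPolynomial (Fin 2) k) _).comp MvPolynomial.C := by
    ext c
    exact P1.stalkToLocalization_constStalk p c
  rw [h2, h3, ← MvPolynomial.coe_eval₂Hom]
  refine congrFun (congrArg DFunLike.coe (?_ : algebraMap _ _ = _)) F
  apply MvPolynomial.ringHom_ext <;> simp

theorem P1.isUnit_algebraMap (p : P1 k) {F : MvPolynomial (Fin 2) k} :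
    IsUnit (algebraMap _ (Localization.AtPrime p.asHomogeneousIdeal.toIdeal) F) ↔
      F ∉ p.asHomogeneousIdeal.toIdeal :=
  IsLocalization.AtPrime.isUnit_to_map_iff _ _ _

/-- Every germ at a point of the chart is a quotient of polynomials in the coordinate. -/
theorem P1.exists_polyGerm (i : Fin 2) (p : P1 k) (hp : p ∈ P1.chart k (i + 1))
    (f : (P1 k).presheaf.stalk p) :
    ∃ a b : Polynomial k, IsUnit (P1.polyGerm i p hp b) ∧ f * P1.polyGerm i p hp b = P1.polyGerm i p
      hp a := by
  obtain ⟨d, a, b, ha, hb, hbp, e⟩ := P1.exists_num_den p f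
  have hX : IsUnit (algebraMap _ (Localization.AtPrime p.asHomogeneousIdeal.toIdeal)
    (MvPolynomial.X (i + 1) : MvPolynomial (Fin 2) k)) :=
    (P1.isUnit_algebraMap p).2 hp
  refine ⟨dehomogenize i a, dehomogenize i b, ?_, ?_⟩
  · apply P1.isUnit_of_isUnit_stalkToLocalization
    have := (P1.isUnit_algebraMap p).2 hbp
    rw [P1.algebraMap_eq_mul_polyGerm i p hp hb] at this
    exact isUnit_of_mul_isUnit_right this
  · apply P1.stalkToLocalization_injective
    rw [P1.algebraMap_eq_mul_polyGerm i p hp hb, P1.algebraMap_eq_mul_polyGerm i p hp ha] at e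
    apply (hX.pow d).mul_left_cancel
    rw [← e, map_mul]
    ring

theorem P1.coordPoint_mem_chart (i : Fin 2) : P1.coordPoint k i ∈ P1.chart k (i + 1) := by
  change MvPolynomial.X (i + 1) ∉ Ideal.span {(MvPolynomial.X i : MvPolynomial (Fin 2) k)}
  rw [Ideal.mem_span_singleton, MvPolynomial.X_dvd_X]
  fin_cases i <;> simp

theorem P1.coordSec_mem_maximalIdeal_of_mem (i : Fin 2) (p : P1 k) (hp : p ∈ P1.chart k (i + 1))
    (hX : MvPolynomial.X i ∈ p.asHomogeneousIdeal.toIdeal) :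
    (P1 k).presheaf.germ _ _ hp (P1.coordSec k i) ∈ IsLocalRing.maximalIdeal
      ((P1 k).presheaf.stalk p) := by
  rw [IsLocalRing.mem_maximalIdeal, mem_nonunits_iff]
  intro h
  have := P1.stalkToLocalization_coordSec i _ hp
  have h2 := (h.map (P1.stalkToLocalization _)).mul ((P1.isUnit_algebraMap _).2 hp)
  rw [this, P1.isUnit_algebraMap] at h2
  exact h2 hX

theorem P1.coordSec_mem_maximalIdeal (i : Fin 2) :
    (P1 k).presheaf.germ _ _ (P1.coordPoint_mem_chart i) (P1.coordSec k i) ∈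
      IsLocalRing.maximalIdeal ((P1 k).presheaf.stalk (P1.coordPoint k i)) :=
  P1.coordSec_mem_maximalIdeal_of_mem i _ _ (Ideal.mem_span_singleton_self _)

theorem P1.polyGerm_sub_mem_span (i : Fin 2) (p : P1 k) (hp : p ∈ P1.chart k (i + 1))
    (a : Polynomial k) :
    P1.polyGerm i p hp a - constStalk (P1.str k) p (a.coeff 0) ∈ Ideal.span
      {(P1 k).presheaf.germ _ _ hp (P1.coordSec k i)} := by
  rw [Ideal.mem_span_singleton]
  have h := map_dvd (P1.polyGerm i p hp) (Polynomial.X_dvd_sub_C (p := a))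
  rw [map_sub] at h
  simpa [P1.polyGerm] using h

theorem constStalk_isUnit {X : Scheme.{u}} (s : X ⟶ Spec (.of k)) (x : X) {c : k} (hc : c ≠ 0) :
    IsUnit (constStalk s x c) := (Ne.isUnit hc).map _

/-- A polynomial differs from its constant term by a multiple of the coordinate, which is not a unit
at p. The point is only assumed to satisfy xᵢ = 0, so that the criterion can be used to identify it.
-/
theorem P1.isUnit_polyGerm_iff (i : Fin 2) (p : P1 k) (hp : p ∈ P1.chart k (i + 1))
    (hX : MvPolynomial.X i ∈ p.asHomogeneousIdeal.toIdeal) (a : Polynomial k) :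
    IsUnit (P1.polyGerm i p hp a) ↔ a.coeff 0 ≠ 0 := by
  have h1 := P1.coordSec_mem_maximalIdeal_of_mem i p hp hX
  have h2 := (Ideal.span_singleton_le_iff_mem _).2 h1 (P1.polyGerm_sub_mem_span i p hp a)
  have h3 : IsUnit (constStalk (P1.str k) p (a.coeff 0)) ↔ a.coeff 0 ≠ 0 :=
    ⟨fun h h0 => by simp [h0] at h, fun h => constStalk_isUnit _ _ h⟩
  rw [← h3, ← not_iff_not, ← mem_nonunits_iff, ← mem_nonunits_iff, ← IsLocalRing.mem_maximalIdeal, ←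
    IsLocalRing.mem_maximalIdeal]
  exact (Submodule.sub_mem_iff_left _ h2).symm.trans (by simp)

theorem P1.coordSec_mul (i : Fin 2) (p : P1 k) (hp : p ∈ P1.chart k (i + 1))
    (hp' : p ∈ P1.chart k (i + 1 + 1)) :
    (P1 k).presheaf.germ _ p hp (P1.coordSec k i) * (P1 k).presheaf.germ _ p hp'
      (P1.coordSec k (i + 1)) = 1 := by
  apply P1.stalkToLocalization_injective
  have h1 := P1.stalkToLocalization_coordSec i p hp
  have h2 := P1.stalkToLocalization_coordSec (i + 1) p hp'
  have h3 : i + 1 + 1 = i := by fin_cases i <;> decide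
  have hu := (P1.isUnit_algebraMap p).2 hp
  apply hu.mul_right_cancel
  rw [map_mul, map_one, one_mul, mul_right_comm, h1, mul_comm]
  rw [← h2]
  congr 2
  simp only [h3]

theorem P1.mem_iff_coeff (i : Fin 2) (p : P1 k) (hp : p ∈ P1.chart k (i + 1))
    (hX : MvPolynomial.X i ∈ p.asHomogeneousIdeal.toIdeal) {F : MvPolynomial (Fin 2) k} {d : ℕ}
      (hF : F.IsHomogeneous d) :
    F ∈ p.asHomogeneousIdeal.toIdeal ↔ (dehomogenize i F).coeff 0 = 0 := by
  rw [← not_iff_not, ← P1.isUnit_algebraMap, ← ne_eq, ← P1.isUnit_polyGerm_iff i p hp hX,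
    P1.algebraMap_eq_mul_polyGerm i p hp hF]
  have hu := ((P1.isUnit_algebraMap p).2 hp).pow d
  exact ⟨fun h => P1.isUnit_of_isUnit_stalkToLocalization p (isUnit_of_mul_isUnit_right h), fun h =>
    hu.mul (h.map _)⟩

theorem P1.mem_chart_or (j : Fin 2) (p : P1 k) : p ∈ P1.chart k j ∨ p ∈ P1.chart k (j + 1) := by
  have h : ⨆ l, P1.chart k l = ⊤ := by
    refine Proj.iSup_basicOpen_eq_top' (G k) _ (fun l => ⟨1, MvPolynomial.isHomogeneous_X k l⟩) ?_
    rw [eq_top_iff]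
    rintro F -
    induction F using MvPolynomial.induction_on with
    | C c => exact Subalgebra.algebraMap_mem _ (⟨MvPolynomial.C c, MvPolynomial.isHomogeneous_C _ _⟩
      : G k 0)
    | add F F' hF hF' => exact Subalgebra.add_mem _ hF hF'
    | mul_X F l hF => exact Subalgebra.mul_mem _ hF (Algebra.subset_adjoin ⟨l, rfl⟩)
  obtain ⟨l, hl⟩ := Opens.mem_iSup.1 (h ▸ Opens.mem_top p)
  rcases fin_two_eq_or j l with rfl | rfl
  · exact Or.inl hl
  · exact Or.inr hl

/-- A point outside the chart satisfies xⱼ = 0 and lies in the other chart, where a form belongs to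
its prime exactly if a certain constant term vanishes. This criterion no longer mentions the point,
so there is only one such point. -/
theorem P1.mem_chart_of_ne (j : Fin 2) (p : P1 k) (hp : p ≠ P1.coordPoint k j) :
    p ∈ P1.chart k j := by
  by_contra h
  have hX : MvPolynomial.X j ∈ p.asHomogeneousIdeal.toIdeal := by_contra fun h' => h h'
  have h1 := (P1.mem_chart_or j p).resolve_left h
  apply hp
  apply ProjectiveSpectrum.ext
  apply HomogeneousIdeal.ext'
  intro d F hF
  exact (P1.mem_iff_coeff j p h1 hX hF).trans (P1.mem_iff_coeff j (P1.coordPoint k j)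
    (P1.coordPoint_mem_chart j) (Ideal.mem_span_singleton_self _) hF).symm

end Line

section FunctionField

variable {k : Type u} [Field k]

/-! ### The function field of the projective line -/

theorem P1.genericPoint_mem {U : (P1 k).Opens} {p : P1 k} (hp : p ∈ U) :
    genericPoint (P1 k) ∈ U :=
  ((genericPoint_spec (P1 k)).mem_open_set_iff U.isOpen).mpr ⟨p, trivial, hp⟩

theorem toK_germ {U : (P1 k).Opens} {p : P1 k} (hp : p ∈ U) (f : Γ(P1 k, U)) :
    toK p ((P1 k).presheaf.germ U p hp f) =
      (P1 k).presheaf.germ U _ (P1.genericPoint_mem hp) f := by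
  have : Nonempty U := ⟨⟨p, hp⟩⟩
  exact Scheme.algebraMap_germ_eq_germToFunctionField _ hp f

theorem toK_injective (p : P1 k) : Function.Injective (toK p) :=
  IsFractionRing.injective ((P1 k).presheaf.stalk p) (P1 k).functionField

theorem toK_constStalk (p : P1 k) (c : k) :
    toK p (constStalk (P1.str k) p c) = algebraMap k (P1 k).functionField c :=
  toK_germ _ _

/-- The local ring of `p` as a subring of the function field. -/
def localRing (p : P1 k) : Subring (P1 k).functionField := (toK p).range

theorem germ_mem_localRing {U : (P1 k).Opens} {p : P1 k} (hp : p ∈ U) (f : Γ(P1 k, U)) :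
    (P1 k).presheaf.germ U _ (P1.genericPoint_mem hp) f ∈ localRing p := ⟨_, toK_germ hp f⟩

theorem exists_germ_of_mem_localRing {p : P1 k} {f : (P1 k).functionField}
    (hf : f ∈ localRing p) : ∃ (U : (P1 k).Opens) (hp : p ∈ U) (s : Γ(P1 k, U)),
      (P1 k).presheaf.germ U _ (P1.genericPoint_mem hp) s = f := by
  obtain ⟨g, rfl⟩ := hf
  obtain ⟨U, hp, s, rfl⟩ := (P1 k).presheaf.exists_germ_eq g
  exact ⟨U, hp, s, (toK_germ hp s).symm⟩

/-- The rational function `f` is regular at `p` with value `c`. -/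
def HasVal (p : P1 k) (f : (P1 k).functionField) (c : k) : Prop :=
  ∃ g, toK p g = f ∧ HasValue (P1.str k) p g c

theorem HasVal.mem {p : P1 k} {f : (P1 k).functionField} {c : k} (h : HasVal p f c) :
    f ∈ localRing p := ⟨h.choose, h.choose_spec.1⟩

theorem hasVal_toK {p : P1 k} {f : (P1 k).presheaf.stalk p} {c : k} :
    HasVal p (toK p f) c ↔ HasValue (P1.str k) p f c :=
  ⟨fun ⟨_, hg, h⟩ => toK_injective p hg ▸ h, fun h => ⟨f, rfl, h⟩⟩

theorem HasVal.add {p : P1 k} {f g : (P1 k).functionField} {c d : k} (hf : HasVal p f c)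
    (hg : HasVal p g d) : HasVal p (f + g) (c + d) := by
  obtain ⟨f, rfl, hf⟩ := hf
  obtain ⟨g, rfl, hg⟩ := hg
  exact ⟨f + g, map_add _ _ _, hf.add _ hg⟩

theorem HasVal.mul {p : P1 k} {f g : (P1 k).functionField} {c d : k} (hf : HasVal p f c)
    (hg : HasVal p g d) : HasVal p (f * g) (c * d) := by
  obtain ⟨f, rfl, hf⟩ := hf
  obtain ⟨g, rfl, hg⟩ := hg
  exact ⟨f * g, map_mul _ _ _, hf.mul _ hg⟩

theorem hasVal_algebraMap (p : P1 k) (c : k) :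
    HasVal p (algebraMap k (P1 k).functionField c) c :=
  ⟨_, toK_constStalk p c, by simp [HasValue]⟩

theorem hasVal_zero (p : P1 k) : HasVal p (0 : (P1 k).functionField) 0 := by
  simpa using hasVal_algebraMap p 0

theorem hasVal_one (p : P1 k) : HasVal p (1 : (P1 k).functionField) 1 := by
  simpa using hasVal_algebraMap p 1

theorem HasVal.neg {p : P1 k} {f : (P1 k).functionField} {c : k} (hf : HasVal p f c) :
    HasVal p (-f) (-c) := by
  have := (hasVal_algebraMap p (-1)).mul hf
  simpa using this

theorem HasVal.pow {p : P1 k} {f : (P1 k).functionField} {c : k} (hf : HasVal p f c) (N : ℕ) :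
    HasVal p (f ^ N) (c ^ N) := by
  induction N with
  | zero => simpa using hasVal_one p
  | succ N ih => rw [pow_succ, pow_succ]; exact ih.mul hf

theorem HasVal.sum {ι : Type*} {p : P1 k} (s : Finset ι) {f : ι → (P1 k).functionField} {c : ι → k}
    (h : ∀ i ∈ s, HasVal p (f i) (c i)) : HasVal p (∑ i ∈ s, f i) (∑ i ∈ s, c i) := by
  classical
  induction s using Finset.induction_on with
  | empty => simpa using hasVal_zero p
  | insert a s ha ih =>
    rw [Finset.sum_insert ha, Finset.sum_insert ha]
    exact (h a (Finset.mem_insert_self _ _)).add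
      (ih fun i hi => h i (Finset.mem_insert_of_mem hi))

theorem HasVal.unique {p : P1 k} {f : (P1 k).functionField} {c d : k} (hc : HasVal p f c)
    (hd : HasVal p f d) : c = d := by
  obtain ⟨g, hg, hgc⟩ := hc
  obtain ⟨g', hg', hgd⟩ := hd
  obtain rfl : g = g' := toK_injective p (hg.trans hg'.symm)
  by_contra hne
  have h := Ideal.sub_mem _ hgd hgc
  rw [sub_sub_sub_cancel_left, ← map_sub] at h
  exact h (constStalk_isUnit _ _ (sub_ne_zero.2 hne))

/-- The inverse of a regular function with nonzero value is regular. -/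
theorem HasVal.inv_mem {p : P1 k} {f : (P1 k).functionField} {c : k} (h : HasVal p f c)
    (hc : c ≠ 0) : f⁻¹ ∈ localRing p := by
  obtain ⟨g, rfl, hg⟩ := h
  have hu : IsUnit g := by
    by_contra hn
    have h := Ideal.sub_mem _ ((IsLocalRing.mem_maximalIdeal g).2 hn) hg
    rw [sub_sub_cancel] at h
    exact h (constStalk_isUnit _ _ hc)
  obtain ⟨v, rfl⟩ := hu
  refine ⟨(v⁻¹ : _ˣ), ?_⟩
  exact eq_inv_of_mul_eq_one_left (by rw [← map_mul, Units.inv_mul, map_one])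

theorem P1.genericPoint_mem_chart (j : Fin 2) : genericPoint (P1 k) ∈ P1.chart k (j + 1) :=
  P1.genericPoint_mem (P1.coordPoint_mem_chart j)

/-- The rational function `xᵢ / xᵢ₊₁`. -/
def coord (k : Type u) [Field k] (i : Fin 2) : (P1 k).functionField :=
  (P1 k).presheaf.germ _ _ (P1.genericPoint_mem_chart i) (P1.coordSec k i)

theorem coord_mem {i : Fin 2} {p : P1 k} (hp : p ∈ P1.chart k (i + 1)) :
    coord k i ∈ localRing p := germ_mem_localRing hp _

theorem coord_mul (i : Fin 2) : coord k i * coord k (i + 1) = 1 :=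
  P1.coordSec_mul i _ _ _

theorem coord_ne_zero (i : Fin 2) : coord k i ≠ 0 := left_ne_zero_of_mul_eq_one (coord_mul i)

theorem coord_add_one (i : Fin 2) : coord k (i + 1) = (coord k i)⁻¹ :=
  eq_inv_of_mul_eq_one_right (coord_mul i)

theorem toK_polyGerm (i : Fin 2) (p : P1 k) (hp : p ∈ P1.chart k (i + 1)) (a : Polynomial k) :
    toK p (P1.polyGerm i p hp a) = Polynomial.aeval (coord k i) a := by
  change ((toK p).comp (P1.polyGerm i p hp)) a = (Polynomial.aeval (coord k i)).toRingHom a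
  congr 1
  apply Polynomial.ringHom_ext
  · intro c
    simp [P1.polyGerm, toK_constStalk]
  · simp only [RingHom.comp_apply, P1.polyGerm, Polynomial.coe_eval₂RingHom, Polynomial.eval₂_X,
      toK_germ]
    exact (Polynomial.aeval_X (coord k i)).symm

theorem aeval_coord_mem {i : Fin 2} {p : P1 k} (hp : p ∈ P1.chart k (i + 1)) (a : Polynomial k) :
    Polynomial.aeval (coord k i) a ∈ localRing p := ⟨_, toK_polyGerm i p hp a⟩

theorem exists_aeval_of_mem_localRing {i : Fin 2} {p : P1 k} (hp : p ∈ P1.chart k (i + 1))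
    {f : (P1 k).functionField} (hf : f ∈ localRing p) : ∃ a b : Polynomial k,
      Polynomial.aeval (coord k i) b ≠ 0 ∧ (Polynomial.aeval (coord k i) b)⁻¹ ∈ localRing p ∧
      f * Polynomial.aeval (coord k i) b = Polynomial.aeval (coord k i) a := by
  obtain ⟨g, rfl⟩ := hf
  obtain ⟨a, b, ⟨v, hv⟩, e⟩ := P1.exists_polyGerm i p hp g
  have h1 : toK p v * toK p (v⁻¹ : _ˣ) = 1 := by rw [← map_mul, Units.mul_inv, map_one]
  rw [hv, toK_polyGerm] at h1
  refine ⟨a, b, left_ne_zero_of_mul_eq_one h1, ⟨(v⁻¹ : _ˣ), eq_inv_of_mul_eq_one_right h1⟩, ?_⟩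
  rw [← toK_polyGerm i p hp, ← toK_polyGerm i p hp, ← e, map_mul]

theorem hasVal_aeval_coord (i : Fin 2) (a : Polynomial k) :
    HasVal (P1.coordPoint k i) (Polynomial.aeval (coord k i) a) (a.coeff 0) := by
  rw [← toK_polyGerm i _ (P1.coordPoint_mem_chart i), hasVal_toK]
  exact (Ideal.span_singleton_le_iff_mem _).2 (P1.coordSec_mem_maximalIdeal i)
    (P1.polyGerm_sub_mem_span i _ _ a)

theorem hasVal_coord (i : Fin 2) : HasVal (P1.coordPoint k i) (coord k i) 0 := by
  simpa using hasVal_aeval_coord i (Polynomial.X : Polynomial k)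

/-- The coordinate is transcendental: once a power of it is split off, the remaining factor has a
nonzero value at xᵢ = 0. -/
theorem aeval_coord_ne_zero (i : Fin 2) {a : Polynomial k} (ha : a ≠ 0) :
    Polynomial.aeval (coord k i) a ≠ 0 := by
  obtain ⟨b, hb, hX⟩ := Polynomial.exists_eq_pow_rootMultiplicity_mul_and_not_dvd a ha 0
  rw [Polynomial.C_0, sub_zero] at hb hX
  rw [hb, map_mul, map_pow, Polynomial.aeval_X]
  refine mul_ne_zero (pow_ne_zero _ (coord_ne_zero i)) fun h0 => hX ?_
  rw [Polynomial.X_dvd_iff]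
  exact (h0 ▸ hasVal_aeval_coord i b).unique (hasVal_zero _)

/-- Every regular function at the point `xᵢ = 0` has a value, and it is equal to its value up to a
multiple of the coordinate. -/
theorem exists_eq_add_coord_mul {i : Fin 2} {f : (P1 k).functionField}
    (hf : f ∈ localRing (P1.coordPoint k i)) : ∃ (c : k), ∃ h ∈ localRing (P1.coordPoint k i),
      f = algebraMap k _ c + coord k i * h := by
  have hp := P1.coordPoint_mem_chart (k := k) i
  obtain ⟨a, b, hb0, hb, e⟩ := exists_aeval_of_mem_localRing hp hf
  have hbv : b.coeff 0 ≠ 0 := by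
    intro h0
    have h1 := hasVal_aeval_coord i b
    obtain ⟨g, hg⟩ := hb
    rw [h0, ← toK_polyGerm i _ hp, hasVal_toK] at h1
    simp only [HasValue, map_zero, sub_zero] at h1
    apply h1
    apply IsUnit.of_mul_eq_one g
    apply toK_injective
    rw [map_mul, hg, toK_polyGerm, mul_inv_cancel₀ hb0, map_one]
  -- The value of a / b at the point: with this c the polynomial a - c b has no constant term, and
  -- its quotient by X yields the remainder.
  set c := a.coeff 0 / b.coeff 0
  obtain ⟨q, hq⟩ : Polynomial.X ∣ a - Polynomial.C c * b := by
    rw [Polynomial.X_dvd_iff]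
    simp [c, hbv]
  refine ⟨c, Polynomial.aeval (coord k i) q * (Polynomial.aeval (coord k i) b)⁻¹,
    mul_mem (aeval_coord_mem hp q) hb, ?_⟩
  have h2 := congrArg (Polynomial.aeval (coord k i)) hq
  rw [map_sub, map_mul, map_mul, Polynomial.aeval_C, Polynomial.aeval_X, sub_eq_iff_eq_add, ← e]
    at h2
  apply mul_right_cancel₀ hb0
  rw [h2, add_mul, mul_assoc, mul_assoc, inv_mul_cancel₀ hb0, mul_one, add_comm]

theorem HasVal.exists_eq {i : Fin 2} {f : (P1 k).functionField} {c : k}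
    (h : HasVal (P1.coordPoint k i) f c) : ∃ h ∈ localRing (P1.coordPoint k i),
      f = algebraMap k _ c + coord k i * h := by
  obtain ⟨d, g, hg, rfl⟩ := exists_eq_add_coord_mul h.mem
  obtain ⟨g', rfl⟩ := hg
  obtain ⟨t, ht⟩ := coord_mem (P1.coordPoint_mem_chart (k := k) i)
  have h0 : HasVal (P1.coordPoint k i) (coord k i * toK _ g') 0 := by
    have h1 := hasVal_coord (k := k) i
    rw [← ht, hasVal_toK, HasValue, map_zero, sub_zero] at h1
    rw [← ht, ← map_mul, hasVal_toK, HasValue, map_zero, sub_zero]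
    exact Ideal.mul_mem_right _ _ h1
  have := ((hasVal_algebraMap _ d).add h0).unique h
  rw [add_zero] at this
  exact ⟨_, ⟨g', rfl⟩, by rw [this]⟩

theorem hasVal_coord_mul {i : Fin 2} {f : (P1 k).functionField}
    (hf : f ∈ localRing (P1.coordPoint k i)) : HasVal (P1.coordPoint k i) (coord k i * f) 0 := by
  obtain ⟨c, h, hh, e⟩ := exists_eq_add_coord_mul hf
  obtain ⟨g, rfl⟩ := hf
  obtain ⟨t, ht⟩ := coord_mem (P1.coordPoint_mem_chart (k := k) i)
  have h1 := hasVal_coord (k := k) i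
  rw [← ht, hasVal_toK, HasValue, map_zero, sub_zero] at h1
  rw [← ht, ← map_mul, hasVal_toK, HasValue, map_zero, sub_zero]
  exact Ideal.mul_mem_right _ _ h1

theorem exists_hasVal {i : Fin 2} {f : (P1 k).functionField}
    (hf : f ∈ localRing (P1.coordPoint k i)) : ∃ c, HasVal (P1.coordPoint k i) f c := by
  obtain ⟨c, h, hh, rfl⟩ := exists_eq_add_coord_mul hf
  exact ⟨c, by simpa using (hasVal_algebraMap _ c).add (hasVal_coord_mul hh)⟩

theorem hasVal_zero_iff {i : Fin 2} {f : (P1 k).functionField} :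
    HasVal (P1.coordPoint k i) f 0 ↔ f * (coord k i)⁻¹ ∈ localRing (P1.coordPoint k i) := by
  constructor
  · intro h
    obtain ⟨g, hg, rfl⟩ := h.exists_eq
    rwa [map_zero, zero_add, mul_comm, inv_mul_cancel_left₀ (coord_ne_zero i)]
  · intro h
    have := hasVal_coord_mul h
    rwa [mul_comm, inv_mul_cancel_right₀ (coord_ne_zero i)] at this

theorem exists_aeval_coord_eq (i : Fin 2) (f : (P1 k).functionField) : ∃ a b : Polynomial k,
    b ≠ 0 ∧ f * Polynomial.aeval (coord k i) b = Polynomial.aeval (coord k i) a := by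
  have hp := P1.coordPoint_mem_chart (k := k) i
  obtain ⟨g, h, hh, rfl⟩ := IsFractionRing.div_surjective
    (A := (P1 k).presheaf.stalk (P1.coordPoint k i)) f
  have hh0 : toK _ h ≠ 0 := by
    intro h0
    exact nonZeroDivisors.ne_zero hh (toK_injective _ (h0.trans (map_zero _).symm))
  obtain ⟨a, b, hb0, -, e⟩ := exists_aeval_of_mem_localRing hp (f := toK _ g) ⟨g, rfl⟩
  obtain ⟨a', b', hb0', -, e'⟩ := exists_aeval_of_mem_localRing hp (f := toK _ h) ⟨h, rfl⟩
  have ha' : Polynomial.aeval (coord k i) a' ≠ 0 := e' ▸ mul_ne_zero hh0 hb0'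
  refine ⟨a * b', b * a', ?_, ?_⟩
  · apply mul_ne_zero <;> rintro rfl
    · simp at hb0
    · simp at ha'
  · rw [map_mul, map_mul, ← e, ← e']
    change toK _ g / toK _ h * _ = _
    field_simp

/-- The order of the pole is at most the multiplicity of X in a denominator; the rest of the
denominator is a unit at the point. -/
theorem exists_coord_pow_mul_mem (i : Fin 2) (f : (P1 k).functionField) :
    ∃ N : ℕ, ∀ M, N ≤ M → coord k i ^ M * f ∈ localRing (P1.coordPoint k i) := by
  have hp := P1.coordPoint_mem_chart (k := k) i
  obtain ⟨a, b, hb, e⟩ := exists_aeval_coord_eq i f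
  obtain ⟨b', hb', hX⟩ := Polynomial.exists_eq_pow_rootMultiplicity_mul_and_not_dvd b hb 0
  rw [Polynomial.C_0, sub_zero] at hb' hX
  set N := b.rootMultiplicity 0
  rw [Polynomial.X_dvd_iff] at hX
  have h1 : (Polynomial.aeval (coord k i) b')⁻¹ ∈ localRing (P1.coordPoint k i) :=
    (hasVal_aeval_coord i b').inv_mem hX
  have h2 : Polynomial.aeval (coord k i) b' ≠ 0 :=
    aeval_coord_ne_zero i (by rintro rfl; simp at hX)
  have h3 : coord k i ^ N * f ∈ localRing (P1.coordPoint k i) := by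
    have : coord k i ^ N * f =
        Polynomial.aeval (coord k i) a * (Polynomial.aeval (coord k i) b')⁻¹ := by
      apply mul_right_cancel₀ h2
      rw [inv_mul_cancel_right₀ h2, ← e]
      conv_rhs => rw [hb', map_mul, map_pow, Polynomial.aeval_X]
      ring
    rw [this]
    exact mul_mem (aeval_coord_mem hp a) h1
  refine ⟨N, fun M hM => ?_⟩
  obtain ⟨l, rfl⟩ := Nat.exists_eq_add_of_le hM
  rw [pow_add, mul_right_comm]
  exact mul_mem h3 (pow_mem (coord_mem hp) l)

theorem maximalIdeal_coordPoint (i : Fin 2) :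
    IsLocalRing.maximalIdeal ((P1 k).presheaf.stalk (P1.coordPoint k i)) =
      Ideal.span {(P1 k).presheaf.germ _ _ (P1.coordPoint_mem_chart i) (P1.coordSec k i)} := by
  refine le_antisymm (fun g hg => ?_)
    ((Ideal.span_singleton_le_iff_mem _).2 (P1.coordSec_mem_maximalIdeal i))
  have h0 : HasVal (P1.coordPoint k i) (toK _ g) 0 := by
    rw [hasVal_toK, HasValue, map_zero, sub_zero]
    exact hg
  obtain ⟨_, ⟨h, rfl⟩, e⟩ := h0.exists_eq
  rw [Ideal.mem_span_singleton]
  refine ⟨h, toK_injective _ ?_⟩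
  rw [e, map_zero, zero_add, map_mul, toK_germ]
  rfl

/-! ### Rational differentials on the projective line -/

/-- The differential of a rational function. -/
abbrev dK (f : (P1 k).functionField) : RatDiff k := KaehlerDifferential.D k (P1 k).functionField f

theorem dK_mul (f g : (P1 k).functionField) : dK (f * g) = f • dK g + g • dK f :=
  Derivation.leibniz _ _ _

theorem dK_one : dK (1 : (P1 k).functionField) = 0 := Derivation.map_one_eq_zero _

theorem isFractionRing_polynomial (i : Fin 2) :
    @IsFractionRing (Polynomial k) _ (P1 k).functionField _
      (Polynomial.aeval (R := k) (coord k i)).toRingHom.toAlgebra := by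
  let := (Polynomial.aeval (R := k) (coord k i)).toRingHom.toAlgebra
  have : FaithfulSMul (Polynomial k) (P1 k).functionField := by
    rw [faithfulSMul_iff_algebraMap_injective, injective_iff_map_eq_zero]
    exact fun a h => by_contra fun ha => aeval_coord_ne_zero i ha h
  refine IsFractionRing.of_field _ _ fun f => ?_
  obtain ⟨a, b, hb, e⟩ := exists_aeval_coord_eq i f
  exact ⟨a, b, eq_div_of_mul_eq (aeval_coord_ne_zero i hb) e⟩

/-- The function field is the fraction field of k[X] with X sent to the coordinate, so its
differentials are a localization of those of k[X], which are free on dX. -/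
theorem dK_coord_ne_zero (i : Fin 2) : dK (coord k i) ≠ 0 := by
  let := (Polynomial.aeval (R := k) (coord k i)).toRingHom.toAlgebra
  have := isFractionRing_polynomial (k := k) i
  have : IsScalarTower k (Polynomial k) (P1 k).functionField :=
    IsScalarTower.of_algebraMap_eq fun c => (Polynomial.aeval_C _ c).symm
  intro h0
  have h1 : KaehlerDifferential.map k k (Polynomial k) (P1 k).functionField
      (KaehlerDifferential.D k _ Polynomial.X) = 0 := by
    rw [KaehlerDifferential.map_D, ← h0]
    exact congrArg dK (Polynomial.aeval_X (coord k i))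
  obtain ⟨c, hc⟩ := (IsLocalizedModule.eq_zero_iff (nonZeroDivisors (Polynomial k)) _).1 h1
  have h2 := congrArg (KaehlerDifferential.polynomialEquiv k) hc
  rw [Submonoid.smul_def, map_smul, KaehlerDifferential.polynomialEquiv_D, map_zero,
    Polynomial.derivative_X, smul_eq_mul, mul_one] at h2
  exact nonZeroDivisors.coe_ne_zero c h2

theorem dK_aeval (i : Fin 2) (a : Polynomial k) : dK (Polynomial.aeval (coord k i) a) =
    Polynomial.aeval (coord k i) (Polynomial.derivative a) • dK (coord k i) :=
  Derivation.map_aeval _ _ _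

theorem exists_dK_eq_of_mul_eq {i : Fin 2} {f : (P1 k).functionField} {a b : Polynomial k}
    (hb : Polynomial.aeval (coord k i) b ≠ 0)
    (e : f * Polynomial.aeval (coord k i) b = Polynomial.aeval (coord k i) a) :
    dK f = ((Polynomial.aeval (coord k i) b)⁻¹ * (Polynomial.aeval (coord k i) a.derivative -
      f * Polynomial.aeval (coord k i) b.derivative)) • dK (coord k i) := by
  have h := congrArg dK e
  rw [dK_mul, dK_aeval, dK_aeval, smul_smul] at h
  rw [mul_smul, eq_inv_smul_iff₀ hb, sub_smul, ← h]
  abel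

theorem exists_eq_smul_dK (i : Fin 2) (η : RatDiff k) : ∃ f : (P1 k).functionField, η = f • dK
    (coord k i) := by
  have : η ∈ Submodule.span (P1 k).functionField {dK (coord k i)} := by
    have h := KaehlerDifferential.span_range_derivation k (P1 k).functionField
    have h2 : η ∈ Submodule.span (P1 k).functionField
      (Set.range (KaehlerDifferential.D k (P1 k).functionField)) := h ▸ Submodule.mem_top
    refine Submodule.span_le.2 ?_ h2
    rintro _ ⟨f, rfl⟩
    obtain ⟨a, b, hb, e⟩ := exists_aeval_coord_eq i f
    change dK f ∈ _
    rw [exists_dK_eq_of_mul_eq (aeval_coord_ne_zero i hb) e]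
    exact Submodule.smul_mem _ _ (Submodule.mem_span_singleton_self _)
  obtain ⟨f, hf⟩ := Submodule.mem_span_singleton.1 this
  exact ⟨f, hf.symm⟩

/-- The quotient rule, with a denominator that is invertible in the local ring of p. -/
theorem exists_dK_eq_smul {i : Fin 2} {p : P1 k} (hp : p ∈ P1.chart k (i + 1))
    {f : (P1 k).functionField} (hf : f ∈ localRing p) :
    ∃ g ∈ localRing p, dK f = g • dK (coord k i) := by
  obtain ⟨a, b, hb0, hb, e⟩ := exists_aeval_of_mem_localRing hp hf
  refine ⟨_, ?_, exists_dK_eq_of_mul_eq hb0 e⟩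
  exact mul_mem hb (sub_mem (aeval_coord_mem hp _) (mul_mem hf (aeval_coord_mem hp _)))

/-- The logarithmic differential of the coordinate. -/
def dlog (k : Type u) [Field k] (i : Fin 2) : RatDiff k := (coord k i)⁻¹ • dK (coord k i)

theorem dlog_add_one (i : Fin 2) : dlog k (i + 1) = -dlog k i := by
  have h := congrArg dK (coord_mul (k := k) i)
  rw [dK_mul, dK_one, coord_add_one] at h
  rw [dlog, dlog, coord_add_one, inv_inv]
  exact eq_neg_of_add_eq_zero_left h

theorem smul_dlog_injective (i : Fin 2) {f g : (P1 k).functionField}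
    (h : f • dlog k i = g • dlog k i) : f = g :=
  smul_left_injective _ (smul_ne_zero (inv_ne_zero (coord_ne_zero i)) (dK_coord_ne_zero i)) h

theorem exists_eq_smul_dlog (i : Fin 2) (η : RatDiff k) : ∃ f : (P1 k).functionField, η = f • dlog k
    i := by
  obtain ⟨f, rfl⟩ := exists_eq_smul_dK i η
  refine ⟨f * coord k i, ?_⟩
  rw [dlog, smul_smul, mul_inv_cancel_right₀ (coord_ne_zero i)]

/-- Away from the two points the coordinate and its inverse are both regular, and the regular
differentials are the multiples of the differential of the coordinate, so dt/t is a local generator.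
-/
theorem isRegularAt_smul_dlog_iff (i : Fin 2) {p : P1 k} (h : p ≠ P1.coordPoint k i)
    (h' : p ≠ P1.coordPoint k (i + 1)) (f : (P1 k).functionField) :
    IsRegularAt p (f • dlog k i) ↔ f ∈ localRing p := by
  have hp' := P1.mem_chart_of_ne _ p h'
  have hinv : (coord k i)⁻¹ ∈ localRing p := by
    rw [← coord_add_one]
    apply coord_mem
    convert P1.mem_chart_of_ne _ p h using 2
    fin_cases i <;> decide
  constructor
  · intro hr
    suffices H : ∀ η : RatDiff k, IsRegularAt p η →
        ∃ g ∈ localRing p, η = g • dK (coord k i) by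
      obtain ⟨g, hg, e⟩ := H _ hr
      have : f = g * coord k i := by
        apply smul_dlog_injective i
        rw [e, dlog, smul_smul, mul_inv_cancel_right₀ (coord_ne_zero i)]
      rw [this]
      exact mul_mem hg (coord_mem hp')
    intro η hr
    unfold IsRegularAt at hr
    induction hr using AddSubgroup.closure_induction with
    | mem x hx =>
      obtain ⟨a, b, rfl⟩ := hx
      obtain ⟨g, hg, e⟩ := exists_dK_eq_smul hp' (f := toK p b) ⟨b, rfl⟩
      exact ⟨toK p a * g, mul_mem ⟨a, rfl⟩ hg, by rw [mul_smul, ← e]⟩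
    | zero => exact ⟨0, zero_mem _, by simp⟩
    | add x y _ _ hx hy =>
      obtain ⟨g, hg, e⟩ := hx
      obtain ⟨g', hg', e'⟩ := hy
      exact ⟨g + g', add_mem hg hg', by rw [e, e', add_smul]⟩
    | neg x _ hx =>
      obtain ⟨g, hg, e⟩ := hx
      exact ⟨-g, neg_mem hg, by rw [e, neg_smul]⟩
  · intro hf
    obtain ⟨g, hg⟩ := mul_mem hf hinv
    obtain ⟨t, ht⟩ := coord_mem hp'
    refine AddSubgroup.subset_closure ⟨g, t, ?_⟩
    rw [hg, ht, mul_smul]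
    rfl

/-- The coordinate is itself a uniformizer, which gives one direction. For the other, any
uniformizer is a unit times the coordinate, and its logarithmic differential differs from that of
the coordinate by a factor with value 1. -/
theorem hasLogResidue_smul_dlog_iff (i : Fin 2) (f : (P1 k).functionField) (c : k) :
    HasLogResidue (P1.coordPoint k i) (f • dlog k i) c ↔ HasVal (P1.coordPoint k i) f c := by
  have hp := P1.coordPoint_mem_chart (k := k) i
  have hco := coord_ne_zero (k := k) i
  constructor
  · intro h
    obtain ⟨g, hg, e⟩ := h _ (maximalIdeal_coordPoint i)
    refine ⟨g, ?_, hg⟩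
    rw [toK_germ] at e
    change coord k i • f • dlog k i = toK _ g • dK (coord k i) at e
    apply smul_dlog_injective i
    rw [← smul_right_injective _ hco |>.eq_iff]
    rw [e, dlog, smul_comm, smul_inv_smul₀ hco]
  · intro hf t ht
    have htm : t ∈ Ideal.span {(P1 k).presheaf.germ _ _ hp (P1.coordSec k i)} := by
      rw [← maximalIdeal_coordPoint, ht]
      exact Ideal.mem_span_singleton_self _
    have hctm : (P1 k).presheaf.germ _ _ hp (P1.coordSec k i) ∈ Ideal.span {t} := by
      rw [← ht]
      exact P1.coordSec_mem_maximalIdeal i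
    obtain ⟨v, hv⟩ := Ideal.mem_span_singleton.1 htm
    obtain ⟨v', hv'⟩ := Ideal.mem_span_singleton.1 hctm
    have hvK : toK _ t = coord k i * toK _ v := by
      rw [hv, map_mul, toK_germ]
      rfl
    have hvK' : coord k i = toK _ t * toK _ v' := by
      rw [← map_mul, ← hv', toK_germ]
      rfl
    have hvv : toK _ v * toK _ v' = 1 := by
      apply mul_left_cancel₀ hco
      rw [← mul_assoc, ← hvK, ← hvK', mul_one]
    obtain ⟨d, hd⟩ := exists_hasVal (i := i) (f := toK _ v) ⟨v, rfl⟩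
    obtain ⟨d', hd'⟩ := exists_hasVal (i := i) (f := toK _ v') ⟨v', rfl⟩
    have hdd : d * d' = 1 := (hvv ▸ hd.mul hd').unique (hasVal_one _)
    have hd0 : d ≠ 0 := left_ne_zero_of_mul_eq_one hdd
    obtain ⟨g, hg, e⟩ := exists_dK_eq_smul hp (f := toK _ v) ⟨v, rfl⟩
    -- `dt = (v + x g) dx`
    have e1 : dK (toK _ t) = (toK _ v + coord k i * g) • dK (coord k i) := by
      rw [hvK, dK_mul, e, add_smul, mul_smul, add_comm]
    set w := toK (P1.coordPoint k i) v + coord k i * g with hw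
    have hwv : HasVal (P1.coordPoint k i) w d := by
      simpa using hd.add (hasVal_coord_mul hg)
    have hwi := hwv.inv_mem hd0
    obtain ⟨d'', hd''⟩ := exists_hasVal hwi
    have hw0 : w ≠ 0 := by
      intro h0
      rw [h0] at hwv
      exact hd0 (hwv.unique (hasVal_zero _))
    have hdd'' : d * d'' = 1 := by
      have := hwv.mul hd''
      rw [mul_inv_cancel₀ hw0] at this
      exact this.unique (hasVal_one _)
    -- With respect to the uniformizer t the coefficient is f v / w, and v and w have the same value
    -- d.
    have hfin := (hf.mul hd).mul hd''
    rw [mul_assoc c d d'', hdd'', mul_one] at hfin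
    obtain ⟨q, hq, hqv⟩ := hfin
    refine ⟨q, hqv, ?_⟩
    change _ = _ • dK (toK _ t)
    rw [e1, hq, hvK, dlog]
    simp only [smul_smul]
    congr 1
    field_simp

end FunctionField

section Bundle

/-! ### Stalks and fibers of vector bundles -/

section Stalks

variable {X : Scheme.{u}} (V : X.Modules)

theorem exists_common_germ {ι : Type*} [Finite ι] {x : X} {U : X.Opens} (hx : x ∈ U)
    (f : ι → X.presheaf.stalk x) : ∃ (W : X.Opens) (_ : W ≤ U) (hW : x ∈ W) (g : ι → Γ(X, W)),
      ∀ i, X.presheaf.germ W x hW (g i) = f i := by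
  cases nonempty_fintype ι
  choose O hO g hg using fun i => X.presheaf.exists_germ_eq (f i)
  have hle : ∀ i, U ⊓ Finset.univ.inf O ≤ O i := fun i =>
    inf_le_right.trans (Finset.inf_le (Finset.mem_univ i))
  have hxW : x ∈ U ⊓ Finset.univ.inf O := by
    have : x ∈ ((Finset.univ.inf O : X.Opens) : Set X) := by
      rw [TopologicalSpace.Opens.coe_finset_inf]
      simpa using hO
    exact ⟨hx, this⟩
  refine ⟨U ⊓ Finset.univ.inf O, inf_le_left, hxW,
    fun i => X.presheaf.map (homOfLE (hle i)).op (g i), fun i => ?_⟩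
  exact (TopCat.Presheaf.germ_res_apply _ _ _ _ _).trans (hg i)

/-- Sections of `V` over `U` that form a basis over all smaller open sets. -/
structure IsFrame {n : ℕ} {U : X.Opens} (e : Fin n → Γ(V, U)) : Prop where
  basis : ∀ (W : X.Opens) (h : W ≤ U), ∃ b : Module.Basis (Fin n) Γ(X, W) Γ(V, W),
    ∀ i, b i = V.presheaf.map (homOfLE h).op (e i)

variable {V}

theorem germ_map (x : X) {U W : X.Opens} (h : W ≤ U) (hx : x ∈ W) (v : Γ(V, U)) :
    V.presheaf.germ W x hx (V.presheaf.map (homOfLE h).op v) = V.presheaf.germ U x (h hx) v :=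
  TopCat.Presheaf.germ_res_apply _ _ _ _ _

theorem germ_sum_smul {ι : Type*} (s : Finset ι) (x : X) {W : X.Opens} (hx : x ∈ W)
    (f : ι → Γ(X, W)) (v : ι → Γ(V, W)) :
    V.presheaf.germ W x hx (∑ i ∈ s, f i • v i) =
      ∑ i ∈ s, X.presheaf.germ W x hx (f i) • V.presheaf.germ W x hx (v i) := by
  rw [map_sum]
  exact Finset.sum_congr rfl fun i _ => germ_smul V x W hx _ _

/-- A relation between germs already holds between sections over a small neighborhood, where the
frame is still a basis. -/
theorem IsFrame.linearIndependent {n : ℕ} {U : X.Opens} {e : Fin n → Γ(V, U)} (he : IsFrame V e)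
    {x : X} (hx : x ∈ U) :
    LinearIndependent (X.presheaf.stalk x) fun i => V.presheaf.germ U x hx (e i) := by
  rw [Fintype.linearIndependent_iff]
  intro f hf
  obtain ⟨W, hWU, hW, g, hg⟩ := exists_common_germ hx f
  have h0 : V.presheaf.germ W x hW (∑ i, g i • V.presheaf.map (homOfLE hWU).op (e i)) =
      V.presheaf.germ W x hW 0 := by
    rw [germ_sum_smul, map_zero, ← hf]
    exact Finset.sum_congr rfl fun i _ => by rw [hg, germ_map]
  obtain ⟨W', hW', i₁, i₂, e0⟩ := V.presheaf.germ_eq x hW hW _ _ h0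
  obtain ⟨b, hb⟩ := he.basis W' (i₁.le.trans hWU)
  have h1 : ∑ i, X.presheaf.map i₁.op (g i) • b i = 0 := by
    rw [map_zero, map_sum] at e0
    rw [← e0]
    refine Finset.sum_congr rfl fun i _ => ?_
    rw [Scheme.Modules.map_smul, hb]
    congr 1
    change _ = (V.presheaf.map _ ≫ V.presheaf.map _) (e i)
    rw [← Functor.map_comp]
    rfl
  intro i
  have h2 := Fintype.linearIndependent_iff.1 b.linearIndependent _ h1 i
  rw [← hg, ← TopCat.Presheaf.germ_res_apply X.presheaf i₁ x hW', h2, map_zero]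

theorem IsFrame.span {n : ℕ} {U : X.Opens} {e : Fin n → Γ(V, U)} (he : IsFrame V e)
    {x : X} (hx : x ∈ U) :
    ⊤ ≤ Submodule.span (X.presheaf.stalk x) (Set.range fun i => V.presheaf.germ U x hx (e i)) := by
  rintro v -
  obtain ⟨W, hW, s, rfl⟩ := V.presheaf.exists_germ_eq v
  obtain ⟨b, hb⟩ := he.basis (U ⊓ W) inf_le_left
  have hxUW : x ∈ U ⊓ W := ⟨hx, hW⟩
  have h1 : V.presheaf.germ W x hW s = V.presheaf.germ (U ⊓ W) x hxUW
      (∑ i, b.repr (V.presheaf.map (homOfLE inf_le_right).op s) i • b i) := by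
    rw [b.sum_repr, germ_map]
  rw [h1, germ_sum_smul]
  refine Submodule.sum_mem _ fun i _ => Submodule.smul_mem _ _ (Submodule.subset_span ⟨i, ?_⟩)
  rw [hb, germ_map]

/-- The basis of the stalk given by a frame. -/
def IsFrame.stalkBasis {n : ℕ} {U : X.Opens} {e : Fin n → Γ(V, U)} (he : IsFrame V e)
    {x : X} (hx : x ∈ U) : Module.Basis (Fin n) (X.presheaf.stalk x) (V.presheaf.stalk x) :=
  Module.Basis.mk (he.linearIndependent hx) (he.span hx)

theorem IsFrame.stalkBasis_apply {n : ℕ} {U : X.Opens} {e : Fin n → Γ(V, U)} (he : IsFrame V e)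
    {x : X} (hx : x ∈ U) (i : Fin n) :
    he.stalkBasis hx i = V.presheaf.germ U x hx (e i) := Module.Basis.mk_apply _ _ _

end Stalks

/-! ### The generic fiber and its lattices of regular sections -/

variable {k : Type u} [Field k] {V : (P1 k).Modules}

variable (V) in
/-- The stalk of `V` at the generic point. -/
def GenFiber : Type u := V.presheaf.stalk (genericPoint (P1 k))

instance : AddCommGroup (GenFiber V) :=
  inferInstanceAs (AddCommGroup (V.presheaf.stalk (genericPoint (P1 k))))

instance : Module (P1 k).functionField (GenFiber V) := stalkModule V (genericPoint (P1 k))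

/-- The rational function defined by a function on an open set. -/
def gK {U : (P1 k).Opens} (h : genericPoint (P1 k) ∈ U) : Γ(P1 k, U) →+* (P1 k).functionField :=
  ((P1 k).presheaf.germ U _ h).hom

/-- The rational section defined by a section over an open set. -/
def gV {U : (P1 k).Opens} (h : genericPoint (P1 k) ∈ U) : Γ(V, U) →+ GenFiber V :=
  (V.presheaf.germ U _ h).hom

theorem gK_injective {U : (P1 k).Opens} (h : genericPoint (P1 k) ∈ U) :
    Function.Injective (gK h) := germ_injective_of_isIntegral _ _ _

theorem gK_res {U W : (P1 k).Opens} (hWU : W ≤ U) (h : genericPoint (P1 k) ∈ W)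
    (f : Γ(P1 k, U)) : gK h ((P1 k).presheaf.map (homOfLE hWU).op f) = gK (hWU h) f :=
  TopCat.Presheaf.germ_res_apply _ _ _ _ _

theorem gV_res {U W : (P1 k).Opens} (hWU : W ≤ U) (h : genericPoint (P1 k) ∈ W)
    (v : Γ(V, U)) : gV h (V.presheaf.map (homOfLE hWU).op v) = gV (hWU h) v :=
  germ_map _ _ _ _

theorem gV_smul {U : (P1 k).Opens} (h : genericPoint (P1 k) ∈ U) (f : Γ(P1 k, U)) (v : Γ(V, U)) :
    gV h (f • v) = gK h f • gV h v := germ_smul V _ U h f v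

theorem gK_mem {U : (P1 k).Opens} {p : P1 k} (hp : p ∈ U) (f : Γ(P1 k, U)) :
    gK (P1.genericPoint_mem hp) f ∈ localRing p := germ_mem_localRing hp f

theorem exists_gV (v : GenFiber V) : ∃ (W : (P1 k).Opens) (h : genericPoint (P1 k) ∈ W)
    (s : Γ(V, W)), gV h s = v := V.presheaf.exists_germ_eq v

theorem exists_gK (f : (P1 k).functionField) : ∃ (W : (P1 k).Opens)
    (h : genericPoint (P1 k) ∈ W) (s : Γ(P1 k, W)), gK h s = f := (P1 k).presheaf.exists_germ_eq f

theorem exists_res_eq_of_gV_eq {U U' : (P1 k).Opens} {h : genericPoint (P1 k) ∈ U}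
    {h' : genericPoint (P1 k) ∈ U'} {v : Γ(V, U)} {v' : Γ(V, U')} (e : gV h v = gV h' v') :
    ∃ (W : (P1 k).Opens) (_ : genericPoint (P1 k) ∈ W) (i : W ≤ U) (i' : W ≤ U'),
      V.presheaf.map (homOfLE i).op v = V.presheaf.map (homOfLE i').op v' := by
  obtain ⟨W, hW, i, i', e⟩ := V.presheaf.germ_eq _ h h' v v' e
  exact ⟨W, hW, i.le, i'.le, e⟩

/-- The basis of the generic stalk given by a frame. -/
def IsFrame.genBasis {n : ℕ} {U : (P1 k).Opens} {e : Fin n → Γ(V, U)} (he : IsFrame V e)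
    (h : genericPoint (P1 k) ∈ U) : Module.Basis (Fin n) (P1 k).functionField (GenFiber V) :=
  he.stalkBasis h

theorem IsFrame.genBasis_apply {n : ℕ} {U : (P1 k).Opens} {e : Fin n → Γ(V, U)} (he : IsFrame V e)
    (h : genericPoint (P1 k) ∈ U) (i : Fin n) : he.genBasis h i = gV h (e i) :=
  he.stalkBasis_apply h i

theorem IsVectorBundle.exists_isFrame {n : ℕ} (hV : IsVectorBundle V n) (p : P1 k) :
    ∃ (U : (P1 k).Opens) (_ : p ∈ U) (e : Fin n → Γ(V, U)), IsFrame V e := by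
  obtain ⟨U, hp, e, he⟩ := hV p
  exact ⟨U, hp, e, ⟨he⟩⟩

theorem map_map_apply {U W W' : (P1 k).Opens} (h : W ≤ U) (h' : W' ≤ W) (v : Γ(V, U)) :
    V.presheaf.map (homOfLE h').op (V.presheaf.map (homOfLE h).op v) =
      V.presheaf.map (homOfLE (h'.trans h)).op v := by
  change (V.presheaf.map _ ≫ V.presheaf.map _) v = _
  rw [← Functor.map_comp]
  rfl

theorem gV_injective_of_isFrame {n : ℕ} {U : (P1 k).Opens} {e : Fin n → Γ(V, U)}
    (he : IsFrame V e) {W : (P1 k).Opens} (hWU : W ≤ U) (h : genericPoint (P1 k) ∈ W) :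
    Function.Injective (gV (V := V) h) := by
  rw [injective_iff_map_eq_zero]
  intro v hv
  obtain ⟨b, hb⟩ := he.basis W hWU
  have h1 : ∑ i, gK h (b.repr v i) • he.genBasis (hWU h) i = 0 := by
    rw [← hv]
    conv_rhs => rw [← b.sum_repr v, map_sum]
    refine Finset.sum_congr rfl fun i _ => ?_
    rw [gV_smul, he.genBasis_apply, hb, gV_res]
  have h2 := Fintype.linearIndependent_iff.1 (he.genBasis (hWU h)).linearIndependent _ h1
  have h3 : ∀ i, b.repr v i = 0 := fun i => gK_injective h ((h2 i).trans (map_zero _).symm)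
  rw [← b.sum_repr v]
  simp [h3]

/-- Locally a section is a vector of functions on an integral scheme, so it is determined by its
generic germ. This allows sections to be replaced by elements of the generic fiber throughout. -/
theorem gV_injective {n : ℕ} (hV : IsVectorBundle V n) {U : (P1 k).Opens}
    (h : genericPoint (P1 k) ∈ U) : Function.Injective (gV (V := V) h) := by
  rw [injective_iff_map_eq_zero]
  intro v hv
  choose O hO e he using fun p : U => hV.exists_isFrame p.1
  refine TopCat.Sheaf.eq_of_locally_eq' (⟨V.presheaf, V.isSheaf⟩ : TopCat.Sheaf Ab (P1 k))
    (fun p : U => O p ⊓ U) U (fun p => homOfLE inf_le_right) ?_ v 0 fun p => ?_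
  · intro p hp
    exact Opens.mem_iSup.2 ⟨⟨p, hp⟩, hO ⟨p, hp⟩, hp⟩
  · have hη : genericPoint (P1 k) ∈ O p ⊓ U := ⟨P1.genericPoint_mem (hO p), h⟩
    apply gV_injective_of_isFrame (he p) inf_le_left hη
    change gV hη (V.presheaf.map (homOfLE inf_le_right).op v) =
      gV hη (V.presheaf.map (homOfLE inf_le_right).op 0)
    rw [gV_res, gV_res, hv, map_zero]

variable (V) in
/-- The rational sections that are regular at `p`. -/
def lattice (p : P1 k) : AddSubgroup (GenFiber V) where
  carrier := {v | ∃ (W : (P1 k).Opens) (hp : p ∈ W) (s : Γ(V, W)),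
    gV (P1.genericPoint_mem hp) s = v}
  zero_mem' := ⟨⊤, trivial, 0, map_zero _⟩
  add_mem' := by
    rintro _ _ ⟨W, hp, s, rfl⟩ ⟨W', hp', s', rfl⟩
    refine ⟨W ⊓ W', ⟨hp, hp'⟩, V.presheaf.map (homOfLE inf_le_left).op s +
      V.presheaf.map (homOfLE inf_le_right).op s', ?_⟩
    rw [map_add, gV_res, gV_res]
  neg_mem' := by
    rintro _ ⟨W, hp, s, rfl⟩
    exact ⟨W, hp, -s, map_neg _ _⟩

theorem gV_mem_lattice {p : P1 k} {W : (P1 k).Opens} (hp : p ∈ W) (h : genericPoint (P1 k) ∈ W)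
    (s : Γ(V, W)) : gV h s ∈ lattice V p := ⟨W, hp, s, rfl⟩

theorem smul_mem_lattice {p : P1 k} {f : (P1 k).functionField} (hf : f ∈ localRing p)
    {v : GenFiber V} (hv : v ∈ lattice V p) : f • v ∈ lattice V p := by
  obtain ⟨W, hp, s, rfl⟩ := hv
  obtain ⟨U, hp', g, rfl⟩ := exists_germ_of_mem_localRing hf
  have hpUW : p ∈ U ⊓ W := ⟨hp', hp⟩
  refine ⟨U ⊓ W, hpUW, (P1 k).presheaf.map (homOfLE (inf_le_left : U ⊓ W ≤ U)).op g •
    V.presheaf.map (homOfLE (inf_le_right : U ⊓ W ≤ W)).op s, ?_⟩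
  rw [gV_smul, gV_res, gK_res]
  rfl

theorem IsFrame.mem_lattice_iff {n : ℕ} {U : (P1 k).Opens} {e : Fin n → Γ(V, U)}
    (he : IsFrame V e) {p : P1 k} (hp : p ∈ U) (v : GenFiber V) :
    v ∈ lattice V p ↔ ∀ i, (he.genBasis (P1.genericPoint_mem hp)).repr v i ∈ localRing p := by
  set B := he.genBasis (P1.genericPoint_mem hp) with hB
  constructor
  · rintro ⟨W, hpW, s, rfl⟩ i
    obtain ⟨b, hb⟩ := he.basis (U ⊓ W) inf_le_left
    have hpUW : p ∈ U ⊓ W := ⟨hp, hpW⟩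
    have h1 : gV (P1.genericPoint_mem hpW) s = ∑ j, gK (P1.genericPoint_mem hpUW)
        (b.repr (V.presheaf.map (homOfLE inf_le_right).op s) j) • B j := by
      rw [← gV_res inf_le_right (P1.genericPoint_mem hpUW)]
      conv_lhs => rw [← b.sum_repr (V.presheaf.map (homOfLE inf_le_right).op s), map_sum]
      refine Finset.sum_congr rfl fun j _ => ?_
      rw [gV_smul, hB, he.genBasis_apply, hb, gV_res]
    rw [h1, B.repr_sum_self]
    exact gK_mem hpUW _
  · intro h
    rw [← B.sum_repr v]
    refine AddSubgroup.sum_mem _ fun i _ => smul_mem_lattice (h i) ?_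
    rw [hB, he.genBasis_apply]
    exact gV_mem_lattice hp _ _

/-- A rational section that is regular at all points of `U` comes from a section over `U`. -/
theorem exists_gV_eq {n : ℕ} (hV : IsVectorBundle V n) {U : (P1 k).Opens}
    (h : genericPoint (P1 k) ∈ U) {v : GenFiber V} (hv : ∀ p ∈ U, v ∈ lattice V p) :
    ∃ s : Γ(V, U), gV h s = v := by
  choose W hW s hs using fun p : U => hv p.1 p.2
  have hη : ∀ p : U, genericPoint (P1 k) ∈ W p ⊓ U := fun p =>
    ⟨P1.genericPoint_mem (hW p), h⟩
  obtain ⟨t, ht, -⟩ := TopCat.Sheaf.existsUnique_gluing'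
    (⟨V.presheaf, V.isSheaf⟩ : TopCat.Sheaf Ab (P1 k)) (fun p : U => W p ⊓ U) U
    (fun p => homOfLE inf_le_right)
    (fun p hp => Opens.mem_iSup.2 ⟨⟨p, hp⟩, hW ⟨p, hp⟩, hp⟩)
    (fun p => V.presheaf.map (homOfLE inf_le_left).op (s p)) (by
      intro p q
      have hpq : genericPoint (P1 k) ∈ (W p ⊓ U) ⊓ (W q ⊓ U) := ⟨hη p, hη q⟩
      apply gV_injective hV hpq
      refine ((gV_res inf_le_left hpq _).trans ?_).trans (gV_res inf_le_right hpq _).symm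
      rw [gV_res, gV_res, hs, hs])
  refine ⟨t, ?_⟩
  let p : U := ⟨_, h⟩
  rw [← hs p, ← gV_res inf_le_left (hη p), ← ht p]
  exact (gV_res inf_le_right (hη p) t).symm

/-- A rational function that is regular at all points of `U` comes from a function on `U`. -/
theorem exists_gK_eq {U : (P1 k).Opens} (h : genericPoint (P1 k) ∈ U) {f : (P1 k).functionField}
    (hf : ∀ p ∈ U, f ∈ localRing p) : ∃ s : Γ(P1 k, U), gK h s = f := by
  choose W hW s hs using fun p : U => exists_germ_of_mem_localRing (hf p.1 p.2)
  have hη : ∀ p : U, genericPoint (P1 k) ∈ W p ⊓ U := fun p =>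
    ⟨P1.genericPoint_mem (hW p), h⟩
  obtain ⟨t, ht, -⟩ := TopCat.Sheaf.existsUnique_gluing'
    (P1 k).sheaf (fun p : U => W p ⊓ U) U
    (fun p => homOfLE inf_le_right)
    (fun p hp => Opens.mem_iSup.2 ⟨⟨p, hp⟩, hW ⟨p, hp⟩, hp⟩)
    (fun p => (P1 k).presheaf.map (homOfLE inf_le_left).op (s p)) (by
      intro p q
      have hpq : genericPoint (P1 k) ∈ (W p ⊓ U) ⊓ (W q ⊓ U) := ⟨hη p, hη q⟩
      apply gK_injective hpq
      refine ((gK_res inf_le_left hpq _).trans ?_).trans (gK_res inf_le_right hpq _).symm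
      rw [gK_res, gK_res]
      exact (hs p).trans (hs q).symm)
  refine ⟨t, ?_⟩
  let p : U := ⟨_, h⟩
  rw [← hs p]
  refine Eq.trans ?_ (gK_res inf_le_left (hη p) (s p))
  rw [← ht p]
  exact (gK_res inf_le_right (hη p) t).symm

end Bundle

section GenericEnd

variable {k : Type u} [Field k] {V : (P1 k).Modules}

/-! ### Endomorphisms of the generic stalk -/

theorem end_res {U : (P1 k).Opens} (a : endSections V U) {W W' : (P1 k).Opens} (hW : W ≤ U)
    (h : W' ≤ W) (v : Γ(V, W)) :
    V.presheaf.map (homOfLE h).op (a.1 ⟨W, hW⟩ v) =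
      a.1 ⟨W', h.trans hW⟩ (V.presheaf.map (homOfLE h).op v) :=
  a.2 ⟨W, hW⟩ ⟨W', h.trans hW⟩ h v

theorem gV_end_congr {U : (P1 k).Opens} (a : endSections V U) {W W' : (P1 k).Opens} (hW : W ≤ U)
    (hW' : W' ≤ U) {h : genericPoint (P1 k) ∈ W} {h' : genericPoint (P1 k) ∈ W'}
    {v : Γ(V, W)} {v' : Γ(V, W')} (e : gV h v = gV h' v') :
    gV h (a.1 ⟨W, hW⟩ v) = gV h' (a.1 ⟨W', hW'⟩ v') := by
  obtain ⟨O, hO, i, i', e⟩ := exists_res_eq_of_gV_eq e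
  rw [← gV_res i hO, ← gV_res i' hO, end_res, end_res, e]

theorem exists_gV_le {U : (P1 k).Opens} (h : genericPoint (P1 k) ∈ U) (v : GenFiber V) :
    ∃ (W : (P1 k).Opens) (_ : W ≤ U) (h : genericPoint (P1 k) ∈ W) (s : Γ(V, W)), gV h s = v := by
  obtain ⟨W, hW, s, rfl⟩ := exists_gV v
  have hUW : genericPoint (P1 k) ∈ U ⊓ W := ⟨h, hW⟩
  exact ⟨U ⊓ W, inf_le_left, hUW, V.presheaf.map (homOfLE inf_le_right).op s, gV_res _ _ _⟩

/-- Every rational section is represented over some open set inside U, where `a` can be applied. Two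
representatives agree on a smaller open set, so the result is independent of the choice, and
linearity can be tested on a common domain. -/
theorem exists_genEnd {U : (P1 k).Opens} (h : genericPoint (P1 k) ∈ U) (a : endSections V U) :
    ∃ M : Module.End (P1 k).functionField (GenFiber V), ∀ (W : (P1 k).Opens) (hW : W ≤ U)
      (hη : genericPoint (P1 k) ∈ W) (s : Γ(V, W)), M (gV hη s) = gV hη (a.1 ⟨W, hW⟩ s) := by
  choose W hW hη s hs using exists_gV_le (V := V) h
  have key : ∀ (O : (P1 k).Opens) (hO : O ≤ U) (hη' : genericPoint (P1 k) ∈ O) (t : Γ(V, O)),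
      gV (hη (gV hη' t)) (a.1 ⟨W _, hW _⟩ (s (gV hη' t))) = gV hη' (a.1 ⟨O, hO⟩ t) :=
    fun O hO hη' t => gV_end_congr a _ _ (hs _)
  refine ⟨{ toFun := fun v => gV (hη v) (a.1 ⟨W v, hW v⟩ (s v)), map_add' := ?_, map_smul' := ?_ },
    key⟩
  · intro v v'
    obtain ⟨O, hO, h1, t, rfl⟩ := exists_gV_le h v
    obtain ⟨O', hO', h1', t', rfl⟩ := exists_gV_le h v'
    have h2 : genericPoint (P1 k) ∈ O ⊓ O' := ⟨h1, h1'⟩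
    rw [← gV_res inf_le_left h2 t, ← gV_res inf_le_right h2 t', ← map_add,
      key _ (inf_le_left.trans hO), key _ (inf_le_left.trans hO), key _ (inf_le_left.trans hO),
      map_add, map_add]
  · intro f v
    obtain ⟨O, hO, h1, t, rfl⟩ := exists_gV_le h v
    obtain ⟨O', h1', g, rfl⟩ := exists_gK f
    have h2 : genericPoint (P1 k) ∈ O ⊓ O' := ⟨h1, h1'⟩
    rw [← gV_res inf_le_left h2 t, ← gK_res inf_le_right h2 g, ← gV_smul,
      key _ (inf_le_left.trans hO), key _ (inf_le_left.trans hO), map_smul, gV_smul,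
      RingHom.id_apply]

/-- The endomorphism of the generic stalk induced by an endomorphism over an open set. -/
def genEnd {U : (P1 k).Opens} (h : genericPoint (P1 k) ∈ U) :
    endSections V U →+* Module.End (P1 k).functionField (GenFiber V) where
  toFun a := (exists_genEnd h a).choose
  map_zero' := by
    ext v
    obtain ⟨W, hW, hη, s, rfl⟩ := exists_gV_le h v
    rw [(exists_genEnd h _).choose_spec W hW hη s]
    exact map_zero _
  map_one' := by
    ext v
    obtain ⟨W, hW, hη, s, rfl⟩ := exists_gV_le h v
    rw [(exists_genEnd h _).choose_spec W hW hη s]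
    rfl
  map_add' a b := by
    ext v
    obtain ⟨W, hW, hη, s, rfl⟩ := exists_gV_le h v
    rw [LinearMap.add_apply, (exists_genEnd h _).choose_spec W hW hη s,
      (exists_genEnd h _).choose_spec W hW hη s, (exists_genEnd h _).choose_spec W hW hη s,
      ← map_add]
    rfl
  map_mul' a b := by
    ext v
    obtain ⟨W, hW, hη, s, rfl⟩ := exists_gV_le h v
    rw [Module.End.mul_apply, (exists_genEnd h _).choose_spec W hW hη s,
      (exists_genEnd h _).choose_spec W hW hη s, (exists_genEnd h _).choose_spec W hW hη _]
    rfl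

theorem genEnd_gV {U : (P1 k).Opens} (h : genericPoint (P1 k) ∈ U) (a : endSections V U)
    {W : (P1 k).Opens} (hW : W ≤ U) (hη : genericPoint (P1 k) ∈ W) (s : Γ(V, W)) :
    genEnd h a (gV hη s) = gV hη (a.1 ⟨W, hW⟩ s) :=
  (exists_genEnd h a).choose_spec W hW hη s

theorem genEnd_endRes {U U' : (P1 k).Opens} (hU : U' ≤ U) (h : genericPoint (P1 k) ∈ U')
    (a : endSections V U) : genEnd h (endRes V hU a) = genEnd (hU h) a := by
  ext v
  obtain ⟨W, hW, hη, s, rfl⟩ := exists_gV_le h v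
  rw [genEnd_gV h _ hW, genEnd_gV _ _ (hW.trans hU)]
  rfl

theorem genEnd_endScalar {U : (P1 k).Opens} (h : genericPoint (P1 k) ∈ U) (f : Γ(P1 k, U)) :
    genEnd h (endScalar V U f) = algebraMap _ _ (gK h f) := by
  ext v
  obtain ⟨W, hW, hη, s, rfl⟩ := exists_gV_le h v
  rw [genEnd_gV h _ hW, Module.algebraMap_end_apply, ← gK_res hW hη, ← gV_smul]
  rfl

theorem subsingleton_of_genericPoint_notMem {W : (P1 k).Opens} (h : genericPoint (P1 k) ∉ W) :
    Subsingleton Γ(V, W) := by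
  have hW : W = ⊥ := by
    ext p
    exact ⟨fun hp => (h (P1.genericPoint_mem hp)).elim, fun hp => hp.elim⟩
  have : Subsingleton Γ(P1 k, W) := by
    subst hW
    exact CommRingCat.subsingleton_of_isTerminal (P1 k).sheaf.isTerminalOfEmpty
  exact Module.subsingleton Γ(P1 k, W) Γ(V, W)

/-- The endomorphism `M` of the generic stalk is regular at `p`. -/
def IsRegularEnd (p : P1 k) (M : Module.End (P1 k).functionField (GenFiber V)) : Prop :=
  ∀ v ∈ lattice V p, M v ∈ lattice V p

theorem isRegularEnd_genEnd {U : (P1 k).Opens} (h : genericPoint (P1 k) ∈ U)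
    (a : endSections V U) {p : P1 k} (hp : p ∈ U) : IsRegularEnd p (genEnd h a) := by
  rintro _ ⟨W, hpW, s, rfl⟩
  have hpUW : p ∈ U ⊓ W := ⟨hp, hpW⟩
  rw [← gV_res inf_le_right (P1.genericPoint_mem hpUW), genEnd_gV _ _ inf_le_left]
  exact gV_mem_lattice hpUW _ _

theorem genEnd_injective {n : ℕ} (hV : IsVectorBundle V n) {U : (P1 k).Opens}
    (h : genericPoint (P1 k) ∈ U) : Function.Injective (genEnd (V := V) h) := by
  intro a b hab
  apply Subtype.ext
  funext W
  ext v
  by_cases hη : genericPoint (P1 k) ∈ W.1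
  · apply gV_injective hV hη
    rw [← genEnd_gV h a W.2 hη, ← genEnd_gV h b W.2 hη, hab]
  · have := subsingleton_of_genericPoint_notMem (V := V) hη
    exact Subsingleton.elim _ _

-- Together with `genEnd_injective` this describes the endomorphisms of V over U as the K-linear
-- endomorphisms of the generic fiber that preserve the lattice of every point of U.
open Classical in
theorem exists_genEnd_eq {n : ℕ} (hV : IsVectorBundle V n) {U : (P1 k).Opens}
    (h : genericPoint (P1 k) ∈ U) {M : Module.End (P1 k).functionField (GenFiber V)}
    (hM : ∀ p ∈ U, IsRegularEnd p M) : ∃ a : endSections V U, genEnd h a = M := by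
  have key : ∀ (W : {W : (P1 k).Opens // W ≤ U}) (v : Γ(V, W.1)), ∃ s : Γ(V, W.1),
      ∀ hη : genericPoint (P1 k) ∈ W.1, gV hη s = M (gV hη v) := by
    intro W v
    by_cases hη : genericPoint (P1 k) ∈ W.1
    · obtain ⟨s, hs⟩ := exists_gV_eq hV hη (v := M (gV hη v)) fun p hp =>
        hM p (W.2 hp) _ (gV_mem_lattice hp _ _)
      exact ⟨s, fun _ => hs⟩
    · exact ⟨0, fun h => (hη h).elim⟩
  choose s hs using key
  have ext' : ∀ (W : {W : (P1 k).Opens // W ≤ U}) (v v' : Γ(V, W.1)),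
      (∀ hη : genericPoint (P1 k) ∈ W.1, gV hη v = gV hη v') → v = v' := by
    intro W v v' e
    by_cases hη : genericPoint (P1 k) ∈ W.1
    · exact gV_injective hV hη (e hη)
    · have := subsingleton_of_genericPoint_notMem (V := V) hη
      exact Subsingleton.elim _ _
  let a : endSections V U := ⟨fun W =>
    { toFun := s W
      map_add' := fun v v' => ext' W _ _ fun hη => by
        rw [map_add, hs, hs, hs, map_add, map_add]
      map_smul' := fun f v => ext' W _ _ fun hη => by
        rw [RingHom.id_apply, gV_smul, hs, hs, gV_smul, map_smul] },
    fun W W' hW v => ext' W' _ _ fun hη => by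
      rw [gV_res]
      change gV _ (s W v) = gV _ (s W' _)
      rw [hs, hs, gV_res]⟩
  refine ⟨a, ?_⟩
  ext v
  obtain ⟨W, hW, hη, t, rfl⟩ := exists_gV_le h v
  rw [genEnd_gV h a hW hη]
  exact hs ⟨W, hW⟩ t hη

/-- The rational section `v` is regular at `p` with value `w`. -/
def HasSecVal (p : P1 k) (v : GenFiber V) (w : Fiber V p) : Prop :=
  ∃ (W : (P1 k).Opens) (hp : p ∈ W) (s : Γ(V, W)),
    gV (P1.genericPoint_mem hp) s = v ∧ fiberValue V p hp s = w

theorem fiberValue_res {p : P1 k} {U W : (P1 k).Opens} (h : W ≤ U) (hp : p ∈ W) (s : Γ(V, U)) :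
    fiberValue V p hp (V.presheaf.map (homOfLE h).op s) = fiberValue V p (h hp) s := by
  rw [fiberValue, germ_map]
  rfl

/-- The endomorphism `M` of the generic stalk is regular at `p`, and induces the endomorphism `α` of
the fiber. -/
def HasEndVal (p : P1 k) (M : Module.End (P1 k).functionField (GenFiber V))
    (α : Module.End k (Fiber V p)) : Prop :=
  ∀ v w, HasSecVal p v w → HasSecVal p (M v) (α w)

/-- Shrinking the neighborhood of p changes neither generic germs nor values in the fiber, so the
condition on all open subsets of U becomes a single condition on the generic endomorphism. -/
theorem hasFiberValue_iff {n : ℕ} (hV : IsVectorBundle V n) {U : (P1 k).Opens}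
    (h : genericPoint (P1 k) ∈ U) (a : endSections V U) {p : P1 k} (hp : p ∈ U)
    (α : Module.End k (Fiber V p)) : HasFiberValue V p a α ↔ HasEndVal p (genEnd h a) α := by
  constructor
  · rintro H _ _ ⟨W, hpW, s, rfl, rfl⟩
    have hpUW : p ∈ U ⊓ W := ⟨hp, hpW⟩
    refine ⟨U ⊓ W, hpUW, a.1 ⟨U ⊓ W, inf_le_left⟩ (V.presheaf.map (homOfLE inf_le_right).op s),
      ?_, ?_⟩
    · rw [← genEnd_gV h, gV_res]
    · rw [H ⟨U ⊓ W, inf_le_left⟩ hpUW, fiberValue_res]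
  · intro H W hpW v
    obtain ⟨W', hpW', s, hs, hs'⟩ := H _ _ ⟨W.1, hpW, v, rfl, rfl⟩
    rw [← hs']
    have hpWW : p ∈ W.1 ⊓ W' := ⟨hpW, hpW'⟩
    rw [← fiberValue_res (inf_le_left : W.1 ⊓ W' ≤ W.1) hpWW,
      ← fiberValue_res (inf_le_right : W.1 ⊓ W' ≤ W') hpWW]
    congr 1
    apply gV_injective hV (P1.genericPoint_mem hpWW)
    rw [gV_res, gV_res, hs, genEnd_gV h _ W.2]

end GenericEnd

section FiberCoordinates

variable {k : Type u} [Field k] {V : (P1 k).Modules}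

/-! ### Coordinates on the fibers -/

theorem exists_hasValue {i : Fin 2} (f : (P1 k).presheaf.stalk (P1.coordPoint k i)) :
    ∃ c, HasValue (P1.str k) _ f c := by
  obtain ⟨c, hc⟩ := exists_hasVal (i := i) (f := toK _ f) ⟨f, rfl⟩
  exact ⟨c, hasVal_toK.1 hc⟩

theorem repr_mem_of_mem_smul_top {R M ι : Type*} [CommRing R] [AddCommGroup M] [Module R M]
    (b : Module.Basis ι R M) (J : Ideal R) {x : M} (hx : x ∈ J • (⊤ : Submodule R M)) (i : ι) :
    b.repr x i ∈ J := by
  induction hx using Submodule.smul_induction_on' with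
  | smul r hr m _ => simpa using J.mul_mem_right _ hr
  | add x _ y _ hx hy => simpa using J.add_mem hx hy

theorem fiberValue_sum_smul {ι : Type*} (s : Finset ι) {p : P1 k} {U : (P1 k).Opens} (hp : p ∈ U)
    (f : ι → Γ(P1 k, U)) (v : ι → Γ(V, U)) (c : ι → k)
    (h : ∀ i, HasValue (P1.str k) p ((P1 k).presheaf.germ U p hp (f i)) (c i)) :
    fiberValue V p hp (∑ i ∈ s, f i • v i) = ∑ i ∈ s, c i • fiberValue V p hp (v i) := by
  classical
  induction s using Finset.induction_on with
  | empty => simpa using fiberValue_zero V p hp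
  | insert a s ha ih =>
    rw [Finset.sum_insert ha, Finset.sum_insert ha, fiberValue_add, ih,
      fiberValue_smul V p hp _ _ (h a)]

section Frame

variable {n : ℕ} {U : (P1 k).Opens} {e : Fin n → Γ(V, U)} (he : IsFrame V e) {i : Fin 2}
  (hp : P1.coordPoint k i ∈ U)

include he in
theorem IsFrame.fiber_linearIndependent :
    LinearIndependent k fun j => fiberValue V (P1.coordPoint k i) hp (e j) := by
  rw [Fintype.linearIndependent_iff]
  intro c hc j
  have h1 : (Submodule.Quotient.mk (∑ j, constStalk (P1.str k) (P1.coordPoint k i) (c j) •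
    he.stalkBasis hp j) :
      Fiber V (P1.coordPoint k i)) = 0 := by
    refine Eq.trans ?_ hc
    refine (map_sum (Submodule.mkQ _) _ _).trans (Finset.sum_congr rfl fun l _ => ?_)
    rw [he.stalkBasis_apply]
    rfl
  have h2 := repr_mem_of_mem_smul_top (he.stalkBasis hp) _
    ((Submodule.Quotient.mk_eq_zero _).1 h1) j
  rw [Module.Basis.repr_sum_self] at h2
  by_contra hne
  exact (IsLocalRing.mem_maximalIdeal _).1 h2 ((isUnit_iff_ne_zero.2 hne).map _)

include he in
theorem IsFrame.fiber_span :
    ⊤ ≤ Submodule.span k (Set.range fun j => fiberValue V (P1.coordPoint k i) hp (e j)) := by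
  rintro w -
  obtain ⟨x, rfl⟩ := Submodule.Quotient.mk_surjective _ w
  choose c hc using fun j => exists_hasValue ((he.stalkBasis hp).repr x j)
  have h1 : (Submodule.Quotient.mk x : Fiber V (P1.coordPoint k i)) =
      ∑ j, c j • fiberValue V (P1.coordPoint k i) hp (e j) := by
    conv_lhs => rw [← (he.stalkBasis hp).sum_repr x]
    refine (map_sum (Submodule.mkQ _) _ _).trans (Finset.sum_congr rfl fun l _ => ?_)
    refine (Submodule.Quotient.eq _).2 ?_
    rw [he.stalkBasis_apply, ← sub_smul]
    exact Submodule.smul_mem_smul (hc l) trivial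
  rw [h1]
  exact Submodule.sum_mem _ fun j _ => Submodule.smul_mem _ _ (Submodule.subset_span ⟨j, rfl⟩)

/-- The basis of the fiber given by a frame. -/
def IsFrame.fiberBasis : Module.Basis (Fin n) k (Fiber V (P1.coordPoint k i)) :=
  Module.Basis.mk (he.fiber_linearIndependent hp) (he.fiber_span hp)

theorem IsFrame.fiberBasis_apply (j : Fin n) :
    he.fiberBasis hp j = fiberValue V (P1.coordPoint k i) hp (e j) := Module.Basis.mk_apply _ _ _

theorem IsFrame.hasVal_repr {v : GenFiber V} {w : Fiber V (P1.coordPoint k i)}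
    (h : HasSecVal _ v w) (j : Fin n) :
    HasVal (P1.coordPoint k i) ((he.genBasis (P1.genericPoint_mem hp)).repr v j)
      ((he.fiberBasis hp).repr w j) := by
  obtain ⟨W, hpW, s, rfl, rfl⟩ := h
  obtain ⟨b, hb⟩ := he.basis (U ⊓ W) inf_le_left
  have hpUW : P1.coordPoint k i ∈ U ⊓ W := ⟨hp, hpW⟩
  set s' := V.presheaf.map (homOfLE (inf_le_right : U ⊓ W ≤ W)).op s with hs'
  choose c hc using fun j => exists_hasValue
    ((P1 k).presheaf.germ (U ⊓ W) _ hpUW (b.repr s' j))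
  have h1 : gV (P1.genericPoint_mem hpW) s = ∑ j, gK (P1.genericPoint_mem hpUW) (b.repr s' j) •
      he.genBasis (P1.genericPoint_mem hp) j := by
    rw [← gV_res inf_le_right (P1.genericPoint_mem hpUW), ← hs']
    conv_lhs => rw [← b.sum_repr s', map_sum]
    refine Finset.sum_congr rfl fun j _ => ?_
    rw [gV_smul, he.genBasis_apply, hb, gV_res]
  have h2 : fiberValue V (P1.coordPoint k i) hpW s = ∑ j, c j • he.fiberBasis hp j := by
    rw [← fiberValue_res inf_le_right hpUW, ← hs']
    conv_lhs => rw [← b.sum_repr s']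
    rw [fiberValue_sum_smul _ hpUW _ _ c hc]
    refine Finset.sum_congr rfl fun j _ => ?_
    rw [he.fiberBasis_apply, hb, fiberValue_res]
  rw [h1, h2, Module.Basis.repr_sum_self, Module.Basis.repr_sum_self]
  exact ⟨_, toK_germ hpUW _, hc j⟩

theorem IsFrame.hasSecVal_iff {v : GenFiber V} {w : Fiber V (P1.coordPoint k i)} :
    HasSecVal _ v w ↔ ∀ j, HasVal (P1.coordPoint k i)
      ((he.genBasis (P1.genericPoint_mem hp)).repr v j) ((he.fiberBasis hp).repr w j) := by
  refine ⟨fun h j => he.hasVal_repr hp h j, fun h => ?_⟩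
  obtain ⟨W, hpW, s, hs⟩ := (he.mem_lattice_iff hp v).2 fun j => (h j).mem
  have h1 : HasSecVal _ v (fiberValue V _ hpW s) := ⟨W, hpW, s, hs, rfl⟩
  have h2 : fiberValue V _ hpW s = w := (he.fiberBasis hp).repr.injective <| by
    ext j
    exact (he.hasVal_repr hp h1 j).unique (h j)
  exact h2 ▸ h1

theorem IsFrame.hasSecVal_basis (j : Fin n) : HasSecVal (P1.coordPoint k i)
    (he.genBasis (P1.genericPoint_mem hp) j) (he.fiberBasis hp j) :=
  ⟨U, hp, e j, (he.genBasis_apply _ j).symm, (he.fiberBasis_apply hp j).symm⟩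

/-- In a frame, taking the value at a point is reducing the matrix entries modulo the maximal ideal.
Sums, multiples, traces and vanishing of values are handled entry by entry through this. -/
theorem IsFrame.hasEndVal_iff {M : Module.End (P1 k).functionField (GenFiber V)}
    {α : Module.End k (Fiber V (P1.coordPoint k i))} :
    HasEndVal _ M α ↔ ∀ j l, HasVal (P1.coordPoint k i)
      (LinearMap.toMatrix (he.genBasis (P1.genericPoint_mem hp))
        (he.genBasis (P1.genericPoint_mem hp)) M j l)
      (LinearMap.toMatrix (he.fiberBasis hp) (he.fiberBasis hp) α j l) := by
  constructor
  · intro h j l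
    rw [LinearMap.toMatrix_apply, LinearMap.toMatrix_apply]
    exact he.hasVal_repr hp (h _ _ (he.hasSecVal_basis hp l)) j
  · intro h v w hvw
    rw [he.hasSecVal_iff hp]
    intro j
    rw [← LinearMap.toMatrix_mulVec_repr (he.genBasis (P1.genericPoint_mem hp))
      (he.genBasis (P1.genericPoint_mem hp)) M v,
      ← LinearMap.toMatrix_mulVec_repr (he.fiberBasis hp) (he.fiberBasis hp) α w]
    simp only [Matrix.mulVec, dotProduct]
    exact HasVal.sum _ fun l _ => (h j l).mul (he.hasVal_repr hp hvw l)

end Frame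

theorem IsFrame.isRegularEnd_iff {n : ℕ} {U : (P1 k).Opens} {e : Fin n → Γ(V, U)}
    (he : IsFrame V e) {p : P1 k} (hp : p ∈ U)
    {M : Module.End (P1 k).functionField (GenFiber V)} :
    IsRegularEnd p M ↔ ∀ j l, LinearMap.toMatrix (he.genBasis (P1.genericPoint_mem hp))
      (he.genBasis (P1.genericPoint_mem hp)) M j l ∈ localRing p := by
  constructor
  · intro h j l
    rw [LinearMap.toMatrix_apply]
    refine (he.mem_lattice_iff hp _).1 (h _ ?_) j
    rw [he.genBasis_apply]
    exact gV_mem_lattice hp _ _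
  · intro h v hv
    rw [he.mem_lattice_iff hp] at hv ⊢
    intro j
    rw [← LinearMap.toMatrix_mulVec_repr (he.genBasis (P1.genericPoint_mem hp))
      (he.genBasis (P1.genericPoint_mem hp)) M v]
    simp only [Matrix.mulVec, dotProduct]
    exact sum_mem fun l _ => mul_mem (h j l) (hv l)

/-! ### Regular endomorphisms and their values -/

section Values

variable {M N : Module.End (P1 k).functionField (GenFiber V)} {p : P1 k}

theorem IsRegularEnd.smul {f : (P1 k).functionField} (hf : f ∈ localRing p)
    (hM : IsRegularEnd p M) : IsRegularEnd p (f • M) :=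
  fun v hv => smul_mem_lattice hf (hM v hv)

variable {n : ℕ} (hV : IsVectorBundle V n)

include hV

theorem IsRegularEnd.trace_mem (hM : IsRegularEnd p M) :
    LinearMap.trace _ _ M ∈ localRing p := by
  obtain ⟨U, hp, e, he⟩ := hV.exists_isFrame p
  rw [LinearMap.trace_eq_matrix_trace _ (he.genBasis (P1.genericPoint_mem hp))]
  exact sum_mem fun j _ => (he.isRegularEnd_iff hp).1 hM j j

/-- The trace form on matrices over the local ring is perfect: testing against the matrix units of a
local frame reads off the entries of M. -/
theorem isRegularEnd_of_trace_mem
    (h : ∀ N, IsRegularEnd p N → LinearMap.trace _ _ (N * M) ∈ localRing p) :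
    IsRegularEnd p M := by
  obtain ⟨U, hp, e, he⟩ := hV.exists_isFrame p
  rw [he.isRegularEnd_iff hp]
  intro j l
  set B := he.genBasis (P1.genericPoint_mem hp) with hB
  have h1 := h (Matrix.toLin B B (Matrix.single l j 1)) ((he.isRegularEnd_iff hp).2 fun a b => by
    rw [LinearMap.toMatrix_toLin, Matrix.single_apply]
    split_ifs
    exacts [one_mem _, zero_mem _])
  rw [LinearMap.trace_eq_matrix_trace _ B, LinearMap.toMatrix_mul,
    LinearMap.toMatrix_toLin, Matrix.trace_single_mul] at h1
  simpa using h1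

variable {i : Fin 2} {α β : Module.End k (Fiber V (P1.coordPoint k i))}

theorem exists_hasEndVal (hM : IsRegularEnd (P1.coordPoint k i) M) :
    ∃ α, HasEndVal (P1.coordPoint k i) M α := by
  obtain ⟨U, hp, e, he⟩ := hV.exists_isFrame (P1.coordPoint k i)
  choose A hA using fun j l => exists_hasVal ((he.isRegularEnd_iff hp).1 hM j l)
  refine ⟨Matrix.toLin (he.fiberBasis hp) (he.fiberBasis hp) (Matrix.of A),
    (he.hasEndVal_iff hp).2 fun j l => ?_⟩
  rw [LinearMap.toMatrix_toLin]
  exact hA j l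

theorem exists_hasEndVal_eq (α : Module.End k (Fiber V (P1.coordPoint k i))) :
    ∃ M, HasEndVal (P1.coordPoint k i) M α := by
  obtain ⟨U, hp, e, he⟩ := hV.exists_isFrame (P1.coordPoint k i)
  refine ⟨Matrix.toLin (he.genBasis (P1.genericPoint_mem hp))
    (he.genBasis (P1.genericPoint_mem hp)) ((LinearMap.toMatrix (he.fiberBasis hp)
      (he.fiberBasis hp) α).map (algebraMap k _)), (he.hasEndVal_iff hp).2 fun j l => ?_⟩
  rw [LinearMap.toMatrix_toLin]
  exact hasVal_algebraMap _ _

theorem HasEndVal.isRegularEnd (h : HasEndVal (P1.coordPoint k i) M α) :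
    IsRegularEnd (P1.coordPoint k i) M := by
  obtain ⟨U, hp, e, he⟩ := hV.exists_isFrame (P1.coordPoint k i)
  exact (he.isRegularEnd_iff hp).2 fun j l => ((he.hasEndVal_iff hp).1 h j l).mem

theorem HasEndVal.add (h : HasEndVal (P1.coordPoint k i) M α)
    (h' : HasEndVal (P1.coordPoint k i) N β) :
    HasEndVal (P1.coordPoint k i) (M + N) (α + β) := by
  obtain ⟨U, hp, e, he⟩ := hV.exists_isFrame (P1.coordPoint k i)
  rw [he.hasEndVal_iff hp] at h h' ⊢
  intro j l
  rw [map_add, map_add]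
  exact (h j l).add (h' j l)

theorem HasEndVal.smul {f : (P1 k).functionField} {c : k} (hf : HasVal (P1.coordPoint k i) f c)
    (h : HasEndVal (P1.coordPoint k i) M α) : HasEndVal (P1.coordPoint k i) (f • M) (c • α) := by
  obtain ⟨U, hp, e, he⟩ := hV.exists_isFrame (P1.coordPoint k i)
  rw [he.hasEndVal_iff hp] at h ⊢
  intro j l
  rw [map_smul, map_smul]
  exact hf.mul (h j l)

omit hV in
theorem HasEndVal.mul (h : HasEndVal (P1.coordPoint k i) M α)
    (h' : HasEndVal (P1.coordPoint k i) N β) :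
    HasEndVal (P1.coordPoint k i) (M * N) (α * β) :=
  fun v w hvw => h _ _ (h' v w hvw)

theorem HasEndVal.trace (h : HasEndVal (P1.coordPoint k i) M α) :
    HasVal (P1.coordPoint k i) (LinearMap.trace _ _ M) (LinearMap.trace _ _ α) := by
  obtain ⟨U, hp, e, he⟩ := hV.exists_isFrame (P1.coordPoint k i)
  rw [he.hasEndVal_iff hp] at h
  rw [LinearMap.trace_eq_matrix_trace _ (he.genBasis (P1.genericPoint_mem hp)),
    LinearMap.trace_eq_matrix_trace _ (he.fiberBasis hp)]
  exact HasVal.sum _ fun j _ => h j j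

theorem hasEndVal_zero_iff : HasEndVal (P1.coordPoint k i) M 0 ↔
    IsRegularEnd (P1.coordPoint k i) ((coord k i)⁻¹ • M) := by
  obtain ⟨U, hp, e, he⟩ := hV.exists_isFrame (P1.coordPoint k i)
  rw [he.hasEndVal_iff hp, he.isRegularEnd_iff hp]
  refine forall₂_congr fun j l => ?_
  rw [map_smul, map_zero, Matrix.zero_apply, hasVal_zero_iff, mul_comm]
  rfl

theorem exists_coord_pow_smul_isRegularEnd (i : Fin 2)
    (M : Module.End (P1 k).functionField (GenFiber V)) :
    ∃ N : ℕ, ∀ m, N ≤ m → IsRegularEnd (P1.coordPoint k i) (coord k i ^ m • M) := by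
  obtain ⟨U, hp, e, he⟩ := hV.exists_isFrame (P1.coordPoint k i)
  choose N hN using fun j l => exists_coord_pow_mul_mem i
    (LinearMap.toMatrix (he.genBasis (P1.genericPoint_mem hp))
      (he.genBasis (P1.genericPoint_mem hp)) M j l)
  refine ⟨Finset.univ.sup fun j => Finset.univ.sup (N j), fun m hm =>
    (he.isRegularEnd_iff hp).2 fun j l => ?_⟩
  rw [map_smul]
  exact hN j l m (((Finset.le_sup (Finset.mem_univ l)).trans
    (Finset.le_sup (f := fun j => Finset.univ.sup (N j)) (Finset.mem_univ j))).trans hm)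

theorem finrank_fiber (i : Fin 2) : Module.finrank k (Fiber V (P1.coordPoint k i)) = n := by
  obtain ⟨U, hp, e, he⟩ := hV.exists_isFrame (P1.coordPoint k i)
  simpa using Module.finrank_eq_card_basis (he.fiberBasis hp)

theorem finite_fiber (i : Fin 2) : Module.Finite k (Fiber V (P1.coordPoint k i)) := by
  obtain ⟨U, hp, e, he⟩ := hV.exists_isFrame (P1.coordPoint k i)
  exact Module.Finite.of_basis (he.fiberBasis hp)

end Values

end FiberCoordinates

section Curve

variable {k : Type u} [Field k] (X : NodalCurve k)

/-! ### Open sets and functions on the nodal curve -/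

theorem NodalCurve.π_zero_eq_π_infty : X.π (P1.zero k) = X.π (P1.infty k) :=
  (X.π_eq_iff _ _).2 (Or.inr ⟨by simp, by simp⟩)

theorem NodalCurve.zero_mem_iff {U : X.C.Opens} : P1.zero k ∈ X.π ⁻¹ᵁ U ↔ X.node ∈ U := Iff.rfl

theorem NodalCurve.infty_mem_iff {U : X.C.Opens} : P1.infty k ∈ X.π ⁻¹ᵁ U ↔ X.node ∈ U := by
  change X.π (P1.infty k) ∈ U ↔ X.π (P1.zero k) ∈ U
  rw [X.π_zero_eq_π_infty]

/-- π is closed, so the complement of the image of the complement of W is open; the condition on the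
two points says that W is saturated. -/
theorem NodalCurve.exists_preimage_eq (W : (P1 k).Opens)
    (h : P1.zero k ∈ W ↔ P1.infty k ∈ W) : ∃ U : X.C.Opens, X.π ⁻¹ᵁ U = W := by
  have := X.π_finite
  have hc : IsClosedMap X.π := X.π.isClosedMap
  refine ⟨⟨(X.π '' (W : Set (P1 k))ᶜ)ᶜ, (hc _ W.isOpen.isClosed_compl).isOpen_compl⟩, ?_⟩
  ext p
  change X.π p ∉ X.π '' (W : Set (P1 k))ᶜ ↔ p ∈ W
  constructor
  · intro hp
    by_contra hpW
    exact hp ⟨p, hpW, rfl⟩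
  · rintro hp ⟨x, hx, e⟩
    rcases (X.π_eq_iff x p).1 e with rfl | ⟨hx', hp'⟩
    · exact hx hp
    · apply hx
      simp only [Set.mem_insert_iff, Set.mem_singleton_iff] at hx' hp'
      rcases hx' with rfl | rfl <;> rcases hp' with rfl | rfl
      exacts [hp, h.2 hp, h.1 hp, hp]

theorem NodalCurve.π_genericPoint : X.π (genericPoint (P1 k)) = genericPoint X.C := by
  have h := (genericPoint_spec (P1 k)).image X.π.continuous
  rw [Set.image_univ, X.π_surjective.range_eq, closure_univ] at h
  exact h.eq (genericPoint_spec X.C)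

theorem NodalCurve.genericPoint_mem_iff {U : X.C.Opens} :
    genericPoint (P1 k) ∈ X.π ⁻¹ᵁ U ↔ genericPoint X.C ∈ U := by
  rw [← X.π_genericPoint]
  rfl

variable {X}

theorem NodalCurve.eq_bot_of_genericPoint_notMem {U : X.C.Opens}
    (h : genericPoint (P1 k) ∉ X.π ⁻¹ᵁ U) : U = ⊥ := by
  ext q
  obtain ⟨p, rfl⟩ := X.π_surjective q
  exact ⟨fun hp => (h (P1.genericPoint_mem (p := p) hp)).elim, fun hp => hp.elim⟩

/-- The rational function on the projective line defined by a function on an open set of `C`. -/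
def kC {U : X.C.Opens} (h : genericPoint (P1 k) ∈ X.π ⁻¹ᵁ U) :
    Γ(X.C, U) →+* (P1 k).functionField := (gK h).comp (X.π.app U).hom

theorem kC_injective {U : X.C.Opens} (h : genericPoint (P1 k) ∈ X.π ⁻¹ᵁ U) :
    Function.Injective (kC h) := (gK_injective h).comp (X.app_injective U)

theorem kC_res {U U' : X.C.Opens} (hU : U' ≤ U) (h : genericPoint (P1 k) ∈ X.π ⁻¹ᵁ U')
    (f : Γ(X.C, U)) :
    kC h (X.C.presheaf.map (homOfLE hU).op f) = kC (X := X) (U := U) (hU h) f := by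
  have e := ConcreteCategory.congr_hom (X.π.naturality (homOfLE hU).op) f
  simp only [ConcreteCategory.comp_apply] at e
  refine (congrArg (gK h) e).trans ?_
  exact gK_res (fun _ hp => hU hp) h _

theorem kC_mem {U : X.C.Opens} (h : genericPoint (P1 k) ∈ X.π ⁻¹ᵁ U) {p : P1 k}
    (hp : p ∈ X.π ⁻¹ᵁ U) (f : Γ(X.C, U)) : kC h f ∈ localRing p := gK_mem hp _

theorem exists_hasVal_kC {U : X.C.Opens} (h : genericPoint (P1 k) ∈ X.π ⁻¹ᵁ U) (hq : X.node ∈ U)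
    (f : Γ(X.C, U)) :
    ∃ c, HasVal (P1.zero k) (kC h f) c ∧ HasVal (P1.infty k) (kC h f) c := by
  obtain ⟨c, h0, h1⟩ := X.exists_value hq f
  exact ⟨c, ⟨_, toK_germ _ _, h0⟩, ⟨_, toK_germ _ _, h1⟩⟩

theorem exists_kC_eq {U : X.C.Opens} (h : genericPoint (P1 k) ∈ X.π ⁻¹ᵁ U)
    {f : (P1 k).functionField} (hf : ∀ p ∈ X.π ⁻¹ᵁ U, f ∈ localRing p)
    (hv : X.node ∈ U → ∃ c, HasVal (P1.zero k) f c ∧ HasVal (P1.infty k) f c) :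
    ∃ s, kC h s = f := by
  obtain ⟨g, rfl⟩ := exists_gK_eq h hf
  obtain ⟨s, rfl⟩ := (X.mem_range_app_iff U g).2 fun h₀ h₁ => by
    obtain ⟨c, h0, h1⟩ := hv h₀
    refine ⟨c, hasVal_toK.1 ?_, hasVal_toK.1 ?_⟩
    · rwa [toK_germ]
    · rwa [toK_germ]
  exact ⟨s, rfl⟩

theorem π_app_constSec (U : X.C.Opens) (c : k) :
    X.π.app U (constSec X.str U c) = constSec (P1.str k) (X.π ⁻¹ᵁ U) c := by
  have e := ConcreteCategory.congr_hom (X.π.naturality (homOfLE (le_top : U ≤ ⊤)).op)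
    (constSec X.str ⊤ c)
  have h1 : constSec X.str U c =
      X.C.presheaf.map (homOfLE (le_top : U ≤ ⊤)).op (constSec X.str ⊤ c) := by
    simp [constSec]
  have h2 : X.π.app ⊤ (constSec X.str ⊤ c) = constSec (P1.str k) ⊤ c := by
    simp [constSec, ← X.π_str]
    rfl
  have h3 : constSec (P1.str k) (X.π ⁻¹ᵁ U) c =
      (P1 k).presheaf.map (homOfLE (le_top : X.π ⁻¹ᵁ U ≤ ⊤)).op (constSec (P1.str k) ⊤ c) := by
    simp [constSec]
  rw [h1, h3, ← h2]
  exact e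

theorem kC_constSec {U : X.C.Opens} (h : genericPoint (P1 k) ∈ X.π ⁻¹ᵁ U) (c : k) :
    kC h (constSec X.str U c) = algebraMap k (P1 k).functionField c := by
  refine (congrArg (gK h) (π_app_constSec U c)).trans ?_
  have h3 : constSec (P1.str k) (X.π ⁻¹ᵁ U) c =
      (P1 k).presheaf.map (homOfLE (le_top : X.π ⁻¹ᵁ U ≤ ⊤)).op (constSec (P1.str k) ⊤ c) := by
    simp [constSec]
  rw [h3, gK_res]
  rfl

theorem P1.coordPoint_notMem_chart (i : Fin 2) : P1.coordPoint k i ∉ P1.chart k i := by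
  rw [Proj.mem_basicOpen, not_not]
  exact Ideal.mem_span_singleton_self (MvPolynomial.X i)

/-- Every rational function comes from a function on some open set of `C`. -/
theorem exists_kC (X : NodalCurve k) (f : (P1 k).functionField) :
    ∃ (U : X.C.Opens) (h : genericPoint (P1 k) ∈ X.π ⁻¹ᵁ U) (s : Γ(X.C, U)), kC h s = f := by
  obtain ⟨W, hW, g, rfl⟩ := exists_gK f
  -- Removing both special points makes the open set saturated and leaves no condition at the node.
  have h0 : P1.zero k ∉ W ⊓ (P1.chart k 0 ⊓ P1.chart k 1) := fun h =>
    P1.coordPoint_notMem_chart 1 h.2.2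
  have h1 : P1.infty k ∉ W ⊓ (P1.chart k 0 ⊓ P1.chart k 1) := fun h =>
    P1.coordPoint_notMem_chart 0 h.2.1
  obtain ⟨U, hU⟩ := X.exists_preimage_eq _ (iff_of_false h0 h1)
  have h : genericPoint (P1 k) ∈ X.π ⁻¹ᵁ U :=
    hU ▸ ⟨hW, P1.genericPoint_mem_chart 1, P1.genericPoint_mem_chart 0⟩
  obtain ⟨s, hs⟩ := exists_kC_eq h (f := gK hW g) (fun p hp => by
    rw [hU] at hp
    exact gK_mem hp.1 g) (fun hq => (h0 (hU ▸ X.zero_mem hq)).elim)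
  exact ⟨U, h, s, hs⟩

/-! ### The dualizing sheaf -/

theorem coe_smul_omega {U : X.C.Opens} (h : genericPoint (P1 k) ∈ X.π ⁻¹ᵁ U) (f : Γ(X.C, U))
    (η : omega X U) (p) : (f • η).1 p = kC h f • η.1 p := by
  change toK p.1 ((P1 k).presheaf.germ _ p.1 p.2 (X.π.app U f)) • η.1 p = _
  rw [toK_germ]
  rfl

/-- ω_C is free with generator dt/t: this differential generates the regular ones away from the two
points and has residues 1 and -1 there, so opposite residues of f dt/t mean equal values of f. -/
theorem mem_omega_iff {U : X.C.Opens} (h : genericPoint (P1 k) ∈ X.π ⁻¹ᵁ U)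
    (η : (p : (X.π ⁻¹ᵁ U : (P1 k).Opens)) → RatDiff k) :
    η ∈ omega X U ↔ ∃ f : Γ(X.C, U), ∀ p, η p = kC h f • dlog k 1 := by
  -- At ∞ the local coordinate is 1/t, whose logarithmic differential is -dt/t, so the residue -c
  -- corresponds to the value c.
  have hinf : ∀ (f : (P1 k).functionField) (c : k),
      HasLogResidue (P1.infty k) (f • dlog k 1) (-c) ↔ HasVal (P1.infty k) f c := by
    intro f c
    have e : f • dlog k 1 = (-f) • dlog k 0 := by
      have := dlog_add_one (k := k) 1
      have h2 : (1 : Fin 2) + 1 = 0 := rfl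
      rw [h2] at this
      rw [this, smul_neg, neg_smul, neg_neg]
    rw [e, hasLogResidue_smul_dlog_iff]
    exact ⟨fun h => by simpa using h.neg, fun h => h.neg⟩
  constructor
  · rintro ⟨h1, h2, h3⟩
    obtain ⟨f, hf⟩ := exists_eq_smul_dlog 1 (η ⟨_, h⟩)
    have hf' : ∀ p, η p = f • dlog k 1 := fun p => (h1 p _).trans hf
    have hval : X.node ∈ U → ∃ c, HasVal (P1.zero k) f c ∧ HasVal (P1.infty k) f c := by
      intro hq
      obtain ⟨c, h0, h1⟩ := h3 hq
      rw [hf'] at h0 h1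
      exact ⟨c, (hasLogResidue_smul_dlog_iff 1 f c).1 h0, (hinf f c).1 h1⟩
    obtain ⟨s, rfl⟩ := exists_kC_eq h (f := f) (fun p hp => by
      by_cases hp0 : p = P1.zero k
      · obtain ⟨c, h0, -⟩ := hval (X.zero_mem_iff.1 (hp0 ▸ hp))
        exact hp0 ▸ h0.mem
      by_cases hp1 : p = P1.infty k
      · obtain ⟨c, -, h1⟩ := hval (X.infty_mem_iff.1 (hp1 ▸ hp))
        exact hp1 ▸ h1.mem
      have := h2 ⟨p, hp⟩ hp0 hp1
      rw [hf'] at this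
      exact (isRegularAt_smul_dlog_iff 1 hp0 hp1 f).1 this) hval
    exact ⟨s, hf'⟩
  · rintro ⟨f, hf⟩
    refine ⟨fun p p' => by rw [hf, hf], fun p hp0 hp1 => ?_, fun hq => ?_⟩
    · rw [hf]
      exact (isRegularAt_smul_dlog_iff 1 hp0 hp1 _).2 (kC_mem h p.2 f)
    · obtain ⟨c, h0, h1⟩ := exists_hasVal_kC h hq f
      rw [hf, hf]
      exact ⟨c, (hasLogResidue_smul_dlog_iff 1 _ c).2 h0, (hinf _ c).2 h1⟩

end Curve

section OrderSections

variable {k : Type u} [Field k] {X : NodalCurve k} {V : (P1 k).Modules}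
  {I : Subalgebra k (Module.End k (Fiber V (P1.zero k)) × Module.End k (Fiber V (P1.infty k)))}

/-! ### Sections of the order as endomorphisms of the generic stalk -/

/-- The endomorphism of the generic stalk given by a section of the order. -/
def oE {U : X.C.Opens} (h : genericPoint (P1 k) ∈ X.π ⁻¹ᵁ U) :
    (orderSheaf X V I).sec U →+* Module.End (P1 k).functionField (GenFiber V) :=
  (genEnd h).comp (orderSections X V I U).subtype

theorem oE_injective {n : ℕ} (hV : IsVectorBundle V n) {U : X.C.Opens}
    (h : genericPoint (P1 k) ∈ X.π ⁻¹ᵁ U) : Function.Injective (oE (I := I) h) :=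
  (genEnd_injective hV h).comp Subtype.val_injective

theorem oE_res {U U' : X.C.Opens} (hU : U' ≤ U) (h : genericPoint (P1 k) ∈ X.π ⁻¹ᵁ U')
    (a : (orderSheaf X V I).sec U) :
    oE h ((orderSheaf X V I).res hU a) = oE (X := X) (U := U) (hU h) a :=
  genEnd_endRes (fun _ hp => hU hp) h _

theorem oE_unit {U : X.C.Opens} (h : genericPoint (P1 k) ∈ X.π ⁻¹ᵁ U) (f : Γ(X.C, U)) :
    oE h ((orderSheaf X V I).unit U f) = algebraMap _ _ (kC h f) :=
  genEnd_endScalar h _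

theorem oE_smul {U : X.C.Opens} (h : genericPoint (P1 k) ∈ X.π ⁻¹ᵁ U) (f : Γ(X.C, U))
    (a : (orderSheaf X V I).sec U) : oE h (f • a) = kC h f • oE h a := by
  rw [Algebra.smul_def, map_mul, Algebra.smul_def]
  congr 1
  exact oE_unit h f

theorem isRegularEnd_oE {U : X.C.Opens} (h : genericPoint (P1 k) ∈ X.π ⁻¹ᵁ U)
    (a : (orderSheaf X V I).sec U) {p : P1 k} (hp : p ∈ X.π ⁻¹ᵁ U) : IsRegularEnd p (oE h a) :=
  isRegularEnd_genEnd h _ hp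

theorem exists_hasEndVal_oE {n : ℕ} (hV : IsVectorBundle V n) {U : X.C.Opens}
    (h : genericPoint (P1 k) ∈ X.π ⁻¹ᵁ U) (a : (orderSheaf X V I).sec U) (hq : X.node ∈ U) :
    ∃ x ∈ I, HasEndVal (P1.zero k) (oE h a) x.1 ∧ HasEndVal (P1.infty k) (oE h a) x.2 := by
  obtain ⟨x, hx, h0, h1⟩ := a.2 hq
  exact ⟨x, hx, (hasFiberValue_iff hV h a.1 (X.zero_mem hq) x.1).1 h0,
    (hasFiberValue_iff hV h a.1 (X.infty_mem hq) x.2).1 h1⟩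

/-- With `oE_injective`, the sections of the order become endomorphisms of one vector space subject
to conditions at points. All later sections are constructed in this way. -/
theorem exists_oE_eq {n : ℕ} (hV : IsVectorBundle V n) {U : X.C.Opens}
    (h : genericPoint (P1 k) ∈ X.π ⁻¹ᵁ U) {M : Module.End (P1 k).functionField (GenFiber V)}
    (hM : ∀ p ∈ X.π ⁻¹ᵁ U, IsRegularEnd p M)
    (hI : X.node ∈ U → ∃ x ∈ I, HasEndVal (P1.zero k) M x.1 ∧ HasEndVal (P1.infty k) M x.2) :
    ∃ a : (orderSheaf X V I).sec U, oE h a = M := by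
  obtain ⟨a, rfl⟩ := exists_genEnd_eq hV h hM
  refine ⟨⟨a, fun hq => ?_⟩, rfl⟩
  obtain ⟨x, hx, h0, h1⟩ := hI hq
  exact ⟨x, hx, (hasFiberValue_iff hV h a (X.zero_mem hq) x.1).2 h0,
    (hasFiberValue_iff hV h a (X.infty_mem hq) x.2).2 h1⟩

theorem subsingleton_sec {U : X.C.Opens} (h : genericPoint (P1 k) ∉ X.π ⁻¹ᵁ U) :
    Subsingleton ((orderSheaf X V I).sec U) := by
  refine ⟨fun a b => Subtype.ext (Subtype.ext (funext fun W => ?_))⟩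
  ext v
  have := subsingleton_of_genericPoint_notMem (V := V) (W := W.1) fun hW => h (W.2 hW)
  exact Subsingleton.elim _ _

/-! ### The sheaf property and torsion freeness -/

section IsOrder

variable {n : ℕ} (hV : IsVectorBundle V n)

include hV

/-- Compatible sections over nonempty open sets share one generic endomorphism. Regularity and the
condition at the node are imposed point by point, so they hold on the union as soon as they hold on
each member. -/
theorem orderSheaf_isSheaf : (orderSheaf X V I).presheaf.IsSheaf := by
  rw [TopCat.Presheaf.isSheaf_iff_isSheafUniqueGluing]
  intro ι U sf hsf
  by_cases h : ∃ i, genericPoint (P1 k) ∈ X.π ⁻¹ᵁ (U i)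
  · obtain ⟨i₀, h₀⟩ := h
    have hle : ∀ i, U i ≤ iSup U := fun i => le_iSup U i
    have hsup : genericPoint (P1 k) ∈ X.π ⁻¹ᵁ (iSup U) := hle i₀ h₀
    have key : ∀ i (h : genericPoint (P1 k) ∈ X.π ⁻¹ᵁ (U i)),
        oE (I := I) h (sf i) = oE h₀ (sf i₀) := by
      intro i h
      have h' : genericPoint (P1 k) ∈ X.π ⁻¹ᵁ (U i ⊓ U i₀) := ⟨h, h₀⟩
      have e := congrArg (oE (I := I) h') (hsf i i₀)
      exact ((oE_res inf_le_left h' (sf i)).symm.trans e).trans (oE_res inf_le_right h' (sf i₀))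
    obtain ⟨a, ha⟩ := exists_oE_eq (I := I) hV hsup (M := oE h₀ (sf i₀)) (fun p hp => by
        obtain ⟨i, hi⟩ := Opens.mem_iSup.1 (show X.π p ∈ iSup U from hp)
        have hi' : p ∈ X.π ⁻¹ᵁ (U i) := hi
        rw [← key i (P1.genericPoint_mem hi')]
        exact isRegularEnd_oE _ _ hi') (fun hq => by
        obtain ⟨i, hi⟩ := Opens.mem_iSup.1 hq
        rw [← key i (P1.genericPoint_mem (X.zero_mem hi))]
        exact exists_hasEndVal_oE hV _ _ hi)
    refine ⟨a, fun i => ?_, fun b hb => ?_⟩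
    · by_cases hi : genericPoint (P1 k) ∈ X.π ⁻¹ᵁ (U i)
      · apply oE_injective (I := I) hV hi
        exact (oE_res (hle i) hi a).trans (ha.trans (key i hi).symm)
      · have := subsingleton_sec (V := V) (I := I) hi
        exact Subsingleton.elim (α := (orderSheaf X V I).sec (U i)) _ _
    · apply oE_injective (I := I) hV hsup
      rw [ha]
      exact (oE_res (hle i₀) h₀ b).symm.trans (congrArg (oE (I := I) h₀) (hb i₀))
  -- If no member of the cover contains the generic point, all members are empty, and so is the
  -- union.
  · push Not at h
    have hsup : genericPoint (P1 k) ∉ X.π ⁻¹ᵁ (iSup U) := fun hq => by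
      obtain ⟨i, hi⟩ := Opens.mem_iSup.1 (show X.π (genericPoint (P1 k)) ∈ iSup U from hq)
      exact h i hi
    have := subsingleton_sec (V := V) (I := I) hsup
    refine ⟨(0 : (orderSheaf X V I).sec (iSup U)), fun i => ?_, fun b _ =>
      Subsingleton.elim (α := (orderSheaf X V I).sec (iSup U)) _ _⟩
    have := subsingleton_sec (V := V) (I := I) (h i)
    exact Subsingleton.elim (α := (orderSheaf X V I).sec (U i)) _ _

theorem orderSheaf_torsionFree (U : X.C.Opens) (f : Γ(X.C, U)) (a : (orderSheaf X V I).sec U)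
    (hf : f ≠ 0) (h : f • a = 0) : a = 0 := by
  by_cases hη : genericPoint (P1 k) ∈ X.π ⁻¹ᵁ U
  · apply oE_injective (I := I) hV hη
    have e := congrArg (oE (I := I) hη) h
    rw [oE_smul, map_zero] at e
    rw [map_zero]
    exact (smul_eq_zero.1 e).resolve_left ((map_ne_zero_iff _ (kC_injective hη)).2 hf)
  · have := subsingleton_sec (V := V) (I := I) hη
    exact Subsingleton.elim _ _

theorem orderSheaf_exists_pow_smul_eq_zero (U : X.C.Opens) (f : Γ(X.C, U))
    (a : (orderSheaf X V I).sec U) (h : (orderSheaf X V I).res (X.C.basicOpen_le f) a = 0) :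
    ∃ N : ℕ, f ^ N • a = 0 := by
  by_cases hη : genericPoint (P1 k) ∈ X.π ⁻¹ᵁ (X.C.basicOpen f)
  · refine ⟨0, ?_⟩
    have hη' : genericPoint (P1 k) ∈ X.π ⁻¹ᵁ U := X.C.basicOpen_le f hη
    rw [pow_zero, one_smul]
    apply oE_injective (I := I) hV hη'
    rw [map_zero, ← oE_res (X.C.basicOpen_le f) hη, h, map_zero]
  -- D(f) is empty only for f = 0, and then the exponent has to be 1, as f ^ 0 = 1.
  · have h0 : f = 0 := (basicOpen_eq_bot_iff f).1 (NodalCurve.eq_bot_of_genericPoint_notMem hη)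
    exact ⟨1, by rw [h0, pow_one, zero_smul]⟩

end IsOrder

end OrderSections

/-! ### Sections over basic open sets of affine open sets -/

section Coherence

variable {k : Type u} [Field k] {X : NodalCurve k} {V : (P1 k).Modules}
  {I : Subalgebra k (Module.End k (Fiber V (P1.zero k)) × Module.End k (Fiber V (P1.infty k)))}

theorem IsFrame.restrict {n : ℕ} {U W : (P1 k).Opens} {e : Fin n → Γ(V, U)} (he : IsFrame V e)
    (h : W ≤ U) : IsFrame V fun i => V.presheaf.map (homOfLE h).op (e i) where
  basis O hO := by
    obtain ⟨b, hb⟩ := he.basis O (hO.trans h)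
    exact ⟨b, fun i => by rw [hb, map_map_apply]⟩

theorem exists_isAffineOpen_isFrame {n : ℕ} (hV : IsVectorBundle V n) {W : (P1 k).Opens} {p : P1 k}
    (hp : p ∈ W) : ∃ (O : (P1 k).Opens) (_ : O ≤ W) (_ : p ∈ O) (e : Fin n → Γ(V, O)),
      IsAffineOpen O ∧ IsFrame V e := by
  obtain ⟨U, hpU, e, he⟩ := hV.exists_isFrame p
  have hpUW : p ∈ U ⊓ W := ⟨hpU, hp⟩
  obtain ⟨O, hO, hpO, hle⟩ := exists_isAffineOpen_mem_and_subset hpUW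
  exact ⟨O, fun x hx => (hle hx).2, hpO, _, hO, he.restrict fun x hx => (hle hx).1⟩

/-- A property of natural numbers and points that holds locally for large numbers
holds for large numbers on affine open sets. -/
theorem exists_nat_of_locally {Y : Scheme.{u}} {W : Y.Opens} (hW : IsAffineOpen W)
    {P : ℕ → Y → Prop} (h : ∀ p ∈ W, ∃ (O : Y.Opens) (N : ℕ), p ∈ O ∧
      ∀ m, N ≤ m → ∀ q ∈ O, P m q) : ∃ N, ∀ m, N ≤ m → ∀ q ∈ W, P m q := by
  choose O N hp hO using fun p : W => h p.1 p.2
  obtain ⟨t, ht⟩ := hW.isCompact.elim_finite_subcover (fun p => (O p : Set Y))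
    (fun p => (O p).isOpen) fun p hp' => Set.mem_iUnion.2 ⟨⟨p, hp'⟩, hp _⟩
  refine ⟨t.sup N, fun m hm q hq => ?_⟩
  obtain ⟨p, hpt, hq'⟩ := Set.mem_iUnion₂.1 (ht hq)
  exact hO p m ((Finset.le_sup hpt).trans hm) q hq'

theorem exists_pow_mul_mem_localRing {O : (P1 k).Opens} (hO : IsAffineOpen O)
    (hη : genericPoint (P1 k) ∈ O) (g : Γ(P1 k, O)) (hg : g ≠ 0) (m : (P1 k).functionField)
    (hm : ∀ p ∈ (P1 k).basicOpen g, m ∈ localRing p) :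
    ∃ N : ℕ, ∀ l, N ≤ l → ∀ p ∈ O, gK hη g ^ l * m ∈ localRing p := by
  have hη' : genericPoint (P1 k) ∈ (P1 k).basicOpen g := by
    rw [Scheme.mem_basicOpen _ _ _ hη]
    exact isUnit_iff_ne_zero.2 ((map_ne_zero_iff _ (gK_injective hη)).2 hg)
  obtain ⟨x, rfl⟩ := exists_gK_eq hη' hm
  obtain ⟨N, y, hy⟩ := exists_eq_pow_mul_of_isAffineOpen _ O hO g x
  have e := congrArg (gK hη') hy
  rw [map_mul, map_pow] at e
  have e1 : gK hη y = gK hη g ^ N * gK hη' x := by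
    rw [← gK_res ((P1 k).basicOpen_le g) hη' y, ← gK_res ((P1 k).basicOpen_le g) hη' g]
    exact e
  refine ⟨N, fun l hl p hp => ?_⟩
  obtain ⟨d, rfl⟩ := Nat.exists_eq_add_of_le hl
  rw [pow_add, mul_right_comm, ← e1]
  exact mul_mem (gK_mem hp y) (pow_mem (gK_mem hp g) _)

variable {n : ℕ} (hV : IsVectorBundle V n)

include hV

/-- In a frame over a small affine open set this is the corresponding fact about functions, applied
to each matrix entry; quasi-compactness makes the exponent uniform. -/
theorem exists_pow_smul_isRegularEnd {W : (P1 k).Opens} (hW : IsAffineOpen W)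
    (hη : genericPoint (P1 k) ∈ W) (g : Γ(P1 k, W)) (hg : g ≠ 0)
    (M : Module.End (P1 k).functionField (GenFiber V))
    (hM : ∀ p ∈ (P1 k).basicOpen g, IsRegularEnd p M) :
    ∃ N : ℕ, ∀ l, N ≤ l → ∀ p ∈ W, IsRegularEnd p (gK hη g ^ l • M) := by
  refine exists_nat_of_locally hW fun p hp => ?_
  obtain ⟨O, hOW, hpO, e, hO, he⟩ := exists_isAffineOpen_isFrame hV hp
  have hηO := P1.genericPoint_mem hpO
  set g' := (P1 k).presheaf.map (homOfLE hOW).op g with hg'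
  have hgg : gK hηO g' = gK hη g := gK_res hOW hηO g
  have hg'0 : g' ≠ 0 := by
    intro h
    rw [h, map_zero, eq_comm] at hgg
    exact hg ((map_eq_zero_iff _ (gK_injective hη)).1 hgg)
  choose N hN using fun i j => exists_pow_mul_mem_localRing hO hηO g' hg'0
    (LinearMap.toMatrix (he.genBasis hηO) (he.genBasis hηO) M i j) fun q hq => by
      have hq' : q ∈ O := (P1 k).basicOpen_le g' hq
      refine (he.isRegularEnd_iff hq').1 (hM q ?_) i j
      rw [hg', Scheme.basicOpen_res] at hq
      exact hq.2
  refine ⟨O, Finset.univ.sup fun i => Finset.univ.sup (N i), hpO, fun m hm q hq =>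
    (he.isRegularEnd_iff hq).2 fun i j => ?_⟩
  rw [map_smul, ← hgg]
  exact hN i j m (((Finset.le_sup (Finset.mem_univ j)).trans
    (Finset.le_sup (f := fun i => Finset.univ.sup (N i)) (Finset.mem_univ i))).trans hm) q hq

/-- Once f ^ N clears the poles, only the condition at the node is left. If f vanishes at the node,
one further factor f makes the value 0, which lies in I. Otherwise the node belongs to D(f), and the
value is a scalar multiple of that of b. -/
theorem orderSheaf_exists_pow_smul_eq_res (U : X.C.Opens) (hU : IsAffineOpen U) (f : Γ(X.C, U))
    (b : (orderSheaf X V I).sec (X.C.basicOpen f)) :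
    ∃ (N : ℕ) (a : (orderSheaf X V I).sec U), (orderSheaf X V I).res (X.C.basicOpen_le f) a =
      X.C.presheaf.map (homOfLE (X.C.basicOpen_le f)).op (f ^ N) • b := by
  by_cases hη : genericPoint (P1 k) ∈ X.π ⁻¹ᵁ (X.C.basicOpen f)
  swap
  · have := subsingleton_sec (V := V) (I := I) hη
    exact ⟨0, 0, Subsingleton.elim _ _⟩
  have hη' : genericPoint (P1 k) ∈ X.π ⁻¹ᵁ U := X.C.basicOpen_le f hη
  have := X.π_finite
  have hW : IsAffineOpen (X.π ⁻¹ᵁ U) := hU.preimage X.π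
  have hbo : X.π ⁻¹ᵁ (X.C.basicOpen f) = (P1 k).basicOpen (X.π.app U f) :=
    Scheme.preimage_basicOpen X.π f
  have hg : X.π.app U f ≠ 0 := by
    intro h0
    rw [hbo, h0, Scheme.basicOpen_zero] at hη
    exact hη
  obtain ⟨N, hN⟩ := exists_pow_smul_isRegularEnd hV hW hη' (X.π.app U f) hg (oE hη b)
    fun p hp => isRegularEnd_oE hη b (hbo ▸ hp)
  have hN' : ∀ l, N ≤ l → ∀ p ∈ X.π ⁻¹ᵁ U, IsRegularEnd p (kC hη' f ^ l • oE hη b) := hN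
  obtain ⟨a, ha⟩ := exists_oE_eq (I := I) hV hη' (hN' (N + 1) (Nat.le_succ _)) (fun hq => by
    obtain ⟨c, h0, h1⟩ := exists_hasVal_kC hη' hq f
    by_cases hc : c = 0
    · subst hc
      obtain ⟨α, hα⟩ := exists_hasEndVal hV (hN' N le_rfl _ (X.zero_mem hq))
      obtain ⟨β, hβ⟩ := exists_hasEndVal hV (hN' N le_rfl _ (X.infty_mem hq))
      refine ⟨0, I.zero_mem, ?_, ?_⟩
      · rw [pow_succ', mul_smul]
        simpa using hα.smul hV h0
      · rw [pow_succ', mul_smul]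
        simpa using hβ.smul hV h1
    · have hq' : X.node ∈ X.C.basicOpen f := by
        rw [← X.zero_mem_iff, hbo, Scheme.mem_basicOpen _ _ _ (X.zero_mem hq)]
        obtain ⟨g, hg, hg'⟩ := h0
        have : g = (P1 k).presheaf.germ _ _ (X.zero_mem hq) (X.π.app U f) :=
          toK_injective _ (hg.trans (toK_germ (X.zero_mem hq) _).symm)
        rw [← this]
        by_contra hn
        have h2 := sub_mem ((IsLocalRing.mem_maximalIdeal _).2 hn) hg'
        rw [sub_sub_cancel] at h2
        exact (IsLocalRing.mem_maximalIdeal _).1 h2 ((isUnit_iff_ne_zero.2 hc).map _)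
      obtain ⟨x, hx, hx0, hx1⟩ := exists_hasEndVal_oE hV hη b hq'
      exact ⟨c ^ (N + 1) • x, I.smul_mem hx _, hx0.smul hV (h0.pow _), hx1.smul hV (h1.pow _)⟩)
  refine ⟨N + 1, a, oE_injective (I := I) hV hη ?_⟩
  rw [oE_res, ha, oE_smul, kC_res, map_pow]

end Coherence

section Finiteness

variable {k : Type u} [Field k] {X : NodalCurve k} {V : (P1 k).Modules}
  {I : Subalgebra k (Module.End k (Fiber V (P1.zero k)) × Module.End k (Fiber V (P1.infty k)))}

/-! ### Finiteness -/

instance : LocallyOfFiniteType (P1.str k) := by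
  have : LocallyOfFiniteType (Spec.map (CommRingCat.ofHom (algebraMap k (G k 0)))) := by
    rw [HasRingHomProperty.Spec_iff (P := @LocallyOfFiniteType)]
    -- Forms of degree zero are constants.
    refine RingHom.FiniteType.of_surjective _ fun ⟨x, hx⟩ => ⟨_, Subtype.ext
      (MvPolynomial.totalDegree_eq_zero_iff_eq_C.1
        (Nat.eq_zero_of_le_zero (MvPolynomial.IsHomogeneous.totalDegree_le hx))).symm⟩
  exact inferInstanceAs (LocallyOfFiniteType (Proj.toSpecZero (G k) ≫ Spec.map _))

theorem finiteType_constSec {W : (P1 k).Opens} (hW : IsAffineOpen W) :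
    (constSec (P1.str k) W).FiniteType := by
  have h := (P1.str k).finiteType_appLE (isAffineOpen_top _) hW le_top
  exact RingHom.FiniteType.comp h (RingHom.FiniteType.of_surjective _
    (Scheme.ΓSpecIso (.of k)).symm.commRingCatIsoToRingEquiv.surjective)

/-- The Artin-Tate lemma: the functions on the affine set π⁻¹(U) are a finitely generated k-algebra
and a finite module over the functions on U, so the latter are a finitely generated k-algebra too.
-/
theorem isNoetherianRing_section {U : X.C.Opens} (hU : IsAffineOpen U) :
    IsNoetherianRing Γ(X.C, U) := by
  have := X.π_finite
  have hW : IsAffineOpen (X.π ⁻¹ᵁ U) := hU.preimage X.π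
  let : Algebra k Γ(X.C, U) := (constSec X.str U).toAlgebra
  let : Algebra k Γ(P1 k, X.π ⁻¹ᵁ U) := (constSec (P1.str k) (X.π ⁻¹ᵁ U)).toAlgebra
  let : Algebra Γ(X.C, U) Γ(P1 k, X.π ⁻¹ᵁ U) := (X.π.app U).hom.toAlgebra
  have : IsScalarTower k Γ(X.C, U) Γ(P1 k, X.π ⁻¹ᵁ U) :=
    IsScalarTower.of_algebraMap_eq fun c => (π_app_constSec U c).symm
  have h1 : Algebra.FiniteType k Γ(P1 k, X.π ⁻¹ᵁ U) := finiteType_constSec hW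
  have h2 : Module.Finite Γ(X.C, U) Γ(P1 k, X.π ⁻¹ᵁ U) := X.π.finite_app U hU
  have h3 : Algebra.FiniteType k Γ(X.C, U) :=
    ⟨fg_of_fg_of_fg k Γ(X.C, U) Γ(P1 k, X.π ⁻¹ᵁ U) h1.out h2.fg_top (X.app_injective U)⟩
  exact Algebra.FiniteType.isNoetherianRing k _

theorem exists_mul_eq_gK {W : (P1 k).Opens} (hW : IsAffineOpen W)
    (hη : genericPoint (P1 k) ∈ W) {ι : Type*} [Finite ι] (f : ι → (P1 k).functionField) :
    ∃ h : Γ(P1 k, W), h ≠ 0 ∧ ∀ i, ∃ g, gK hη g = gK hη h * f i := by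
  have : Nonempty W := ⟨⟨_, hη⟩⟩
  have := functionField_isFractionRing_of_isAffineOpen (P1 k) W hW
  obtain ⟨b, hb⟩ := IsLocalization.exist_integer_multiples_of_finite
    (nonZeroDivisors Γ(P1 k, W)) f
  refine ⟨b, nonZeroDivisors.coe_ne_zero b, fun i => ?_⟩
  obtain ⟨g, hg⟩ := hb i
  exact ⟨g, hg.trans (Algebra.smul_def _ _)⟩

variable {n : ℕ} (hV : IsVectorBundle V n)

include hV

/-- Near each point the matrix in the basis `B` arises from one with regular entries by a change of
basis. The function h clears the denominators of these transition matrices on finitely many open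
sets covering W, uniformly in M. -/
theorem exists_mul_toMatrix_mem {W : (P1 k).Opens} (hW : IsAffineOpen W)
    (hη : genericPoint (P1 k) ∈ W)
    (B : Module.Basis (Fin n) (P1 k).functionField (GenFiber V)) :
    ∃ h : Γ(P1 k, W), h ≠ 0 ∧ ∀ p ∈ W, ∀ M, IsRegularEnd p M → ∀ i j,
      gK hη h * LinearMap.toMatrix B B M i j ∈ localRing p := by
  have key : ∀ p : W, ∃ (O : (P1 k).Opens) (h : Γ(P1 k, W)), p.1 ∈ O ∧ O ≤ W ∧ h ≠ 0 ∧
      ∀ q ∈ O, ∀ M, IsRegularEnd q M → ∀ i j,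
        gK hη h * LinearMap.toMatrix B B M i j ∈ localRing q := by
    rintro ⟨p, hp⟩
    obtain ⟨O, hOW, hpO, e, hO, he⟩ := exists_isAffineOpen_isFrame hV hp
    set B' := he.genBasis (P1.genericPoint_mem hpO)
    obtain ⟨h, h0, hh⟩ := exists_mul_eq_gK hW hη
      fun x : (Fin n × Fin n) × (Fin n × Fin n) =>
        B.toMatrix B' x.1.1 x.1.2 * B'.toMatrix B x.2.1 x.2.2
    refine ⟨O, h, hpO, hOW, h0, fun q hq M hM i j => ?_⟩
    have hM' := (he.isRegularEnd_iff hq).1 hM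
    rw [← basis_toMatrix_mul_linearMap_toMatrix_mul_basis_toMatrix B B' B B' M,
      Matrix.mul_apply, Finset.mul_sum]
    refine sum_mem fun b _ => ?_
    rw [Matrix.mul_apply, Finset.sum_mul, Finset.mul_sum]
    refine sum_mem fun a _ => ?_
    obtain ⟨g, hg⟩ := hh ((i, a), (b, j))
    have : gK hη h * (B.toMatrix B' i a * LinearMap.toMatrix B' B' M a b * B'.toMatrix B b j) =
        gK hη g * LinearMap.toMatrix B' B' M a b := by
      rw [hg]
      ring
    rw [this]
    exact mul_mem (gK_mem (hOW hq) g) (hM' a b)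
  choose O h hp hOW h0 hO using key
  obtain ⟨t, ht⟩ := hW.isCompact.elim_finite_subcover (fun p => (O p : Set (P1 k)))
    (fun p => (O p).isOpen) fun p hp' => Set.mem_iUnion.2 ⟨⟨p, hp'⟩, hp _⟩
  have : Nonempty W := ⟨⟨_, hη⟩⟩
  refine ⟨∏ p ∈ t, h p, Finset.prod_ne_zero_iff.2 fun p _ => h0 p, fun q hq M hM i j => ?_⟩
  obtain ⟨p, hpt, hq'⟩ := Set.mem_iUnion₂.1 (ht hq)
  classical
  rw [← Finset.mul_prod_erase t h hpt, map_mul, mul_right_comm]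
  exact mul_mem (hO p q hq' M hM i j) (gK_mem hq _)

/-- After multiplication by a common denominator the sections embed linearly into matrices of
functions on π⁻¹(U). These form a finite module over the noetherian ring of functions on U, so every
submodule is finite. -/
theorem orderSheaf_finite (U : X.C.Opens) (hU : IsAffineOpen U) :
    Module.Finite Γ(X.C, U) ((orderSheaf X V I).sec U) := by
  by_cases hη : genericPoint (P1 k) ∈ X.π ⁻¹ᵁ U
  swap
  · have := subsingleton_sec (V := V) (I := I) hη
    infer_instance
  have := X.π_finite
  have hW : IsAffineOpen (X.π ⁻¹ᵁ U) := hU.preimage X.π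
  have := isNoetherianRing_section hU
  let : Algebra Γ(X.C, U) Γ(P1 k, X.π ⁻¹ᵁ U) := (X.π.app U).hom.toAlgebra
  have : Module.Finite Γ(X.C, U) Γ(P1 k, X.π ⁻¹ᵁ U) := X.π.finite_app U hU
  obtain ⟨U₀, hη₀, e₀, he₀⟩ := hV.exists_isFrame (genericPoint (P1 k))
  set B := he₀.genBasis hη₀
  obtain ⟨h, h0, hh⟩ := exists_mul_toMatrix_mem hV hW hη B
  choose φ hφ using fun (a : (orderSheaf X V I).sec U) (i j : Fin n) =>
    exists_gK_eq hη fun p hp => hh p hp (oE hη a) (isRegularEnd_oE hη a hp) i j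
  let Φ : (orderSheaf X V I).sec U →ₗ[Γ(X.C, U)] (Fin n → Fin n → Γ(P1 k, X.π ⁻¹ᵁ U)) :=
    { toFun := φ
      map_add' := fun a b => by
        ext i j
        apply gK_injective hη
        rw [Pi.add_apply, Pi.add_apply, map_add, hφ, hφ, hφ, map_add, map_add, Matrix.add_apply,
          mul_add]
      map_smul' := fun f a => by
        ext i j
        apply gK_injective hη
        have e : gK hη (f • φ a i j) = kC hη f * gK hη (φ a i j) := by
          rw [Algebra.smul_def, map_mul]
          rfl
        rw [Pi.smul_apply, Pi.smul_apply, RingHom.id_apply, e, hφ, hφ, oE_smul, map_smul,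
          Matrix.smul_apply, smul_eq_mul, mul_left_comm] }
  have hΦ : Function.Injective Φ := by
    intro a b hab
    apply oE_injective (I := I) hV hη
    apply (LinearMap.toMatrix B B).injective
    ext i j
    have e := congrArg (gK hη) (congrFun (congrFun hab i) j)
    change gK hη (φ a i j) = gK hη (φ b i j) at e
    rw [hφ, hφ] at e
    exact mul_left_cancel₀ ((map_ne_zero_iff _ (gK_injective hη)).2 h0) e
  exact Module.Finite.of_injective Φ hΦ

end Finiteness

section GenericStalk

/-! ### The generic stalk of the order -/

/-- A compatible family of injective maps that jointly reaches all of `R` exhibits `R` as the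
filtered colimit. -/
theorem exists_stalk_ringEquiv {T : TopCat.{u}} (F : TopCat.Presheaf RingCat.{u} T) (x : T)
    {R : Type u} [Ring R] (r : ∀ U : Opens T, x ∈ U → F.obj (op U) →+* R)
    (hres : ∀ (U U' : Opens T) (h : U' ≤ U) (hx : x ∈ U') (a : F.obj (op U)),
      r U' hx (F.map (homOfLE h).op a) = r U (h hx) a)
    (inj : ∀ U hx, Function.Injective (r U hx)) (surj : ∀ y, ∃ U hx a, r U hx a = y) :
    ∃ e : F.stalk x ≃+* R, ∀ U hx a, e (F.germ U x hx a) = r U hx a := by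
  let c : Limits.Cocone ((OpenNhds.inclusion x).op ⋙ F) :=
    { pt := RingCat.of R
      ι :=
        { app := fun U => RingCat.ofHom (r U.unop.1 U.unop.2)
          naturality := fun U U' i => by
            ext a
            exact hres _ _ i.unop.le U'.unop.2 a } }
  let φ : F.stalk x ⟶ RingCat.of R := Limits.colimit.desc _ c
  have hφ : ∀ U hx a, φ (F.germ U x hx a) = r U hx a := fun U hx a =>
    ConcreteCategory.congr_hom (Limits.colimit.ι_desc c (op (⟨U, hx⟩ : OpenNhds x))) a
  refine ⟨RingEquiv.ofBijective φ.hom ⟨?_, fun y => ?_⟩, hφ⟩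
  · rw [injective_iff_map_eq_zero]
    intro s hs
    obtain ⟨U, hx, a, rfl⟩ := F.exists_germ_eq s
    have h0 := (hφ U hx a).symm.trans hs
    rw [(map_eq_zero_iff _ (inj U hx)).1 h0, map_zero]
  · obtain ⟨U, hx, a, rfl⟩ := surj y
    exact ⟨F.germ U x hx a, hφ U hx a⟩

variable {k : Type u} [Field k] {X : NodalCurve k} {V : (P1 k).Modules}
  {I : Subalgebra k (Module.End k (Fiber V (P1.zero k)) × Module.End k (Fiber V (P1.infty k)))}

/-- π is birational: every rational function on the line is regular on an open set that avoids 0 and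
∞, and there it is a function on C. -/
theorem exists_functionField_ringEquiv (X : NodalCurve k) :
    ∃ e : X.C.functionField ≃+* (P1 k).functionField, ∀ (U : X.C.Opens) (h : genericPoint X.C ∈ U)
      (f : Γ(X.C, U)), e (X.C.presheaf.germ U _ h f) = kC (X.genericPoint_mem_iff.2 h) f := by
  let φ : X.C.functionField ⟶ (P1 k).functionField :=
    X.C.presheaf.stalkSpecializes (specializes_of_eq X.π_genericPoint) ≫
      X.π.stalkMap (genericPoint (P1 k))
  have hφ : ∀ (U : X.C.Opens) (h : genericPoint X.C ∈ U) (f : Γ(X.C, U)),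
      φ (X.C.presheaf.germ U _ h f) = kC (X.genericPoint_mem_iff.2 h) f := by
    intro U h f
    have h' : X.π (genericPoint (P1 k)) ∈ U := X.genericPoint_mem_iff.2 h
    have e1 := ConcreteCategory.congr_hom (X.C.presheaf.germ_stalkSpecializes h
      (specializes_of_eq X.π_genericPoint)) f
    have e2 := ConcreteCategory.congr_hom (X.π.germ_stalkMap U (genericPoint (P1 k)) h') f
    exact (congrArg (X.π.stalkMap (genericPoint (P1 k))) e1).trans e2
  refine ⟨RingEquiv.ofBijective φ.hom ⟨RingHom.injective _, fun y => ?_⟩, hφ⟩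
  obtain ⟨U, h, s, rfl⟩ := exists_kC X y
  exact ⟨_, hφ U (X.genericPoint_mem_iff.1 h) s⟩

theorem NodalCurve.exists_le_preimage_eq (X : NodalCurve k) {U₀ : X.C.Opens} {W : (P1 k).Opens}
    (hle : W ≤ X.π ⁻¹ᵁ U₀) (h : P1.zero k ∈ W ↔ P1.infty k ∈ W) :
    ∃ U ≤ U₀, X.π ⁻¹ᵁ U = W := by
  obtain ⟨U, rfl⟩ := X.exists_preimage_eq W h
  refine ⟨U, fun q hq => ?_, rfl⟩
  obtain ⟨p, rfl⟩ := X.π_surjective q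
  exact hle hq

theorem exists_open_isRegularEnd {n : ℕ} (hV : IsVectorBundle V n) {p : P1 k}
    {M : Module.End (P1 k).functionField (GenFiber V)} (hM : IsRegularEnd p M) :
    ∃ O : (P1 k).Opens, p ∈ O ∧ ∀ q ∈ O, IsRegularEnd q M := by
  obtain ⟨U, hp, e, he⟩ := hV.exists_isFrame p
  choose f hf using (he.isRegularEnd_iff hp).1 hM
  obtain ⟨O, hO, hpO, g, hg⟩ := exists_common_germ hp fun x : Fin n × Fin n => f x.1 x.2
  refine ⟨O, hpO, fun q hq => (he.isRegularEnd_iff (hO hq)).2 fun i j => ?_⟩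
  rw [← hf, ← hg (i, j), toK_germ]
  exact gK_mem hq _

/-- Regularity at p spreads to a neighborhood; discarding 0 and ∞ from it gives the preimage of an
open set of C without the node, where I imposes no condition. -/
theorem exists_oE_of_isRegularEnd {n : ℕ} (hV : IsVectorBundle V n) {U₀ : X.C.Opens} {p : P1 k}
    (hp : p ∈ X.π ⁻¹ᵁ U₀) (hp0 : p ≠ P1.zero k) (hp1 : p ≠ P1.infty k)
    {M : Module.End (P1 k).functionField (GenFiber V)} (hM : IsRegularEnd p M) :
    ∃ (U : X.C.Opens) (_ : U ≤ U₀) (hpU : p ∈ X.π ⁻¹ᵁ U) (a : (orderSheaf X V I).sec U),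
      oE (P1.genericPoint_mem hpU) a = M := by
  obtain ⟨O, hpO, hO⟩ := exists_open_isRegularEnd hV hM
  have h0 : P1.zero k ∉ (O ⊓ X.π ⁻¹ᵁ U₀) ⊓ (P1.chart k 0 ⊓ P1.chart k 1) := fun h =>
    P1.coordPoint_notMem_chart 1 h.2.2
  have h1 : P1.infty k ∉ (O ⊓ X.π ⁻¹ᵁ U₀) ⊓ (P1.chart k 0 ⊓ P1.chart k 1) := fun h =>
    P1.coordPoint_notMem_chart 0 h.2.1
  obtain ⟨U, hle, hU⟩ := X.exists_le_preimage_eq (inf_le_left.trans inf_le_right)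
    (iff_of_false h0 h1)
  have hpU : p ∈ X.π ⁻¹ᵁ U :=
    hU ▸ ⟨⟨hpO, hp⟩, P1.mem_chart_of_ne 0 p hp1, P1.mem_chart_of_ne 1 p hp0⟩
  obtain ⟨a, ha⟩ := exists_oE_eq (I := I) hV (P1.genericPoint_mem hpU) (M := M) (fun q hq => by
    rw [hU] at hq
    exact hO q hq.1.1) (fun hq => (h0 (hU ▸ X.zero_mem hq)).elim)
  exact ⟨U, hle, hpU, a, ha⟩

theorem exists_oE_of_hasEndVal {n : ℕ} (hV : IsVectorBundle V n) {U₀ : X.C.Opens}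
    (hq : X.node ∈ U₀) {M : Module.End (P1 k).functionField (GenFiber V)}
    {x : Module.End k (Fiber V (P1.zero k)) × Module.End k (Fiber V (P1.infty k))} (hx : x ∈ I)
    (h0 : HasEndVal (P1.zero k) M x.1) (h1 : HasEndVal (P1.infty k) M x.2) :
    ∃ (U : X.C.Opens) (_ : U ≤ U₀) (hU : X.node ∈ U) (a : (orderSheaf X V I).sec U),
      oE (P1.genericPoint_mem (X.zero_mem hU)) a = M := by
  obtain ⟨O, hpO, hO⟩ := exists_open_isRegularEnd hV (h0.isRegularEnd hV)
  obtain ⟨O', hpO', hO'⟩ := exists_open_isRegularEnd hV (h1.isRegularEnd hV)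
  -- The union of the two neighborhoods contains both points, hence is saturated inside π⁻¹(U₀), and
  -- M is regular at each of its points.
  have h0' : P1.zero k ∈ (O ⊔ O') ⊓ X.π ⁻¹ᵁ U₀ := ⟨Or.inl hpO, X.zero_mem hq⟩
  have h1' : P1.infty k ∈ (O ⊔ O') ⊓ X.π ⁻¹ᵁ U₀ := ⟨Or.inr hpO', X.infty_mem hq⟩
  obtain ⟨U, hle, hU⟩ := X.exists_le_preimage_eq inf_le_right (iff_of_true h0' h1')
  have hqU : X.node ∈ U := X.zero_mem_iff.1 (hU ▸ h0')
  obtain ⟨a, ha⟩ := exists_oE_eq (I := I) hV (P1.genericPoint_mem (X.zero_mem hqU)) (M := M)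
    (fun p hp => by
      rw [hU] at hp
      exact hp.1.elim (hO p) (hO' p)) (fun _ => ⟨x, hx, h0, h1⟩)
  exact ⟨U, hle, hqU, a, ha⟩

theorem localRing_genericPoint (f : (P1 k).functionField) :
    f ∈ localRing (genericPoint (P1 k)) := by
  obtain ⟨W, h, s, rfl⟩ := exists_gK f
  exact gK_mem h s

theorem isRegularEnd_genericPoint {n : ℕ} (hV : IsVectorBundle V n)
    (M : Module.End (P1 k).functionField (GenFiber V)) :
    IsRegularEnd (genericPoint (P1 k)) M := by
  obtain ⟨U, hp, e, he⟩ := hV.exists_isFrame (genericPoint (P1 k))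
  exact (he.isRegularEnd_iff hp).2 fun _ _ => localRing_genericPoint _

theorem genericPoint_ne_coordPoint (i : Fin 2) : genericPoint (P1 k) ≠ P1.coordPoint k i := by
  intro h
  have h1 := P1.genericPoint_mem_chart (k := k) (i + 1)
  rw [h, add_assoc, show (1 : Fin 2) + 1 = 0 from rfl, add_zero] at h1
  exact P1.coordPoint_notMem_chart i h1

/-- Whatever I is, the order is generically the full endomorphism algebra, so identities between
generic endomorphisms can be tested on sections. -/
theorem exists_oE {n : ℕ} (hV : IsVectorBundle V n) {U₀ : X.C.Opens}
    (h₀ : genericPoint (P1 k) ∈ X.π ⁻¹ᵁ U₀)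
    (M : Module.End (P1 k).functionField (GenFiber V)) :
    ∃ (U : X.C.Opens) (_ : U ≤ U₀) (h : genericPoint (P1 k) ∈ X.π ⁻¹ᵁ U)
      (a : (orderSheaf X V I).sec U), oE h a = M :=
  exists_oE_of_isRegularEnd hV h₀ (genericPoint_ne_coordPoint 1) (genericPoint_ne_coordPoint 0)
    (isRegularEnd_genericPoint hV M)

variable {n : ℕ} (hV : IsVectorBundle V n)

include hV

theorem orderSheaf_generic : ∃ e : (orderSheaf X V I).presheaf.stalk (genericPoint X.C) ≃+*
      Matrix (Fin n) (Fin n) X.C.functionField,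
    ∀ (U : X.C.Opens) (h : genericPoint X.C ∈ U) (f : Γ(X.C, U)),
      e ((orderSheaf X V I).presheaf.germ U _ h ((orderSheaf X V I).unit U f)) =
        Matrix.scalar (Fin n) (X.C.presheaf.germ U _ h f) := by
  obtain ⟨e, he⟩ := exists_stalk_ringEquiv (orderSheaf X V I).presheaf (genericPoint X.C)
    (fun U h => oE (X.genericPoint_mem_iff.2 h))
    (fun U U' h hx a => oE_res h (X.genericPoint_mem_iff.2 hx) a)
    (fun U hx => oE_injective hV _) (fun M => by
      obtain ⟨U, -, h, a, ha⟩ := exists_oE (I := I) (X := X) (U₀ := ⊤) hV trivial M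
      exact ⟨U, X.genericPoint_mem_iff.1 h, a, ha⟩)
  obtain ⟨φ, hφ⟩ := exists_functionField_ringEquiv X
  obtain ⟨O, hη, b, hb⟩ := hV.exists_isFrame (genericPoint (P1 k))
  let B := hb.genBasis hη
  refine ⟨e.trans ((LinearMap.toMatrixAlgEquiv B).toRingEquiv.trans φ.symm.mapMatrix),
    fun U h f => ?_⟩
  have h1 : e ((orderSheaf X V I).presheaf.germ U _ h ((orderSheaf X V I).unit U f)) =
      algebraMap _ _ (φ (X.C.presheaf.germ U _ h f)) := by
    rw [hφ, he]
    exact oE_unit _ f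
  simp only [RingEquiv.trans_apply]
  rw [h1]
  have h2 : (LinearMap.toMatrixAlgEquiv B).toRingEquiv
      (algebraMap _ _ (φ (X.C.presheaf.germ U _ h f))) =
        Matrix.scalar (Fin n) (φ (X.C.presheaf.germ U _ h f)) :=
    (LinearMap.toMatrixAlgEquiv B).commutes _
  rw [h2]
  ext i j
  by_cases hij : i = j <;> simp [hij]

theorem orderSheaf_isOrder (hn : 0 < n) : (orderSheaf X V I).IsOrder where
  isSheaf := orderSheaf_isSheaf hV
  torsionFree := orderSheaf_torsionFree hV
  finite := orderSheaf_finite hV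
  exists_pow_smul_eq_zero U _ := orderSheaf_exists_pow_smul_eq_zero hV U
  exists_pow_smul_eq_res := orderSheaf_exists_pow_smul_eq_res hV
  generic := ⟨n, hn, orderSheaf_generic hV⟩

end GenericStalk

section TraceForm

/-! ### Trace forms and maximal isotropic subspaces -/

theorem end_eq_of_trace_mul_eq {K E ι : Type*} [Field K] [AddCommGroup E] [Module K E]
    [Fintype ι] [DecidableEq ι] (b : Module.Basis ι K E) {x y : Module.End K E}
    (h : ∀ z, LinearMap.trace K E (z * x) = LinearMap.trace K E (z * y)) : x = y := by
  apply (LinearMap.toMatrix b b).injective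
  rw [Matrix.ext_iff_trace_mul_left]
  intro A
  have h1 := h (Matrix.toLin b b A)
  simpa [LinearMap.trace_eq_matrix_trace _ b, LinearMap.toMatrix_mul] using h1

/-- The trace form is nondegenerate, so by equality of dimensions it identifies the endomorphism
algebra with its dual. -/
theorem exists_eq_trace_mul {K E ι : Type*} [Field K] [AddCommGroup E] [Module K E]
    [Fintype ι] [DecidableEq ι] (b : Module.Basis ι K E) (f : Module.End K E →ₗ[K] K) :
    ∃ y, ∀ x, f x = LinearMap.trace K E (x * y) := by
  have : Module.Finite K E := Module.Finite.of_basis b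
  let T : Module.End K E →ₗ[K] Module.Dual K (Module.End K E) :=
    ((LinearMap.mul K (Module.End K E)).compr₂ (LinearMap.trace K E)).flip
  have hT : Function.Injective T := fun x y hxy => end_eq_of_trace_mul_eq b fun z =>
    LinearMap.congr_fun hxy z
  obtain ⟨y, hy⟩ := (LinearMap.injective_iff_surjective_of_finrank_eq_finrank
    (Subspace.dual_finrank_eq).symm).1 hT f
  exact ⟨y, fun x => (LinearMap.congr_fun hy x).symm⟩

variable {k : Type u} [Field k] {W₁ : Type v} {W₂ : Type w}
  [AddCommGroup W₁] [Module k W₁] [AddCommGroup W₂] [Module k W₂]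

/-- The pairing as a bilinear form. -/
def trForm : LinearMap.BilinForm k (Module.End k W₁ × Module.End k W₂) :=
  (((LinearMap.mul k (Module.End k W₁)).compr₂ (LinearMap.trace k W₁)).compl₁₂
    (LinearMap.fst k _ _) (LinearMap.fst k _ _)) -
  (((LinearMap.mul k (Module.End k W₂)).compr₂ (LinearMap.trace k W₂)).compl₁₂
    (LinearMap.snd k _ _) (LinearMap.snd k _ _))

theorem trForm_apply (x y : Module.End k W₁ × Module.End k W₂) : trForm x y = trPairing x y := rfl

theorem trPairing_comm (x y : Module.End k W₁ × Module.End k W₂) :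
    trPairing x y = trPairing y x := by
  rw [trPairing, trPairing, LinearMap.trace_mul_comm, LinearMap.trace_mul_comm k x.2]

theorem ker_trForm [Module.Finite k W₁] [Module.Finite k W₂] :
    (trForm : LinearMap.BilinForm k (Module.End k W₁ × Module.End k W₂)).ker = ⊥ := by
  rw [LinearMap.ker_eq_bot']
  rintro ⟨x, y⟩ h
  refine Prod.ext (end_eq_of_trace_mul_eq (Module.finBasis k W₁) fun z => ?_)
    (end_eq_of_trace_mul_eq (Module.finBasis k W₂) fun z => ?_)
  · have := LinearMap.congr_fun h (z, 0)
    rw [trForm_apply, trPairing] at this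
    simpa [LinearMap.trace_mul_comm k x] using this
  · have := LinearMap.congr_fun h (0, z)
    rw [trForm_apply, trPairing] at this
    simpa [LinearMap.trace_mul_comm k y] using this

theorem IsIsotropic.sup_span_singleton {J : Submodule k (Module.End k W₁ × Module.End k W₂)}
    (hJ : IsIsotropic J) {x : Module.End k W₁ × Module.End k W₂}
    (hx : ∀ y ∈ J, trPairing y x = 0) (hxx : trPairing x x = 0) :
    IsIsotropic (J ⊔ Submodule.span k {x}) := by
  intro a ha b hb
  obtain ⟨a, ha', _, hc, rfl⟩ := Submodule.mem_sup.1 ha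
  obtain ⟨b, hb', _, hd, rfl⟩ := Submodule.mem_sup.1 hb
  obtain ⟨c, rfl⟩ := Submodule.mem_span_singleton.1 hc
  obtain ⟨d, rfl⟩ := Submodule.mem_span_singleton.1 hd
  have h1 : trForm a b = 0 := hJ a ha' b hb'
  have h2 : trForm a x = 0 := hx a ha'
  have h3 : trForm x b = 0 := (trPairing_comm x b).trans (hx b hb')
  have h4 : trForm x x = 0 := hxx
  rw [← trForm_apply]
  simp [h1, h2, h3, h4]

/-- A maximal isotropic subspace for the pairing is its own orthogonal. -/
theorem mem_of_isMaximalIsotropic [IsAlgClosed k] [CharZero k] [Module.Finite k W₁]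
    [Module.Finite k W₂]
    (hW : Module.finrank k W₁ = Module.finrank k W₂)
    {J : Submodule k (Module.End k W₁ × Module.End k W₂)}
    (hJ : Maximal IsIsotropic J) {x : Module.End k W₁ × Module.End k W₂}
    (hx : ∀ y ∈ J, trPairing y x = 0) : x ∈ J := by
  -- Maximality: an isotropic vector orthogonal to J can be adjoined to J.
  have key : ∀ z, (∀ y ∈ J, trPairing y z = 0) → trPairing z z = 0 → z ∈ J := fun z hz hzz =>
    hJ.le_of_ge (hJ.prop.sup_span_singleton hz hzz) le_sup_left
      (Submodule.mem_sup_right (Submodule.mem_span_singleton_self z))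
  by_contra hxJ
  have hxx : trForm x x ≠ 0 := fun h => hxJ (key x hx h)
  -- If x is orthogonal to J but not isotropic, any other orthogonal vector y can be moved into J
  -- along x: the condition that y + t x be isotropic is a quadratic equation in t, which has a root
  -- over k.
  have h1 : trForm.orthogonal J = J ⊔ Submodule.span k {x} := by
    apply le_antisymm
    · intro y hy
      obtain ⟨t, ht⟩ := exists_quadratic_eq_zero (a := trForm x x)
        (b := 2 * trForm x y) (c := trForm y y) hxx (IsAlgClosed.exists_eq_mul_self _)
      have h2 : y + t • x ∈ J := by
        refine key _ (fun z hz => ?_) ?_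
        · have h3 := hy z hz
          have h4 := hx z hz
          rw [← trForm_apply] at h4 ⊢
          rw [map_add, map_smul, h4]
          simpa using h3
        · rw [← trForm_apply, ← ht]
          have h5 : trForm y x = trForm x y := trPairing_comm y x
          simp only [map_add, map_smul, LinearMap.add_apply, LinearMap.smul_apply, smul_eq_mul, h5]
          ring
      have h3 : y = (y + t • x) + (-t) • x := by module
      rw [h3]
      exact add_mem (Submodule.mem_sup_left h2) (Submodule.mem_sup_right
        (Submodule.smul_mem _ _ (Submodule.mem_span_singleton_self x)))
    · refine sup_le (fun y hy z hz => hJ.prop z hz y hy) ?_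
      rw [Submodule.span_singleton_le_iff_mem]
      exact fun y hy => hx y hy
  have h2 := LinearMap.BilinForm.finrank_add_finrank_orthogonal'
    (B := (trForm : LinearMap.BilinForm k (Module.End k W₁ × Module.End k W₂))) J
  have h3 : Module.finrank k (J ⊔ Submodule.span k {x} : Submodule k _) =
      Module.finrank k J + 1 := by
    have h4 := Submodule.finrank_sup_add_finrank_inf_eq J (Submodule.span k {x})
    have h5 : x ≠ 0 := fun h => hxJ (h ▸ J.zero_mem)
    rw [finrank_span_singleton h5, (Submodule.disjoint_span_singleton' h5).2 hxJ |>.eq_bot,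
      finrank_bot, add_zero] at h4
    exact h4
  -- The dimensions of J and its orthogonal would differ by one, but by nondegeneracy their sum is
  -- twice the square of dim W₂, which is even.
  rw [ker_trForm, inf_bot_eq, finrank_bot, h1, h3, Module.finrank_prod, Module.finrank_linearMap,
    Module.finrank_linearMap, hW] at h2
  omega

end TraceForm

section TraceMorphism

variable {k : Type u} [Field k] {X : NodalCurve k} {V : (P1 k).Modules}
  {I : Subalgebra k (Module.End k (Fiber V (P1.zero k)) × Module.End k (Fiber V (P1.infty k)))}
  {n : ℕ} (hV : IsVectorBundle V n)

/-! ### Prescribing values at the two points -/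

include hV in
/-- There are functions with value `1` at one of the two points that vanish to high order at
the other point. -/
theorem exists_cutoff (i : Fin 2) (M : Module.End (P1 k).functionField (GenFiber V)) (r : ℕ) :
    ∃ g : (P1 k).functionField, HasVal (P1.coordPoint k i) g 1 ∧ ∀ l ≤ r,
      IsRegularEnd (P1.coordPoint k (i + 1)) (coord k i ^ l • g • M) := by
  obtain ⟨m, hm⟩ := exists_coord_pow_smul_isRegularEnd hV (i + 1) M
  -- m absorbs the pole of M at the other point, r the factor t ^ l, and the final 1 makes t ^ N
  -- vanish at the first point.
  set N := m + r + 1 with hN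
  set t := coord k i with ht
  have hs : coord k (i + 1) = t⁻¹ := coord_add_one i
  have ht0 : t ≠ 0 := coord_ne_zero i
  have h1 : HasVal (P1.coordPoint k i) (1 + t ^ N) 1 := by
    simpa [hN] using (hasVal_one _).add ((hasVal_coord (k := k) i).pow N)
  have h2 : HasVal (P1.coordPoint k (i + 1)) (1 + t⁻¹ ^ N) 1 := by
    rw [← hs]
    simpa [hN] using (hasVal_one _).add ((hasVal_coord (k := k) (i + 1)).pow N)
  have h3 : 1 + t ^ N ≠ 0 := fun h => by
    rw [h] at h1
    exact one_ne_zero (h1.unique (hasVal_zero _))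
  have h4 : 1 + t⁻¹ ^ N ≠ 0 := fun h => by
    rw [h] at h2
    exact one_ne_zero (h2.unique (hasVal_zero _))
  -- In terms of s = 1/t this function is s ^ N / (1 + s ^ N): it has value 1 at t = 0 and a zero of
  -- order N at s = 0.
  refine ⟨(1 + t ^ N)⁻¹, ?_, fun l hl => ?_⟩
  · obtain ⟨c, hc⟩ := exists_hasVal (h1.inv_mem one_ne_zero)
    have h5 := h1.mul hc
    rw [mul_inv_cancel₀ h3] at h5
    have h6 := h5.unique (hasVal_one _)
    rw [one_mul] at h6
    exact h6 ▸ hc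
  · have e : t ^ l • (1 + t ^ N)⁻¹ • M = (1 + t⁻¹ ^ N)⁻¹ • (coord k (i + 1)) ^ (N - l) • M := by
      rw [smul_smul, smul_smul, hs]
      congr 1
      have hl' : N = (N - l) + l := by omega
      generalize N - l = d at hl'
      have hpow : t ^ N = t ^ d * t ^ l := by rw [hl', pow_add]
      rw [inv_pow] at h4 ⊢
      rw [inv_pow, ← div_eq_mul_inv, ← div_eq_mul_inv, eq_comm, inv_eq_one_div, div_div,
        div_eq_div_iff (mul_ne_zero h4 (pow_ne_zero _ ht0)) h3, hpow]
      field_simp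
      ring
    rw [e]
    exact (hm _ (by omega)).smul (h2.inv_mem one_ne_zero)

-- Lifts of α and β exist separately. Multiplied by cutoff functions, each keeps its value at its
-- own point and vanishes at the other one, so that they can be added.
include hV in
theorem exists_hasEndVal_zero_infty (α : Module.End k (Fiber V (P1.zero k)))
    (β : Module.End k (Fiber V (P1.infty k))) :
    ∃ M, HasEndVal (P1.zero k) M α ∧ HasEndVal (P1.infty k) M β := by
  obtain ⟨M, hM⟩ := exists_hasEndVal_eq hV α
  obtain ⟨N, hN⟩ := exists_hasEndVal_eq hV β
  obtain ⟨f, hf, hf'⟩ := exists_cutoff hV 1 M 1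
  obtain ⟨g, hg, hg'⟩ := exists_cutoff hV 0 N 1
  have e0 : coord k 0 = (coord k 1)⁻¹ := coord_add_one 1
  have e1 : coord k 1 = (coord k 0)⁻¹ := coord_add_one 0
  have h0 : HasEndVal (P1.infty k) (f • M) 0 := by
    rw [hasEndVal_zero_iff hV, e0, inv_inv]
    simpa using hf' 1 le_rfl
  have h1 : HasEndVal (P1.zero k) (g • N) 0 := by
    rw [hasEndVal_zero_iff hV, e1, inv_inv]
    simpa using hg' 1 le_rfl
  refine ⟨f • M + g • N, ?_, ?_⟩
  · simpa using (hM.smul hV hf).add hV h1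
  · simpa using h0.add hV (hN.smul hV hg)

-- Since the local trace form is perfect, it suffices that tr(N Y) is regular for all N regular at
-- the point. With a cutoff g, both t g N and t² g N vanish at the two points, so they may be used
-- as tests. The function tr(t g N Y) takes equal values c at the two points. At the other point it
-- is 1/t times the regular function tr(t² g N Y), and 1/t vanishes there, so c = 0. Vanishing at
-- the first point allows division by t, and then by the unit g.
include hV in
theorem isRegularEnd_of_trace_hasVal (i : Fin 2)
    {Y : Module.End (P1 k).functionField (GenFiber V)}
    (H : ∀ N, HasEndVal (P1.coordPoint k i) N 0 → HasEndVal (P1.coordPoint k (i + 1)) N 0 →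
      ∃ c, HasVal (P1.coordPoint k i) (LinearMap.trace _ _ (N * Y)) c ∧
        HasVal (P1.coordPoint k (i + 1)) (LinearMap.trace _ _ (N * Y)) c) :
    IsRegularEnd (P1.coordPoint k i) Y := by
  refine isRegularEnd_of_trace_mem hV fun N hN => ?_
  -- The exponent 3 is needed since t² g N must vanish at the other point, where the local
  -- coordinate is 1/t.
  obtain ⟨g, hg, hg'⟩ := exists_cutoff hV i N 3
  set t := coord k i with ht
  have ht0 : t ≠ 0 := coord_ne_zero i
  have hs : coord k (i + 1) = t⁻¹ := coord_add_one i
  have htm : t ∈ localRing (P1.coordPoint k i) := (hasVal_coord i).mem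
  have key : ∀ l, 1 ≤ l → l ≤ 2 →
      HasEndVal (P1.coordPoint k i) (t ^ l • g • N) 0 ∧
        HasEndVal (P1.coordPoint k (i + 1)) (t ^ l • g • N) 0 := by
    intro l hl hl'
    rw [hasEndVal_zero_iff hV, hasEndVal_zero_iff hV, hs, inv_inv, ← ht]
    obtain ⟨l, rfl⟩ := Nat.exists_eq_add_of_le' hl
    constructor
    · rw [smul_smul, pow_succ', inv_mul_cancel_left₀ ht0]
      exact (hN.smul hg.mem).smul (pow_mem htm l)
    · rw [smul_smul, ← pow_succ']
      exact hg' _ (by omega)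
  have htr : ∀ f : (P1 k).functionField, LinearMap.trace (P1 k).functionField _ ((f • N) * Y) =
      f * LinearMap.trace _ _ (N * Y) := fun f => by
    rw [smul_mul_assoc, map_smul, smul_eq_mul]
  obtain ⟨c, h0, h1⟩ := H _ (key 1 le_rfl one_le_two).1 (key 1 le_rfl one_le_two).2
  obtain ⟨d, -, h2⟩ := H _ (key 2 one_le_two le_rfl).1 (key 2 one_le_two le_rfl).2
  rw [smul_smul, htr] at h0 h1 h2
  have h3 := (hasVal_coord (k := k) (i + 1)).mul h2
  have e : coord k (i + 1) * (t ^ 2 * g * LinearMap.trace _ _ (N * Y)) =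
      t ^ 1 * g * LinearMap.trace _ _ (N * Y) := by
    rw [hs]
    field_simp
  rw [e, zero_mul] at h3
  obtain rfl : c = 0 := h1.unique h3
  have h4 := mul_mem (hasVal_zero_iff.1 h0) (hg.inv_mem one_ne_zero)
  have hg0 : g ≠ 0 := fun h => by
    rw [h] at hg
    exact one_ne_zero (hg.unique (hasVal_zero _))
  have e2 : t ^ 1 * g * LinearMap.trace _ _ (N * Y) * (coord k i)⁻¹ * g⁻¹ =
      LinearMap.trace _ _ (N * Y) := by
    rw [← ht]
    field_simp
  rwa [e2] at h4

/-! ### The trace morphism -/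

/-- Pairing x with the unit of I. This is what makes the trace of a section of the order a function
on C. -/
theorem IsMaximalIsotropic.trace_eq (hI : IsMaximalIsotropic I)
    {x : Module.End k (Fiber V (P1.zero k)) × Module.End k (Fiber V (P1.infty k))} (hx : x ∈ I) :
    LinearMap.trace k _ x.1 = LinearMap.trace k _ x.2 := by
  have h := hI.prop x hx 1 I.one_mem
  rw [trPairing, Prod.fst_one, Prod.snd_one, mul_one, mul_one] at h
  exact sub_eq_zero.1 h

include hV in
theorem exists_kC_eq_trace (hI : IsMaximalIsotropic I) {U : X.C.Opens}
    (h : genericPoint (P1 k) ∈ X.π ⁻¹ᵁ U) (a : (orderSheaf X V I).sec U) :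
    ∃ f : Γ(X.C, U), kC h f = LinearMap.trace _ _ (oE h a) := by
  refine exists_kC_eq h (fun p hp => (isRegularEnd_oE h a hp).trace_mem hV) fun hq => ?_
  obtain ⟨x, hx, h0, h1⟩ := exists_hasEndVal_oE hV h a hq
  exact ⟨_, h0.trace hV, hI.trace_eq hx ▸ h1.trace hV⟩

theorem mem_omega_of_notMem {U : X.C.Opens} (h : genericPoint (P1 k) ∉ X.π ⁻¹ᵁ U)
    (η : (p : (X.π ⁻¹ᵁ U : (P1 k).Opens)) → RatDiff k) : η ∈ omega X U := by
  have : η = 0 := funext fun p => (h (P1.genericPoint_mem p.2)).elim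
  rw [this]
  exact zero_mem _

/-- The morphism `a ↦ tr(a) dt/t`. -/
def traceHom (hI : IsMaximalIsotropic I) : OmegaHom X (orderSheaf X V I) ⊤ where
  app W :=
    { toFun := fun a => ⟨fun p => LinearMap.trace _ _ (oE (P1.genericPoint_mem p.2) a) • dlog k 1,
        by
          by_cases h : genericPoint (P1 k) ∈ X.π ⁻¹ᵁ W.1
          · obtain ⟨f, hf⟩ := exists_kC_eq_trace hV hI h a
            exact (mem_omega_iff h _).2 ⟨f, fun p => by rw [hf]⟩
          · exact mem_omega_of_notMem h _⟩
      map_add' := fun a b => by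
        apply Subtype.ext
        funext p
        change LinearMap.trace _ _ (oE _ (a + b)) • dlog k 1 =
          LinearMap.trace _ _ (oE _ a) • dlog k 1 + LinearMap.trace _ _ (oE _ b) • dlog k 1
        rw [map_add, map_add, add_smul]
      map_smul' := fun f a => by
        apply Subtype.ext
        funext p
        rw [RingHom.id_apply, coe_smul_omega (P1.genericPoint_mem p.2)]
        change LinearMap.trace _ _ (oE _ (f • a)) • dlog k 1 =
          _ • LinearMap.trace _ _ (oE _ a) • dlog k 1
        rw [oE_smul, map_smul, smul_assoc] }
  naturality W W' h a := by
    apply Subtype.ext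
    funext p
    change LinearMap.trace _ _ (oE _ a) • dlog k 1 = LinearMap.trace _ _ (oE _ _) • dlog k 1
    rw [oE_res h (P1.genericPoint_mem p.2)]

theorem traceHom_eval (hI : IsMaximalIsotropic I) {W : X.C.Opens}
    (h : genericPoint (P1 k) ∈ X.π ⁻¹ᵁ W) (a : (orderSheaf X V I).sec W) (p) :
    ((traceHom hV hI).eval a).1 p = LinearMap.trace _ _ (oE h a) • dlog k 1 := rfl

theorem traceHom_nu_app (hI : IsMaximalIsotropic I) {U W : X.C.Opens} (hW : W ≤ U)
    (y : (orderSheaf X V I).sec U) (h : genericPoint (P1 k) ∈ X.π ⁻¹ᵁ W)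
    (a : (orderSheaf X V I).sec W) (p) :
    (((traceHom hV hI).nu U y).app ⟨W, hW⟩ a).1 p =
      LinearMap.trace _ _ (oE h a * oE (X := X) (U := U) (hW h) y) • dlog k 1 := by
  refine (traceHom_eval hV hI h _ p).trans ?_
  rw [← oE_res hW h y, ← map_mul]
  rfl

theorem omega_ext {U : X.C.Opens} {η ξ : omega X U}
    (H : ∀ (h : genericPoint (P1 k) ∈ X.π ⁻¹ᵁ U), η.1 ⟨_, h⟩ = ξ.1 ⟨_, h⟩) : η = ξ := by
  apply Subtype.ext
  funext p
  rw [η.2.1 p ⟨_, P1.genericPoint_mem p.2⟩, ξ.2.1 p ⟨_, P1.genericPoint_mem p.2⟩, H]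

/-- The coefficient `f` of the rational differential `f dt/t`. -/
def dlogCoef (k : Type u) [Field k] : RatDiff k ≃ₗ[(P1 k).functionField] (P1 k).functionField :=
  (LinearEquiv.ofBijective (LinearMap.toSpanSingleton (P1 k).functionField (RatDiff k) (dlog k 1))
    ⟨fun _ _ h => smul_dlog_injective 1 h, fun η => by
      obtain ⟨f, hf⟩ := exists_eq_smul_dlog 1 η
      exact ⟨f, hf.symm⟩⟩).symm

theorem dlogCoef_smul (η : RatDiff k) : dlogCoef k η • dlog k 1 = η :=
  (dlogCoef k).symm_apply_apply η

/-! ### Local homomorphisms to the dualizing sheaf as trace functionals -/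

namespace OmegaHom

variable {U : X.C.Opens} (ψ : OmegaHom X (orderSheaf X V I) U)

/-- The coefficient of `dt/t` in the value of a homomorphism to the dualizing sheaf. -/
def coef {W : X.C.Opens} (hW : W ≤ U) (h : genericPoint (P1 k) ∈ X.π ⁻¹ᵁ W)
    (a : (orderSheaf X V I).sec W) : (P1 k).functionField :=
  dlogCoef k ((ψ.app ⟨W, hW⟩ a).1 ⟨_, h⟩)

variable {ψ} in
theorem coef_smul_dlog {W : X.C.Opens} {hW : W ≤ U} {h : genericPoint (P1 k) ∈ X.π ⁻¹ᵁ W}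
    (a : (orderSheaf X V I).sec W) :
    ψ.coef hW h a • dlog k 1 = (ψ.app ⟨W, hW⟩ a).1 ⟨_, h⟩ := dlogCoef_smul _

theorem coef_add {W : X.C.Opens} (hW : W ≤ U) (h : genericPoint (P1 k) ∈ X.π ⁻¹ᵁ W)
    (a b : (orderSheaf X V I).sec W) : ψ.coef hW h (a + b) = ψ.coef hW h a + ψ.coef hW h b := by
  rw [coef, map_add (ψ.app _)]
  exact map_add (dlogCoef k) _ _

theorem coef_smul {W : X.C.Opens} (hW : W ≤ U) (h : genericPoint (P1 k) ∈ X.π ⁻¹ᵁ W)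
    (f : Γ(X.C, W)) (a : (orderSheaf X V I).sec W) :
    ψ.coef hW h (f • a) = kC h f * ψ.coef hW h a := by
  rw [coef, map_smul (ψ.app _), coe_smul_omega h]
  exact map_smul (dlogCoef k) _ _

theorem coef_res {W W' : X.C.Opens} (hW : W ≤ U) (hle : W' ≤ W)
    (h : genericPoint (P1 k) ∈ X.π ⁻¹ᵁ W') (a : (orderSheaf X V I).sec W) :
    ψ.coef (hle.trans hW) h ((orderSheaf X V I).res hle a) = ψ.coef hW (hle h) a := by
  rw [coef, ← ψ.naturality ⟨W, hW⟩ ⟨W', hle.trans hW⟩ hle a]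
  rfl

include hV in
variable {ψ} in
theorem coef_congr {W W' : X.C.Opens} (hW : W ≤ U) (hW' : W' ≤ U)
    {h : genericPoint (P1 k) ∈ X.π ⁻¹ᵁ W} {h' : genericPoint (P1 k) ∈ X.π ⁻¹ᵁ W'}
    {a : (orderSheaf X V I).sec W} {a' : (orderSheaf X V I).sec W'} (e : oE h a = oE h' a') :
    ψ.coef hW h a = ψ.coef hW' h' a' := by
  have h2 : genericPoint (P1 k) ∈ X.π ⁻¹ᵁ (W ⊓ W') := ⟨h, h'⟩
  have e2 : (orderSheaf X V I).res (inf_le_left : W ⊓ W' ≤ W) a =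
      (orderSheaf X V I).res (inf_le_right : W ⊓ W' ≤ W') a' := by
    apply oE_injective (I := I) hV h2
    rw [oE_res, oE_res, e]
  exact (ψ.coef_res hW inf_le_left h2 a).symm.trans
    ((congrArg (ψ.coef _ h2) e2).trans (ψ.coef_res hW' inf_le_right h2 a'))

-- The coefficient of dt/t depends only on the generic endomorphism of a section, and the sections
-- over small open sets exhaust all generic endomorphisms, so ψ extends to a K-linear functional.
include hV in
theorem exists_coef_eq (hU : genericPoint (P1 k) ∈ X.π ⁻¹ᵁ U) :
    ∃ ℓ : Module.End (P1 k).functionField (GenFiber V) →ₗ[(P1 k).functionField]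
      (P1 k).functionField, ∀ (W : X.C.Opens) (hW : W ≤ U)
      (h : genericPoint (P1 k) ∈ X.π ⁻¹ᵁ W) (a : (orderSheaf X V I).sec W),
      ℓ (oE h a) = ψ.coef hW h a := by
  choose W hW h a ha using exists_oE (I := I) hV hU
  have key : ∀ (O : X.C.Opens) (hO : O ≤ U) (h' : genericPoint (P1 k) ∈ X.π ⁻¹ᵁ O)
      (b : (orderSheaf X V I).sec O),
      ψ.coef (hW (oE h' b)) (h _) (a _) = ψ.coef hO h' b := fun O hO h' b =>
    coef_congr hV _ _ (ha _)
  refine ⟨{ toFun := fun M => ψ.coef (hW M) (h M) (a M), map_add' := ?_, map_smul' := ?_ }, key⟩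
  · intro M N
    obtain ⟨O, hO, hη, b, rfl⟩ := exists_oE (I := I) hV hU M
    obtain ⟨O', hO', hη', b', rfl⟩ := exists_oE (I := I) hV hU N
    have h2 : genericPoint (P1 k) ∈ X.π ⁻¹ᵁ (O ⊓ O') := ⟨hη, hη'⟩
    have hle : O ⊓ O' ≤ U := inf_le_left.trans hO
    rw [← oE_res inf_le_left h2 b, ← oE_res inf_le_right h2 b', ← map_add,
      key _ hle, key _ hle, key _ hle, coef_add]
  · intro f M
    obtain ⟨O, hO, hη, b, rfl⟩ := exists_oE (I := I) hV hU M
    obtain ⟨O', hη', s, rfl⟩ := exists_kC X f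
    have h2 : genericPoint (P1 k) ∈ X.π ⁻¹ᵁ (O ⊓ O') := ⟨hη, hη'⟩
    have hle : O ⊓ O' ≤ U := inf_le_left.trans hO
    rw [← oE_res inf_le_left h2 b, ← kC_res inf_le_right h2 s, ← oE_smul,
      key _ hle, key _ hle, coef_smul, RingHom.id_apply, smul_eq_mul]

include hV in
/-- Every local homomorphism from the order to the dualizing sheaf is of the form
`x ↦ tr(x Y) dt/t`. -/
theorem exists_eq_trace (hU : genericPoint (P1 k) ∈ X.π ⁻¹ᵁ U) :
    ∃ Y : Module.End (P1 k).functionField (GenFiber V), ∀ (W : X.C.Opens) (hW : W ≤ U)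
      (h : genericPoint (P1 k) ∈ X.π ⁻¹ᵁ W) (a : (orderSheaf X V I).sec W),
      (ψ.app ⟨W, hW⟩ a).1 ⟨_, h⟩ = LinearMap.trace _ _ (oE h a * Y) • dlog k 1 := by
  obtain ⟨ℓ, hℓ⟩ := ψ.exists_coef_eq hV hU
  obtain ⟨O, hη, e, he⟩ := hV.exists_isFrame (genericPoint (P1 k))
  obtain ⟨Y, hY⟩ := exists_eq_trace_mul (he.genBasis hη) ℓ
  refine ⟨Y, fun O hO h' b => ?_⟩
  rw [← hY, hℓ O hO, coef_smul_dlog]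

end OmegaHom

theorem exists_kC_eq_trace_mul {U : X.C.Opens} {ψ : OmegaHom X (orderSheaf X V I) U}
    {Y : Module.End (P1 k).functionField (GenFiber V)}
    (hY : ∀ (W : X.C.Opens) (hW : W ≤ U) (h : genericPoint (P1 k) ∈ X.π ⁻¹ᵁ W)
      (a : (orderSheaf X V I).sec W),
      (ψ.app ⟨W, hW⟩ a).1 ⟨_, h⟩ = LinearMap.trace _ _ (oE h a * Y) • dlog k 1)
    (W : X.C.Opens) (hW : W ≤ U) (h : genericPoint (P1 k) ∈ X.π ⁻¹ᵁ W)
    (a : (orderSheaf X V I).sec W) :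
    ∃ f : Γ(X.C, W), kC h f = LinearMap.trace _ _ (oE h a * Y) := by
  obtain ⟨f, hf⟩ := (mem_omega_iff h _).1 (ψ.app ⟨W, hW⟩ a).2
  exact ⟨f, smul_dlog_injective 1 ((hf ⟨_, h⟩).symm.trans (hY W hW h a))⟩

/-- Sections over small open sets give all endomorphisms of the generic fiber, on which the trace
form is nondegenerate. -/
theorem traceHom_nu_injective (hI : IsMaximalIsotropic I) (U : X.C.Opens) :
    Function.Injective ((traceHom (X := X) hV hI).nu U) := by
  intro y y' e
  by_cases hU : genericPoint (P1 k) ∈ X.π ⁻¹ᵁ U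
  · apply oE_injective (I := I) hV hU
    obtain ⟨O, hη, b, hb⟩ := hV.exists_isFrame (genericPoint (P1 k))
    refine end_eq_of_trace_mul_eq (hb.genBasis hη) fun M => ?_
    obtain ⟨W, hW, h, a, rfl⟩ := exists_oE (I := I) hV hU M
    apply smul_dlog_injective 1
    rw [← traceHom_nu_app hV hI hW y h a ⟨_, h⟩, ← traceHom_nu_app hV hI hW y' h a ⟨_, h⟩, e]
  · have := subsingleton_sec (V := V) (I := I) hU
    exact Subsingleton.elim _ _

/-- A homomorphism is x ↦ tr(x Y) dt/t for a generic endomorphism Y, and it remains to see that Y is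
a section of the order: it is regular everywhere by testing against enough sections, and its values
at the two points lie in I because I is its own orthogonal. -/
theorem traceHom_nu_surjective [IsAlgClosed k] [CharZero k] (hI : IsMaximalIsotropic I)
    (U : X.C.Opens) : Function.Surjective ((traceHom (X := X) hV hI).nu U) := by
  intro ψ
  by_cases hU : genericPoint (P1 k) ∈ X.π ⁻¹ᵁ U
  swap
  · refine ⟨0, OmegaHom.ext (funext fun W => LinearMap.ext fun a => omega_ext fun h => ?_)⟩
    exact (hU (W.2 h)).elim
  obtain ⟨Y, hY⟩ := ψ.exists_eq_trace hV hU
  have hY' := exists_kC_eq_trace_mul hY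
  -- An N with values in I is a section of the order near the node, so tr(N Y) is a function on C
  -- there and takes the same value at 0 and ∞.
  have hnode : X.node ∈ U → ∀ N, ∀ x ∈ I, HasEndVal (P1.zero k) N x.1 →
      HasEndVal (P1.infty k) N x.2 → ∃ c, HasVal (P1.zero k) (LinearMap.trace _ _ (N * Y)) c ∧
        HasVal (P1.infty k) (LinearMap.trace _ _ (N * Y)) c := by
    intro hq N x hx h0 h1
    obtain ⟨W, hW, hqW, a, rfl⟩ := exists_oE_of_hasEndVal hV hq hx h0 h1
    obtain ⟨f, hf⟩ := hY' W hW _ a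
    rw [← hf]
    exact exists_hasVal_kC _ hqW f
  have hzero : X.node ∈ U → IsRegularEnd (P1.zero k) Y := fun hq =>
    isRegularEnd_of_trace_hasVal hV 1 fun N h0 h1 => hnode hq N 0 I.zero_mem h0 h1
  have hinfty : X.node ∈ U → IsRegularEnd (P1.infty k) Y := fun hq =>
    isRegularEnd_of_trace_hasVal hV 0 fun N h0 h1 => by
      obtain ⟨c, hc, hc'⟩ := hnode hq N 0 I.zero_mem h1 h0
      exact ⟨c, hc', hc⟩
  obtain ⟨y, hy⟩ := exists_oE_eq (I := I) hV hU (M := Y) (fun p hp => by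
    by_cases hp0 : p = P1.zero k
    · exact hp0 ▸ hzero (X.zero_mem_iff.1 (hp0 ▸ hp))
    by_cases hp1 : p = P1.infty k
    · exact hp1 ▸ hinfty (X.infty_mem_iff.1 (hp1 ▸ hp))
    -- Away from the node every endomorphism regular at p is a section near p, so the perfect local
    -- trace form applies directly.
    refine isRegularEnd_of_trace_mem hV fun N hN => ?_
    obtain ⟨W, hW, hpW, a, rfl⟩ := exists_oE_of_isRegularEnd (I := I) hV hp hp0 hp1 hN
    obtain ⟨f, hf⟩ := hY' W hW _ a
    rw [← hf]
    exact kC_mem _ hpW f) (fun hq => by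
    obtain ⟨α, hα⟩ := exists_hasEndVal hV (hzero hq)
    obtain ⟨β, hβ⟩ := exists_hasEndVal hV (hinfty hq)
    refine ⟨(α, β), ?_, hα, hβ⟩
    have := finite_fiber hV 1
    have := finite_fiber hV 0
    -- Each x in I is the pair of values of some N, and the equality of the values of tr(N Y) at the
    -- two points says that x is orthogonal to (α, β).
    refine mem_of_isMaximalIsotropic ((finrank_fiber hV 1).trans (finrank_fiber hV 0).symm) hI
      fun x hx => ?_
    obtain ⟨N, h0, h1⟩ := exists_hasEndVal_zero_infty hV x.1 x.2
    obtain ⟨c, hc, hc'⟩ := hnode hq N x hx h0 h1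
    have e0 := hc.unique ((h0.mul hα).trace hV)
    have e1 := hc'.unique ((h1.mul hβ).trace hV)
    exact sub_eq_zero.2 (e0.symm.trans e1))
  refine ⟨y, OmegaHom.ext (funext fun W => LinearMap.ext fun a => omega_ext fun h => ?_)⟩
  rw [traceHom_nu_app hV hI W.2 y h a, hY W.1 W.2 h a, hy]

end TraceMorphism

section SphericalOrder

variable {k : Type u} [Field k] {X : NodalCurve k} {V : (P1 k).Modules}
  {I : Subalgebra k (Module.End k (Fiber V (P1.zero k)) × Module.End k (Fiber V (P1.infty k)))}
  {n : ℕ} (hV : IsVectorBundle V n)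

/-! ### Symmetric spherical orders -/

include hV

theorem finrank_genFiber : Module.finrank (P1 k).functionField (GenFiber V) = n := by
  obtain ⟨O, hη, e, he⟩ := hV.exists_isFrame (genericPoint (P1 k))
  simpa using Module.finrank_eq_card_basis (he.genBasis hη)

theorem nontrivial_genFiber (hn : 0 < n) : Nontrivial (GenFiber V) :=
  Module.nontrivial_of_finrank_pos (R := (P1 k).functionField) (by rwa [finrank_genFiber hV])

theorem trace_genFiber_one :
    LinearMap.trace (P1 k).functionField (GenFiber V) 1 = algebraMap k _ (n : k) := by
  obtain ⟨O, hη, e, he⟩ := hV.exists_isFrame (genericPoint (P1 k))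
  have := Module.Finite.of_basis (he.genBasis hη)
  rw [LinearMap.trace_one, finrank_genFiber hV, map_natCast]

/-- The unit section is nonzero because V has positive rank, so it spans the one-dimensional space
of global sections. -/
theorem exists_unit_constSec_eq (hn : 0 < n) (h : (orderSheaf X V I).h0 X.str = 1)
    (y : (orderSheaf X V I).sec ⊤) :
    ∃ c : k, (orderSheaf X V I).unit ⊤ (constSec X.str ⊤ c) = y := by
  have hη : genericPoint (P1 k) ∈ X.π ⁻¹ᵁ (⊤ : X.C.Opens) := trivial
  have := nontrivial_genFiber hV hn
  let : Module k ((orderSheaf X V I).sec ⊤) := Module.compHom _ (constSec X.str ⊤)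
  have h1 : (1 : (orderSheaf X V I).sec ⊤) ≠ 0 := fun h0 => by
    have := congrArg (oE (I := I) hη) h0
    rw [map_one, map_zero] at this
    exact one_ne_zero this
  obtain ⟨c, hc⟩ := (finrank_eq_one_iff_of_nonzero' (1 : (orderSheaf X V I).sec ⊤) h1).1 h y
  refine ⟨c, Eq.trans ?_ hc⟩
  change _ = constSec X.str ⊤ c • (1 : (orderSheaf X V I).sec ⊤)
  rw [Algebra.smul_def, mul_one]
  rfl

theorem orderSheaf_unit_injective (hn : 0 < n) (U : X.C.Opens) :
    Function.Injective ((orderSheaf X V I).unit U) := by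
  have := nontrivial_genFiber hV hn
  by_cases hη : genericPoint (P1 k) ∈ X.π ⁻¹ᵁ U
  · intro f g e
    have e1 := congrArg (oE (I := I) hη) e
    rw [oE_unit, oE_unit] at e1
    exact kC_injective hη ((algebraMap (P1 k).functionField
      (Module.End (P1 k).functionField (GenFiber V))).injective e1)
  · have hU : U = ⊥ := NodalCurve.eq_bot_of_genericPoint_notMem hη
    have : Subsingleton Γ(X.C, U) := by
      subst hU
      exact CommRingCat.subsingleton_of_isTerminal X.C.sheaf.isTerminalOfEmpty
    exact Function.injective_of_subsingleton _

/-- A global function f gives a global section of the order, which is a constant multiple of the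
unit; since 𝒪_C embeds into the order, f is that constant. -/
theorem constSec_bijective (hn : 0 < n) (h : (orderSheaf X V I).h0 X.str = 1) :
    Function.Bijective (constSec X.str ⊤) := by
  constructor
  · intro c d e
    have hη : genericPoint (P1 k) ∈ X.π ⁻¹ᵁ (⊤ : X.C.Opens) := trivial
    have e1 := congrArg (kC hη) e
    rw [kC_constSec, kC_constSec] at e1
    exact (algebraMap k (P1 k).functionField).injective e1
  · intro f
    obtain ⟨c, hc⟩ := exists_unit_constSec_eq (I := I) hV hn h ((orderSheaf X V I).unit ⊤ f)
    exact ⟨c, orderSheaf_unit_injective hV hn ⊤ hc⟩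

theorem traceHom_isNonzero [CharZero k] (hI : IsMaximalIsotropic I) (hn : 0 < n) :
    (traceHom (X := X) hV hI).IsNonzero := by
  have hη : genericPoint (P1 k) ∈ X.π ⁻¹ᵁ (⊤ : X.C.Opens) := trivial
  refine ⟨⊤, 1, fun h0 => ?_⟩
  have e := congrArg (fun η : omega X ⊤ => η.1 ⟨_, hη⟩) h0
  change LinearMap.trace _ _ (oE hη (1 : (orderSheaf X V I).sec ⊤)) • dlog k 1 = 0 at e
  rw [map_one, trace_genFiber_one hV, ← zero_smul (P1 k).functionField (dlog k 1)] at e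
  have e1 := smul_dlog_injective 1 e
  rw [map_eq_zero, Nat.cast_eq_zero] at e1
  exact hn.ne' e1

/-- By duality τ is the image under ν of a global section of the order, and those are constants. -/
theorem exists_eval_eq_smul_traceHom [IsAlgClosed k] [CharZero k] (hI : IsMaximalIsotropic I)
    (hn : 0 < n) (h : (orderSheaf X V I).h0 X.str = 1) (τ : OmegaHom X (orderSheaf X V I) ⊤) :
    ∃ c : k, ∀ (W : X.C.Opens) (a : (orderSheaf X V I).sec W),
      τ.eval a = constSec X.str W c • (traceHom hV hI).eval a := by
  obtain ⟨y, rfl⟩ := traceHom_nu_surjective hV hI ⊤ τ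
  obtain ⟨c, rfl⟩ := exists_unit_constSec_eq hV hn h y
  refine ⟨c, fun W a => omega_ext fun hη => ?_⟩
  have htop : genericPoint (P1 k) ∈ X.π ⁻¹ᵁ (⊤ : X.C.Opens) := trivial
  rw [coe_smul_omega hη, traceHom_eval hV hI hη]
  refine (traceHom_nu_app hV hI le_top _ hη a _).trans ?_
  rw [oE_unit htop, kC_constSec, kC_constSec, Algebra.algebraMap_eq_smul_one (A := Module.End _ _),
    mul_smul_comm, mul_one, map_smul, smul_assoc]

/-- A nonzero τ is a nonzero constant multiple of the trace morphism. Hence every property has to be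
checked for that one only, where symmetry is tr(x y) = tr(y x). -/
theorem isSymmetricSphericalOrder_orderSheaf [IsAlgClosed k] [CharZero k]
    (hI : IsMaximalIsotropic I) (hn : 0 < n) (h : (orderSheaf X V I).h0 X.str = 1) :
    IsSymmetricSphericalOrder X (orderSheaf X V I) := by
  have key : ∀ τ : OmegaHom X (orderSheaf X V I) ⊤, τ.IsNonzero → ∃ c : k, c ≠ 0 ∧
      ∀ (W : X.C.Opens) (a : (orderSheaf X V I).sec W),
        τ.eval a = constSec X.str W c • (traceHom hV hI).eval a := by
    rintro τ ⟨W, a, hne⟩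
    obtain ⟨c, hc⟩ := exists_eval_eq_smul_traceHom hV hI hn h τ
    refine ⟨c, fun h0 => hne ?_, hc⟩
    rw [hc, h0, map_zero, zero_smul]
  refine ⟨orderSheaf_isOrder hV hn, constSec_bijective hV hn h, ⟨_, traceHom_isNonzero hV hI hn⟩,
    fun τ τ' hτ => ?_, fun τ hτ U => ?_, fun τ hτ W x y => ?_⟩
  · obtain ⟨c, hc0, hc⟩ := key τ hτ
    obtain ⟨d, hd⟩ := exists_eval_eq_smul_traceHom hV hI hn h τ'
    refine ⟨d * c⁻¹, fun W a => ?_⟩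
    rw [hc, hd, smul_smul, ← map_mul, inv_mul_cancel_right₀ hc0]
  · obtain ⟨c, hc0, hc⟩ := key τ hτ
    have e : ∀ y, τ.nu U y = (traceHom hV hI).nu U (constSec X.str U c • y) := by
      intro y
      refine OmegaHom.ext (funext fun W => LinearMap.ext fun a => omega_ext fun hη => ?_)
      rw [traceHom_nu_app hV hI W.2 _ hη]
      have e1 : (τ.nu U y).app W a = constSec X.str W.1 c • ((traceHom hV hI).nu U y).app W a :=
        hc W.1 _
      have hη' : genericPoint (P1 k) ∈ X.π ⁻¹ᵁ U := W.2 hη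
      rw [e1, coe_smul_omega hη, traceHom_nu_app hV hI W.2 _ hη, oE_smul hη', kC_constSec,
        kC_constSec, mul_smul_comm, map_smul, smul_assoc]
    have hsmul : Function.Bijective fun y : (orderSheaf X V I).sec U => constSec X.str U c • y := by
      refine Function.bijective_iff_has_inverse.2
        ⟨fun y => constSec X.str U c⁻¹ • y, fun y => ?_, fun y => ?_⟩
      · simp only
        rw [smul_smul, ← map_mul, inv_mul_cancel₀ hc0, map_one, one_smul]
      · simp only
        rw [smul_smul, ← map_mul, mul_inv_cancel₀ hc0, map_one, one_smul]
    have e' : τ.nu U = (traceHom hV hI).nu U ∘ fun y => constSec X.str U c • y := funext e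
    rw [e']
    exact Function.Bijective.comp
      ⟨traceHom_nu_injective hV hI U, traceHom_nu_surjective hV hI U⟩ hsmul
  · obtain ⟨c, -, hc⟩ := key τ hτ
    rw [hc, hc]
    congr 1
    refine omega_ext fun hη => ?_
    rw [traceHom_eval hV hI hη, traceHom_eval hV hI hη, map_mul (oE hη), map_mul (oE hη),
      LinearMap.trace_mul_comm]

/-- A section that commutes with all local sections commutes with all endomorphisms of the generic
fiber, so it is a scalar there; the trace shows that the scalar is a function on C. -/
theorem hasCenterStructureSheaf_orderSheaf [CharZero k] (hI : IsMaximalIsotropic I) (hn : 0 < n) :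
    (orderSheaf X V I).HasCenterStructureSheaf := by
  refine fun U => ⟨orderSheaf_unit_injective hV hn U, fun a => ⟨?_, fun H => ?_⟩⟩
  · rintro ⟨f, rfl⟩ U' hle b
    have e : (orderSheaf X V I).res hle ((orderSheaf X V I).unit U f) = _ :=
      (orderSheaf X V I).unit_res hle f
    rw [e, (orderSheaf X V I).central]
  · by_cases hη : genericPoint (P1 k) ∈ X.π ⁻¹ᵁ U
    swap
    · have := subsingleton_sec (V := V) (I := I) hη
      exact ⟨0, Subsingleton.elim _ _⟩
    have hc : oE hη a ∈ Subalgebra.center (P1 k).functionField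
        (Module.End (P1 k).functionField (GenFiber V)) := by
      rw [Subalgebra.mem_center_iff]
      intro M
      obtain ⟨U', hle, h', b, rfl⟩ := exists_oE (I := I) hV hη M
      have e := congrArg (oE (I := I) h') (H U' hle b)
      rw [map_mul, map_mul, oE_res] at e
      exact e.symm
    rw [Algebra.IsCentral.center_eq_bot, Algebra.mem_bot] at hc
    obtain ⟨f, hf⟩ := hc
    obtain ⟨g, hg⟩ := exists_kC_eq_trace hV hI hη a
    -- If a is the scalar f, then g = tr a = n f, and n is invertible in characteristic zero.
    refine ⟨constSec X.str U (n : k)⁻¹ * g, oE_injective (I := I) hV hη ?_⟩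
    have hn0 : algebraMap k (P1 k).functionField (n : k) ≠ 0 := by
      rw [Ne, map_eq_zero, Nat.cast_eq_zero]
      exact hn.ne'
    rw [oE_unit, ← hf, map_mul, kC_constSec, hg, ← hf, Algebra.algebraMap_eq_smul_one f, map_smul,
      trace_genFiber_one hV, smul_eq_mul, map_inv₀, mul_left_comm, inv_mul_cancel₀ hn0, mul_one,
      Algebra.algebraMap_eq_smul_one]

end SphericalOrder

end NodalOrder

end

theorem proposition1p4 {k : Type u} [Field k] [IsAlgClosed k] [CharZero k] :
    -- `I(P₁, P₂, φ)` is maximal isotropic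
    (∀ (n : ℕ) (W₁ : Type v) (W₂ : Type w) [AddCommGroup W₁] [Module k W₁]
      [AddCommGroup W₂] [Module k W₂],
      Module.finrank k W₁ = n → Module.finrank k W₂ = n →
      ∀ (P₁ : Subalgebra k (Module.End k W₁)) (P₂ : Subalgebra k (Module.End k W₂)),
        NodalOrder.IsParabolic P₁ → NodalOrder.IsParabolic P₂ →
        ∀ φ : NodalOrder.Levi P₁ ≃ₐ[k] NodalOrder.Levi P₂,
          NodalOrder.IsMaximalIsotropic (NodalOrder.gluedSubalgebra P₁ P₂ φ)) ∧
    -- the sheaf of algebras `A(V, I)` for any maximal isotropic subalgebra `I`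
    (∀ (X : NodalOrder.NodalCurve k) (n : ℕ) (V : (NodalOrder.P1 k).Modules), 0 < n →
      NodalOrder.IsVectorBundle V n →
      ∀ I : Subalgebra k (Module.End k (NodalOrder.Fiber V (NodalOrder.P1.zero k)) ×
          Module.End k (NodalOrder.Fiber V (NodalOrder.P1.infty k))),
        NodalOrder.IsMaximalIsotropic I →
          (NodalOrder.orderSheaf X V I).IsOrder ∧
          ((NodalOrder.orderSheaf X V I).h0 X.str = 1 →
            NodalOrder.IsSymmetricSphericalOrder X (NodalOrder.orderSheaf X V I) ∧
            (NodalOrder.orderSheaf X V I).HasCenterStructureSheaf)) ∧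
    -- the sheaf of algebras `A(V, I(P₁, P₂, φ))`
    (∀ (X : NodalOrder.NodalCurve k) (n : ℕ) (V : (NodalOrder.P1 k).Modules), 0 < n →
      NodalOrder.IsVectorBundle V n →
      ∀ (P₁ : Subalgebra k (Module.End k (NodalOrder.Fiber V (NodalOrder.P1.zero k))))
        (P₂ : Subalgebra k (Module.End k (NodalOrder.Fiber V (NodalOrder.P1.infty k)))),
        NodalOrder.IsParabolic P₁ → NodalOrder.IsParabolic P₂ →
        ∀ φ : NodalOrder.Levi P₁ ≃ₐ[k] NodalOrder.Levi P₂,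
          (NodalOrder.orderSheaf X V (NodalOrder.gluedSubalgebra P₁ P₂ φ)).IsOrder ∧
          ((NodalOrder.orderSheaf X V (NodalOrder.gluedSubalgebra P₁ P₂ φ)).h0 X.str = 1 →
            NodalOrder.IsSymmetricSphericalOrder X
              (NodalOrder.orderSheaf X V (NodalOrder.gluedSubalgebra P₁ P₂ φ)) ∧
            (NodalOrder.orderSheaf X V
              (NodalOrder.gluedSubalgebra P₁ P₂ φ)).HasCenterStructureSheaf)) :=
  ⟨fun _ _ _ _ _ _ _ _ _ _ _ h₁ h₂ φ => NodalOrder.isMaximalIsotropic_gluedSubalgebra h₁ h₂ φ,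
    fun _ _ _ hn hV _ hI => ⟨NodalOrder.orderSheaf_isOrder hV hn, fun h =>
      ⟨NodalOrder.isSymmetricSphericalOrder_orderSheaf hV hI hn h,
        NodalOrder.hasCenterStructureSheaf_orderSheaf hV hI hn⟩⟩,
    fun _ _ _ hn hV _ _ h₁ h₂ φ => ⟨NodalOrder.orderSheaf_isOrder hV hn, fun h =>
      ⟨NodalOrder.isSymmetricSphericalOrder_orderSheaf hV
          (NodalOrder.isMaximalIsotropic_gluedSubalgebra h₁ h₂ φ) hn h,
        NodalOrder.hasCenterStructureSheaf_orderSheaf hV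
          (NodalOrder.isMaximalIsotropic_gluedSubalgebra h₁ h₂ φ) hn⟩⟩⟩
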